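/- Let $n\ge 1$ and let $M$ be a connected smooth manifold (Hausdorff, second countable, without boundary) of dimension $2n+1$. Let $\xi\subset TM$ be a contact structure on $M$, i.e. a smooth vector subbundle of rank $2n$ which is maximally non-integrable: for every $p\in M$ the bracket form $$\xi_p\times\xi_p\to T_pM/\xi_p,\qquad (V(p),W(p))\mapsto [V,W](p) \bmod \xi_p$$ ($V,W$ smooth local sections of $\xi$ near $p$) is nondegenerate; equivalently, locally $\xi=\ker\alpha$ for a smooth 1-form $\alpha$ with $\alpha\wedge(d\alpha)^n\neq 0$ everywhere. Let $g$ be any sub-Riemannian metric on $\xi$, i.e. an inner product on each $\xi_p$ depending smoothly on $p$. Let $\mathbb H^n$ be the manifold $\mathbb R^{2n+1}$ with coordinates $x_1,\dots,x_n,y_1,\dots,y_n,t$, with the distribution $\xi^{std}$ spanned by $$X_i=\frac{\partial}{\partial x_i}+2y_i\frac{\partial}{\partial t},\qquad Y_i=\frac{\partial}{\partial y_i}-2x_i\frac{\partial}{\partial t}\qquad(1\le i\le n)$$ and with the sub-Riemannian metric for which $X_1,\dots,X_n,Y_1,\dots,Y_n$ are orthonormal at each point. On either manifold, a horizontal path is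 a smooth path $\gamma:[a,b]\to M$ (with $a<b$) whose velocity lies in the distribution at every time; its Carnot–Carathéodory length is $\int_a^b\sqrt{g(\dot\gamma,\dot\gamma)}\,dt$, and the Carnot–Carathéodory distance $d(p,q)$ is the infimum of the lengths of the horizontal paths from $p$ to $q$. Then for every $p\in M$ there is a smooth embedding $\varphi:\mathbb H^n\to M$ with $\varphi(0)=p$ which is open, which is distributional, i.e. $d\varphi(\xi^{std})\subset\xi$, and which is locally biLipschitz for the Carnot–Carathéodory distances $d_{\mathbb H^n}$ and $d_M$: $\varphi$ is injective and every point of $\mathbb H^n$ has an open neighbourhood $U$ such that $\varphi|_U$ is Lipschitz and its inverse $\varphi(U)\to U$ is Lipschitz. -/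

import Mathlib

open Set Topology MeasureTheory
open scoped Manifold ContDiff ENNReal NNReal

/- Prefer the canonical one-chart manifold structure on a vector space. -/
attribute [local instance 1100] chartedSpaceSelf

noncomputable section

/-! ### Distributions, contact structures, sub-Riemannian metrics -/

section Distributions

variable {E : Type*} [NormedAddCommGroup E] [NormedSpace ℝ E]
  {H : Type*} [TopologicalSpace H] (I : ModelWithCorners ℝ E H)
  {M : Type*} [TopologicalSpace M] [ChartedSpace H M] [IsManifold I ∞ M]

/-- `V`, a (not necessarily continuous) section of the family of subspaces `ξ`, is smooth on `U`
as a vector field on `M`. -/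
def IsSmoothSectionOn (ξ : ∀ p : M, Submodule ℝ (TangentSpace I p)) (V : ∀ p : M, ξ p)
    (U : Set M) : Prop :=
  ContMDiffOn I I.tangent ∞
    (fun p ↦ (⟨p, (V p : TangentSpace I p)⟩ : TangentBundle I M)) U

/-- `ξ` is a distribution of rank `k`: a smooth vector subbundle of rank `k` of the tangent bundle,
that is, near each point it has a smooth frame made of `k` vector fields. -/
def IsDistribution (ξ : ∀ p : M, Submodule ℝ (TangentSpace I p)) (k : ℕ) : Prop :=
  ∀ p : M, ∃ (U : Set M) (V : Fin k → ∀ q : M, ξ q), IsOpen U ∧ p ∈ U ∧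
    (∀ i, IsSmoothSectionOn I ξ (V i) U) ∧
    ∀ q ∈ U, LinearIndependent ℝ (fun i ↦ V i q) ∧
      Submodule.span ℝ (range fun i ↦ V i q) = ⊤

/-- `ξ` is a contact structure on a manifold of dimension `2 * n + 1`: a distribution of rank
`2 * n` which is maximally non-integrable, i.e. the bracket form
`ξ_p × ξ_p → T_p M / ξ_p`, `(V p, W p) ↦ [V, W] p mod ξ_p` is nondegenerate at every point `p`. -/
structure IsContactStructure (ξ : ∀ p : M, Submodule ℝ (TangentSpace I p)) (n : ℕ) : Prop where
  isDistribution : IsDistribution I ξ (2 * n)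
  nondegenerate : ∀ (p : M) (U : Set M) (V : ∀ q : M, ξ q), IsOpen U → p ∈ U →
    IsSmoothSectionOn I ξ V U → V p ≠ 0 →
    ∃ (U' : Set M) (W : ∀ q : M, ξ q), IsOpen U' ∧ p ∈ U' ∧ IsSmoothSectionOn I ξ W U' ∧
      VectorField.mlieBracket I (fun q ↦ (V q : TangentSpace I q))
        (fun q ↦ (W q : TangentSpace I q)) p ∉ ξ p

/-- A sub-Riemannian metric on `ξ`: an inner product on each `ξ_p`, depending smoothly on `p`
(the product of any two smooth local sections of `ξ` is a smooth function). -/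
structure SubRiemannianMetric (ξ : ∀ p : M, Submodule ℝ (TangentSpace I p)) where
  inner : ∀ p : M, ξ p →ₗ[ℝ] ξ p →ₗ[ℝ] ℝ
  symm : ∀ (p : M) (v w : ξ p), inner p v w = inner p w v
  pos : ∀ (p : M) (v : ξ p), v ≠ 0 → 0 < inner p v v
  smooth : ∀ (U : Set M) (V W : ∀ p : M, ξ p), IsOpen U →
    IsSmoothSectionOn I ξ V U → IsSmoothSectionOn I ξ W U →
    ContMDiffOn I 𝓘(ℝ, ℝ) ∞ (fun p ↦ inner p (V p) (W p)) U

/-- `γ`, restricted to `[a, b]`, is a (smooth) horizontal path for `ξ`. -/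
structure IsHorizontalPath (ξ : ∀ p : M, Submodule ℝ (TangentSpace I p)) (a b : ℝ)
    (γ : ℝ → M) : Prop where
  lt : a < b
  smooth : ContMDiffOn 𝓘(ℝ, ℝ) I ∞ γ (Icc a b)
  horizontal : ∀ t ∈ Icc a b,
    (mfderivWithin 𝓘(ℝ, ℝ) I γ (Icc a b) t (1 : ℝ) : TangentSpace I (γ t)) ∈ ξ (γ t)

variable {I}

open Classical in
/-- The norm of a tangent vector: `√(g(v, v))` if `v ∈ ξ_p`, and `∞` otherwise. -/
def SubRiemannianMetric.speed {ξ : ∀ p : M, Submodule ℝ (TangentSpace I p)}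
    (g : SubRiemannianMetric I ξ) (p : M) (v : TangentSpace I p) : ℝ≥0∞ :=
  if h : v ∈ ξ p then ENNReal.ofReal (Real.sqrt (g.inner p ⟨v, h⟩ ⟨v, h⟩)) else ∞

/-- The Carnot–Carathéodory length of a path on `[a, b]`. -/
def SubRiemannianMetric.length {ξ : ∀ p : M, Submodule ℝ (TangentSpace I p)}
    (g : SubRiemannianMetric I ξ) (a b : ℝ) (γ : ℝ → M) : ℝ≥0∞ :=
  ∫⁻ t in Icc a b, g.speed (γ t) (mfderivWithin 𝓘(ℝ, ℝ) I γ (Icc a b) t (1 : ℝ))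

/-- The Carnot–Carathéodory distance: the infimum of the lengths of the horizontal paths
from `p` to `q` (`∞` if there are none). -/
def SubRiemannianMetric.ccDist {ξ : ∀ p : M, Submodule ℝ (TangentSpace I p)}
    (g : SubRiemannianMetric I ξ) (p q : M) : ℝ≥0∞ :=
  sInf {ℓ : ℝ≥0∞ | ∃ (a b : ℝ) (γ : ℝ → M), IsHorizontalPath I ξ a b γ ∧
    γ a = p ∧ γ b = q ∧ ℓ = g.length a b γ}

variable {E' : Type*} [NormedAddCommGroup E'] [NormedSpace ℝ E']
  {H' : Type*} [TopologicalSpace H'] (I' : ModelWithCorners ℝ E' H')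
  {M' : Type*} [TopologicalSpace M'] [ChartedSpace H' M'] (I)

/-- `f : (M', ξ') → (M, ξ)` is an open distributional embedding: an open smooth embedding whose
derivative carries `ξ'` into `ξ`. -/
structure IsOpenDistributionalEmbedding (ξ' : ∀ p : M', Submodule ℝ (TangentSpace I' p))
    (ξ : ∀ p : M, Submodule ℝ (TangentSpace I p)) (f : M' → M) : Prop where
  isSmoothEmbedding : Manifold.IsSmoothEmbedding I' I ∞ f
  isOpenMap : IsOpenMap f
  distributional : ∀ (p : M') (v : TangentSpace I' p), v ∈ ξ' p → mfderiv I' I f p v ∈ ξ (f p)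

end Distributions

/-! ### Lipschitz notions for explicit distance functions -/

section Lipschitz

variable {X Y : Type*}

/-- `U` is open for the distance `d`. -/
def IsOpenForDist (d : X → X → ℝ≥0∞) (U : Set X) : Prop :=
  ∀ x ∈ U, ∃ ε : ℝ≥0∞, 0 < ε ∧ ∀ y, d x y < ε → y ∈ U

/-- `f` restricted to `U` is Lipschitz for the distances `d` and `d'`. -/
def IsLipschitzOn (d : X → X → ℝ≥0∞) (d' : Y → Y → ℝ≥0∞) (f : X → Y) (U : Set X) : Prop :=
  ∃ L : ℝ≥0, ∀ x ∈ U, ∀ y ∈ U, d' (f x) (f y) ≤ L * d x y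

/-- `f` restricted to `U` is biLipschitz for the distances `d` and `d'`: it is Lipschitz and
injective, and its inverse `f(U) → U` is Lipschitz. -/
def IsBiLipschitzOn (d : X → X → ℝ≥0∞) (d' : Y → Y → ℝ≥0∞) (f : X → Y) (U : Set X) : Prop :=
  IsLipschitzOn d d' f U ∧ InjOn f U ∧
    ∃ L : ℝ≥0, ∀ x ∈ U, ∀ y ∈ U, d x y ≤ L * d' (f x) (f y)

/-- `f` is locally biLipschitz: it is injective and each point has an open neighbourhood on which
`f` is biLipschitz (in particular Lipschitz). The neighbourhood is required to be open both for the
distance `d` and for the given topology of `X`. -/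
def IsLocallyBiLipschitz [TopologicalSpace X] (d : X → X → ℝ≥0∞) (d' : Y → Y → ℝ≥0∞)
    (f : X → Y) : Prop :=
  Function.Injective f ∧ ∀ p : X, ∃ U : Set X, IsOpen U ∧ IsOpenForDist d U ∧ p ∈ U ∧
    IsBiLipschitzOn d d' f U

end Lipschitz

/-! ### The Heisenberg group -/

/-- The index set `{x_1, …, x_n, y_1, …, y_n, t}` of the coordinates. -/
abbrev Heisenberg.Index (n : ℕ) : Type := (Fin n ⊕ Fin n) ⊕ Unit

/-- The manifold `ℝ^(2n+1)`, with coordinates `x_1, …, x_n, y_1, …, y_n, t`. -/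
abbrev Heisenberg (n : ℕ) : Type := EuclideanSpace ℝ (Heisenberg.Index n)

namespace Heisenberg

/-- The index of the coordinate `x_i`. -/
abbrev ix {n : ℕ} (i : Fin n) : Index n := Sum.inl (Sum.inl i)

/-- The index of the coordinate `y_i`. -/
abbrev iy {n : ℕ} (i : Fin n) : Index n := Sum.inl (Sum.inr i)

/-- The index of the coordinate `t`. -/
abbrev it {n : ℕ} : Index n := Sum.inr ()

/-- The vector field `X_i = ∂/∂x_i + 2 y_i ∂/∂t`. -/
def X {n : ℕ} (i : Fin n) (p : Heisenberg n) : Heisenberg n :=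
  EuclideanSpace.single (ix i) (1 : ℝ) + (2 * p (iy i)) • EuclideanSpace.single it (1 : ℝ)

/-- The vector field `Y_i = ∂/∂y_i - 2 x_i ∂/∂t`. -/
def Y {n : ℕ} (i : Fin n) (p : Heisenberg n) : Heisenberg n :=
  EuclideanSpace.single (iy i) (1 : ℝ) - (2 * p (ix i)) • EuclideanSpace.single it (1 : ℝ)

/-- The span of the `X_i` and the `Y_i` at `p`. -/
def horizontal (n : ℕ) (p : Heisenberg n) : Submodule ℝ (Heisenberg n) :=
  Submodule.span ℝ (range (fun i ↦ X i p) ∪ range (fun i ↦ Y i p))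

/-- The standard distribution on the Heisenberg group, as a subbundle of the tangent bundle. -/
def distribution (n : ℕ) (p : Heisenberg n) :
    Submodule ℝ (TangentSpace 𝓘(ℝ, Heisenberg n) p) :=
  horizontal n p

/-- The pairing `∑ a_i a'_i + ∑ b_i b'_i` of two vectors with `x`-components `a, a'` and
`y`-components `b, b'`. -/
def pairing (n : ℕ) : Heisenberg n →ₗ[ℝ] Heisenberg n →ₗ[ℝ] ℝ :=
  LinearMap.mk₂ ℝ (fun v w ↦ ∑ i, v (ix i) * w (ix i) + ∑ i, v (iy i) * w (iy i))
    (fun v v' w ↦ by simp [add_mul, Finset.sum_add_distrib]; ring)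
    (fun c v w ↦ by simp [mul_assoc, Finset.mul_sum, mul_add])
    (fun v w w' ↦ by simp [mul_add, Finset.sum_add_distrib]; ring)
    (fun c v w ↦ by simp [mul_left_comm, Finset.mul_sum, mul_add])

theorem pairing_symm {n : ℕ} (v w : Heisenberg n) : pairing n v w = pairing n w v := by
  simp only [pairing, LinearMap.mk₂_apply, mul_comm]

theorem t_eq_of_mem {n : ℕ} {p v : Heisenberg n} (hv : v ∈ horizontal n p) :
    v it = 2 * ∑ i, (p (iy i) * v (ix i) - p (ix i) * v (iy i)) := by
  refine Submodule.span_induction (p := fun v _ ↦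
    v it = 2 * ∑ i, (p (iy i) * v (ix i) - p (ix i) * v (iy i))) ?_ ?_ ?_ ?_ hv
  · rintro _ (⟨i, rfl⟩ | ⟨i, rfl⟩) <;> simp [X, Y]
  · simp
  · intro v w _ _ h h'
    simp only [PiLp.add_apply, h, h', ← mul_add, ← Finset.sum_add_distrib]
    congr 1
    exact Finset.sum_congr rfl fun i _ ↦ by ring
  · intro c v _ h
    simp only [PiLp.smul_apply, h, smul_eq_mul, Finset.mul_sum]
    exact Finset.sum_congr rfl fun i _ ↦ by ring

theorem pairing_pos {n : ℕ} {p v : Heisenberg n} (hv : v ∈ horizontal n p) (h : v ≠ 0) :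
    0 < pairing n v v := by
  have h0 : (0 : ℝ) ≤ ∑ i, v (ix i) * v (ix i) := Finset.sum_nonneg fun i _ ↦ mul_self_nonneg _
  have h1 : (0 : ℝ) ≤ ∑ i, v (iy i) * v (iy i) := Finset.sum_nonneg fun i _ ↦ mul_self_nonneg _
  simp only [pairing, LinearMap.mk₂_apply]
  by_contra hlt
  have e0 : ∑ i, v (ix i) * v (ix i) = 0 := by linarith
  have e1 : ∑ i, v (iy i) * v (iy i) = 0 := by linarith
  rw [Finset.sum_eq_zero_iff_of_nonneg fun i _ ↦ mul_self_nonneg _] at e0 e1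
  have f0 : ∀ i, v (ix i) = 0 := fun i ↦ mul_self_eq_zero.1 (e0 i (Finset.mem_univ i))
  have f1 : ∀ i, v (iy i) = 0 := fun i ↦ mul_self_eq_zero.1 (e1 i (Finset.mem_univ i))
  have ht := t_eq_of_mem hv
  simp only [f0, f1] at ht
  apply h
  ext ((i | i) | i)
  · exact f0 i
  · exact f1 i
  · simpa using ht

/-- The sub-Riemannian metric of the Heisenberg group, for which the `X_i` and `Y_i` are
orthonormal at each point. -/
def metric (n : ℕ) : SubRiemannianMetric 𝓘(ℝ, Heisenberg n) (distribution n) where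
  inner p := (pairing n).domRestrict₁₂ (horizontal n p) (horizontal n p)
  symm p v w := pairing_symm v.1 w.1
  pos p v hv := pairing_pos (p := p) v.2 fun h ↦ hv (Subtype.ext h)
  smooth U V W _ hV hW := by
    have hV' : ContDiffOn ℝ ∞ (fun p ↦ ((V p).1 : Heisenberg n)) U :=
      contMDiffOn_vectorSpace_iff_contDiffOn.1 hV
    have hW' : ContDiffOn ℝ ∞ (fun p ↦ ((W p).1 : Heisenberg n)) U :=
      contMDiffOn_vectorSpace_iff_contDiffOn.1 hW
    rw [contMDiffOn_iff_contDiffOn]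
    have a := fun i ↦ (contDiffOn_piLp 2).1 hV' i
    have b := fun i ↦ (contDiffOn_piLp 2).1 hW' i
    exact (ContDiffOn.sum fun i _ ↦ (a (ix i)).mul (b (ix i))).add
      (ContDiffOn.sum fun i _ ↦ (a (iy i)).mul (b (iy i)))

end Heisenberg

end

set_option maxSynthPendingDepth 3

/-! Contact structures have no local invariants, and the Heisenberg group embeds, as a contact
manifold, in each of its own balls. This produces φ; the metric statement is then a comparison of
lengths on compact sets.

In a chart ξ is the kernel of a contact form (`IsContactStructure.exists_form`). By Darboux
(`exists_darboux_chart`) this kernel is carried near the given point to that of `theta`: a linear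
change of coordinates makes the two forms and their exterior derivatives agree at the point, and
Moser's deformation argument (`exists_moser_map`) does the rest. The smooth flow it needs
(`exists_smooth_flow`) comes from the inverse function theorem in C([0, 1], E), where u ↦ u - ∫ X(s,
u) has derivative 1 minus a Volterra operator.

Darboux only yields a ball of the Heisenberg group. To use the whole group, a contact embedding with
bounded image (`Heisenberg.boundedEmbedding`) is built in the space of one-jets, from two lifted
point transformations with a Legendre transformation between them; a dilation then brings the image
into any ball (`Heisenberg.exists_embedding_ball`).

For the distances, a dimension count shows that dφ identifies the two distributions, and on compact
sets the norms of horizontal vectors are comparable (`exists_speed_comparison`). So paths that stay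
in the image of a ball have comparable lengths on both sides. A path between nearby points may leave
that image, but then its length is bounded below (`IsOpenSmoothEmbedding.le_length_of_not_mapsTo`),
while explicit horizontal curves join the points inside the ball with Euclidean length at most 1
(`Heisenberg.exists_short_horizontalCurve`). Hence `exists_ccDist_le`, which is applied in both
directions. -/

noncomputable section

/-! ### Smoothness of composition operators -/

section Nemytskii

variable {K : Type*} [TopologicalSpace K] [CompactSpace K]
  {G : Type*} [NormedAddCommGroup G] [NormedSpace ℝ G]
  {F : Type*} [NormedAddCommGroup F] [NormedSpace ℝ F]

/-- Pointwise application, as a continuous bilinear map on spaces of continuous functions. -/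
def ContinuousMap.pointwiseApply (K G F : Type*) [TopologicalSpace K] [CompactSpace K]
    [NormedAddCommGroup G] [NormedSpace ℝ G] [NormedAddCommGroup F] [NormedSpace ℝ F] :
    C(K, G →L[ℝ] F) →L[ℝ] C(K, G) →L[ℝ] C(K, F) :=
  LinearMap.mkContinuous₂
    (LinearMap.mk₂ ℝ (fun (A : C(K, G →L[ℝ] F)) (u : C(K, G)) ↦ (⟨fun k ↦ A k (u k), by fun_prop⟩ : C(K, F)))
      (fun A B u ↦ by ext k; simp) (fun c A u ↦ by ext k; simp)
      (fun A u v ↦ by ext k; simp) (fun c A u ↦ by ext k; simp)) 1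
    (fun A u ↦ by
      rw [ContinuousMap.norm_le _ (by positivity)]
      intro k
      simp only [one_mul]
      exact ((A k).le_opNorm _).trans
        (mul_le_mul (A.norm_coe_le_norm k) (u.norm_coe_le_norm k) (norm_nonneg _) (by positivity)))

@[simp] lemma ContinuousMap.pointwiseApply_apply (A : C(K, G →L[ℝ] F)) (u : C(K, G)) (k : K) :
    ContinuousMap.pointwiseApply K G F A u k = A k (u k) := rfl

/-- Compactness of the range of `u` makes the continuity of `f` uniform near it, even where the
space is not locally compact. -/
lemma exists_delta_of_compact_range {K : Type*} [TopologicalSpace K] [CompactSpace K]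
    {G F : Type*} [NormedAddCommGroup G] [NormedAddCommGroup F] {f : G → F} (hf : Continuous f) (u : C(K, G)) {ε : ℝ}
    (hε : 0 < ε) : ∃ δ > 0, ∀ k, ∀ y, ‖y - u k‖ < δ → ‖f y - f (u k)‖ < ε := by
  have h := (isCompact_range u.continuous).uniformContinuousAt_of_continuousAt f
    (fun x _ ↦ hf.continuousAt) (Metric.dist_mem_uniformity hε)
  obtain ⟨δ, hδ, h⟩ := Metric.mem_uniformity_dist.1 h
  refine ⟨δ, hδ, fun k y hy ↦ ?_⟩
  have := h (a := u k) (b := y) (by rwa [dist_comm, dist_eq_norm]) (mem_range_self k)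
  rw [← dist_eq_norm, dist_comm]
  exact this

/-- The mean value inequality bounds the error at `k` by ε‖v k - u k‖ once `fderiv ℝ f` varies by
less than ε on a δ-ball around `u k`. Since δ does not depend on `k`, the bound holds in sup norm.
-/
lemma ContinuousMap.hasFDerivAt_postcomp {f : G → F} (hf : ContDiff ℝ 1 f) (u : C(K, G)) :
    HasFDerivAt (fun v : C(K, G) ↦ (ContinuousMap.comp ⟨f, hf.continuous⟩ v : C(K, F)))
      (ContinuousMap.pointwiseApply K G F
        (ContinuousMap.comp ⟨fderiv ℝ f, hf.continuous_fderiv (by simp)⟩ u)) u := by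
  rw [hasFDerivAt_iff_isLittleO, Asymptotics.isLittleO_iff]
  intro ε hε
  obtain ⟨δ, hδ, h⟩ := exists_delta_of_compact_range (hf.continuous_fderiv (by simp)) u hε
  filter_upwards [Metric.ball_mem_nhds u hδ] with v hv
  rw [mem_ball_iff_norm] at hv
  rw [ContinuousMap.norm_le _ (by positivity)]
  intro k
  have hvk : ‖v k - u k‖ < δ := ((v - u).norm_coe_le_norm k).trans_lt hv
  have key := (convex_ball (u k) δ).norm_image_sub_le_of_norm_hasFDerivWithin_le'
    (f := f) (f' := fderiv ℝ f) (φ := fderiv ℝ f (u k)) (x := u k) (y := v k) (C := ε)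
    (fun x _ ↦ ((hf.differentiable (by simp)) x).hasFDerivAt.hasFDerivWithinAt)
    (fun x hx ↦ (h k x (by rwa [mem_ball_iff_norm] at hx)).le)
    (Metric.mem_ball_self hδ) (by rwa [mem_ball_iff_norm])
  refine key.trans (mul_le_mul_of_nonneg_left ?_ hε.le)
  exact (v - u).norm_coe_le_norm k

/-- The derivative is again a postcomposition, with `fderiv ℝ f`, followed by a continuous linear
map. The target `F` is quantified inside the induction because it becomes `G →L[ℝ] F`. -/
lemma ContinuousMap.contDiff_postcomp_nat {K : Type*} [TopologicalSpace K] [CompactSpace K]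
    {G : Type} [NormedAddCommGroup G] [NormedSpace ℝ G] (n : ℕ) :
    ∀ {F : Type} [NormedAddCommGroup F] [NormedSpace ℝ F] (f : G → F) (hf : ContDiff ℝ n f),
      ContDiff ℝ n (fun v : C(K, G) ↦ (ContinuousMap.comp ⟨f, hf.continuous⟩ v : C(K, F))) := by
  induction n with
  | zero =>
    intro F _ _ f hf
    exact contDiff_zero.2 (ContinuousMap.continuous_postcomp _)
  | succ n ih =>
    intro F _ _ f hf
    have h1 : ContDiff ℝ 1 f := hf.of_le (by simp)
    have h2 : ContDiff ℝ n (fderiv ℝ f) := hf.fderiv_right (by simp)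
    have := contDiff_succ_iff_hasFDerivAt (𝕜 := ℝ) (n := n)
      (f := fun v : C(K, G) ↦ (ContinuousMap.comp ⟨f, hf.continuous⟩ v : C(K, F)))
    push_cast
    rw [this]
    exact ⟨fun v ↦ ContinuousMap.pointwiseApply K G F (ContinuousMap.comp ⟨fderiv ℝ f, h2.continuous⟩ v),
      ContDiff.comp (g := ContinuousMap.pointwiseApply K G F)
        (ContinuousLinearMap.contDiff _) (ih (fderiv ℝ f) h2),
      fun u ↦ ContinuousMap.hasFDerivAt_postcomp h1 u⟩

lemma ContinuousMap.contDiff_postcomp {K : Type*} [TopologicalSpace K] [CompactSpace K]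
    {G : Type} [NormedAddCommGroup G] [NormedSpace ℝ G]
    {F : Type} [NormedAddCommGroup F] [NormedSpace ℝ F] (f : G → F) (hf : ContDiff ℝ ∞ f) :
    ContDiff ℝ ∞ (fun v : C(K, G) ↦ (ContinuousMap.comp ⟨f, hf.continuous⟩ v : C(K, F))) :=
  contDiff_infty.2 fun n ↦ ContinuousMap.contDiff_postcomp_nat n f (contDiff_infty.1 hf n)

end Nemytskii

/-! ### The Volterra operator -/

section Volterra

open intervalIntegral

variable {E : Type*} [NormedAddCommGroup E] [NormedSpace ℝ E] [CompleteSpace E]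

/-- The unit interval. -/
local notation "𝕀" => Icc (0 : ℝ) 1

/-- The extension of a function on the unit interval to the line. -/
lemma continuous_comp_projIcc {E : Type*} [TopologicalSpace E] (u : C(𝕀, E)) :
    Continuous fun s : ℝ ↦ u (projIcc 0 1 zero_le_one s) :=
  u.continuous.comp continuous_projIcc

/-- `u ↦ ∫₀ᵗ u`. -/
def primitive (E : Type*) [NormedAddCommGroup E] [NormedSpace ℝ E] [CompleteSpace E] :
    C(𝕀, E) →L[ℝ] C(𝕀, E) :=
  LinearMap.mkContinuous
    { toFun := fun u ↦ ⟨fun t ↦ ∫ s in (0 : ℝ)..t, u (projIcc 0 1 zero_le_one s), by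
        have := (continuous_primitive (fun a b ↦ (continuous_comp_projIcc u).intervalIntegrable
          (μ := volume) a b) 0)
        exact this.comp continuous_subtype_val⟩
      map_add' := fun u v ↦ by
        ext t
        exact integral_add ((continuous_comp_projIcc u).intervalIntegrable _ _)
          ((continuous_comp_projIcc v).intervalIntegrable _ _)
      map_smul' := fun c u ↦ by
        ext t
        exact integral_smul c _ } 1
    (fun u ↦ by
      rw [ContinuousMap.norm_le _ (by positivity)]
      intro t
      refine (norm_integral_le_of_norm_le_const (C := ‖u‖) fun s _ ↦ u.norm_coe_le_norm _).trans ?_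
      rw [sub_zero, abs_of_nonneg t.2.1, one_mul]
      exact mul_le_of_le_one_right (norm_nonneg _) t.2.2)

lemma primitive_apply (u : C(𝕀, E)) (t : 𝕀) :
    primitive E u t = ∫ s in (0 : ℝ)..t, u (projIcc 0 1 zero_le_one s) := rfl

lemma primitive_zero (u : C(𝕀, E)) : primitive E u 0 = 0 := by
  simp [primitive_apply]

lemma hasDerivWithinAt_primitive (u : C(𝕀, E)) (t : 𝕀) :
    HasDerivWithinAt (fun s : ℝ ↦ primitive E u (projIcc 0 1 zero_le_one s)) (u t) 𝕀 t := by
  have h := integral_hasDerivAt_right (f := fun s : ℝ ↦ u (projIcc 0 1 zero_le_one s)) (a := 0)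
    (b := t) ((continuous_comp_projIcc u).intervalIntegrable _ _)
    ((continuous_comp_projIcc u).stronglyMeasurableAtFilter _ _)
    (continuous_comp_projIcc u).continuousAt
  simp only [projIcc_val] at h
  refine h.hasDerivWithinAt.congr (fun s hs ↦ ?_) ?_
  · rw [primitive_apply, projIcc_of_mem _ hs]
  · rw [primitive_apply, projIcc_val]

/-- The Volterra operator `u ↦ ∫₀ᵗ A(s) u(s) ds`. -/
def volterra (A : C(𝕀, E →L[ℝ] E)) : C(𝕀, E) →L[ℝ] C(𝕀, E) :=
  (primitive E).comp (ContinuousMap.pointwiseApply 𝕀 E E A)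

/-- Each application of the operator integrates one more power of t, which produces the factorial.
-/
lemma norm_volterra_pow_apply_le (A : C(𝕀, E →L[ℝ] E)) (u : C(𝕀, E)) (n : ℕ) (t : 𝕀) :
    ‖(volterra A ^ n) u t‖ ≤ ‖A‖ ^ n * ‖u‖ * (t : ℝ) ^ n / n.factorial := by
  induction n generalizing t with
  | zero => simpa using u.norm_coe_le_norm t
  | succ n ih =>
    rw [pow_succ', mul_apply_eq_comp]
    set w := (volterra A ^ n) u
    have hle : ∀ s ∈ Icc (0 : ℝ) t, ‖(ContinuousMap.pointwiseApply 𝕀 E E A w)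
        (projIcc 0 1 zero_le_one s)‖ ≤ ‖A‖ ^ (n + 1) * ‖u‖ / n.factorial * s ^ n := by
      intro s hs
      have hs' : s ∈ 𝕀 := ⟨hs.1, hs.2.trans t.2.2⟩
      rw [ContinuousMap.pointwiseApply_apply, projIcc_of_mem _ hs']
      refine ((A _).le_opNorm _).trans ?_
      refine (mul_le_mul (A.norm_coe_le_norm _) (ih ⟨s, hs'⟩) (norm_nonneg _)
        (norm_nonneg _)).trans (le_of_eq ?_)
      simp only
      ring
    have hI : (volterra A w) t = ∫ s in (0 : ℝ)..t, (ContinuousMap.pointwiseApply 𝕀 E E A w)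
        (projIcc 0 1 zero_le_one s) := rfl
    rw [hI]
    refine (intervalIntegral.norm_integral_le_integral_norm t.2.1).trans ?_
    refine (integral_mono_on t.2.1 ((continuous_comp_projIcc _).norm.intervalIntegrable _ _)
      (Continuous.intervalIntegrable (by fun_prop) _ _) hle).trans (le_of_eq ?_)
    rw [intervalIntegral.integral_const_mul, integral_pow, Nat.factorial_succ]
    push_cast
    have : (n.factorial : ℝ) ≠ 0 := by positivity
    field_simp
    simp

/-- By the factorial bound some power V ^ n has norm less than 1, whatever the size of `A`. Then 1 -
V ^ n is invertible, and 1 - V is one of two commuting factors of it. -/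
lemma isUnit_one_sub_volterra (A : C(𝕀, E →L[ℝ] E)) : IsUnit (1 - volterra A) := by
  have hlim := FloorSemiring.tendsto_pow_div_factorial_atTop ‖A‖
  obtain ⟨n, hn⟩ := (hlim.eventually_lt_const (show (0 : ℝ) < 1 / 2 by norm_num)).exists
  have hnorm : ‖volterra A ^ n‖ < 1 := by
    refine lt_of_le_of_lt (ContinuousLinearMap.opNorm_le_bound _ (M := ‖A‖ ^ n / n.factorial)
      (by positivity) fun u ↦ ?_) (hn.trans (by norm_num))
    rw [ContinuousMap.norm_le _ (by positivity)]
    intro t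
    refine (norm_volterra_pow_apply_le A u n t).trans ?_
    have : (t : ℝ) ^ n ≤ 1 := pow_le_one₀ t.2.1 t.2.2
    calc ‖A‖ ^ n * ‖u‖ * (t : ℝ) ^ n / n.factorial ≤ ‖A‖ ^ n * ‖u‖ * 1 / n.factorial := by gcongr
      _ = _ := by ring
  have hu : IsUnit (1 - volterra A ^ n) :=
    isUnit_one_sub_of_norm_lt_one (R := C(𝕀, E) →L[ℝ] C(𝕀, E)) hnorm
  have hc : Commute (1 - volterra A) (∑ i ∈ Finset.range n, volterra A ^ i) :=
    Commute.sum_right _ _ _ fun i _ ↦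
      ((Commute.one_left _).sub_left ((Commute.refl _).pow_right i))
  rw [← mul_neg_geom_sum] at hu
  exact (hc.isUnit_mul_iff.1 hu).1

end Volterra

/-! ### Smooth dependence of the flow of a time-dependent vector field near an equilibrium -/

section Flow

local notation "𝕀" => Icc (0 : ℝ) 1

variable {E : Type} [NormedAddCommGroup E] [NormedSpace ℝ E]

/-- The superposition operator `u ↦ (t ↦ X(t, u(t)))`. -/
def superposition (X : ℝ × E → E) (hX : Continuous X) (u : C(𝕀, E)) : C(𝕀, E) :=
  ⟨fun t ↦ X (t, u t), by fun_prop⟩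

/-- The pointwise derivative of the superposition operator. -/
def superpositionDeriv (X : ℝ × E → E) (hX : ContDiff ℝ ∞ X) (u : C(𝕀, E)) : C(𝕀, E →L[ℝ] E) :=
  ⟨fun t ↦ (fderiv ℝ X (t, u t)).comp (ContinuousLinearMap.inr ℝ ℝ E), by
    have := hX.continuous_fderiv (by simp)
    fun_prop⟩

/-- Passing from u to t ↦ (t, u t), an affine map, reduces time-dependent maps to postcomposition
with a fixed one. -/
lemma superposition_eq (X : ℝ × E → E) (hX : Continuous X) :
    superposition X hX = (fun v : C(𝕀, ℝ × E) ↦ (ContinuousMap.comp ⟨X, hX⟩ v : C(𝕀, E))) ∘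
      (fun u : C(𝕀, E) ↦ (ContinuousLinearMap.inr ℝ ℝ E).compLeftContinuous ℝ 𝕀 u +
        (⟨fun t ↦ ((t : ℝ), (0 : E)), by fun_prop⟩ : C(𝕀, ℝ × E))) := by
  ext u t
  simp [superposition]

lemma contDiff_superposition (X : ℝ × E → E) (hX : ContDiff ℝ ∞ X) :
    ContDiff ℝ ∞ (superposition X hX.continuous) := by
  rw [superposition_eq]
  exact (ContinuousMap.contDiff_postcomp X hX).comp
    ((ContinuousLinearMap.contDiff _).add contDiff_const)

lemma hasFDerivAt_superposition (X : ℝ × E → E) (hX : ContDiff ℝ ∞ X) (u : C(𝕀, E)) :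
    HasFDerivAt (superposition X hX.continuous)
      (ContinuousMap.pointwiseApply 𝕀 E E (superpositionDeriv X hX u)) u := by
  have h1 : HasFDerivAt (fun u : C(𝕀, E) ↦
      (ContinuousLinearMap.inr ℝ ℝ E).compLeftContinuous ℝ 𝕀 u +
        (⟨fun t ↦ ((t : ℝ), (0 : E)), by fun_prop⟩ : C(𝕀, ℝ × E)))
      ((ContinuousLinearMap.inr ℝ ℝ E).compLeftContinuous ℝ 𝕀) u :=
    (ContinuousLinearMap.hasFDerivAt _).add_const _
  have h2 := (ContinuousMap.hasFDerivAt_postcomp (hX.of_le (by simp)) _).comp u h1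
  rw [superposition_eq]
  refine h2.congr_fderiv ?_
  ext v t
  simp [superpositionDeriv]

variable [CompleteSpace E]

lemma hasFDerivAt_sub_primitive_superposition (X : ℝ × E → E) (hX : ContDiff ℝ ∞ X)
    (u : C(𝕀, E)) :
    HasFDerivAt (fun u : C(𝕀, E) ↦ u - primitive E (superposition X hX.continuous u))
      (1 - volterra (superpositionDeriv X hX u)) u :=
  (hasFDerivAt_id u).sub ((primitive E).hasFDerivAt.comp u (hasFDerivAt_superposition X hX u))

/-- Constant functions. -/
def constFunction (E : Type*) [NormedAddCommGroup E] [NormedSpace ℝ E] : E →L[ℝ] C(𝕀, E) :=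
  LinearMap.mkContinuous
    { toFun := fun x ↦ ContinuousMap.const _ x
      map_add' := fun _ _ ↦ rfl
      map_smul' := fun _ _ ↦ rfl } 1 fun x ↦ by
    rw [ContinuousMap.norm_le _ (by positivity)]
    exact fun _ ↦ (one_mul ‖x‖).ge

@[simp] lemma constFunction_apply {E : Type*} [NormedAddCommGroup E] [NormedSpace ℝ E] (x : E)
    (t : 𝕀) : constFunction E x t = x := rfl

/-- The derivative of the integral operator, as an isomorphism. -/
lemma exists_equiv_hasFDerivAt_sub_primitive (X : ℝ × E → E) (hX : ContDiff ℝ ∞ X)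
    (u : C(𝕀, E)) : ∃ e : C(𝕀, E) ≃L[ℝ] C(𝕀, E), HasFDerivAt
      (fun u : C(𝕀, E) ↦ u - primitive E (superposition X hX.continuous u))
      (e : C(𝕀, E) →L[ℝ] C(𝕀, E)) u := by
  obtain ⟨e, he⟩ := isUnit_one_sub_volterra (superpositionDeriv X hX u)
  refine ⟨ContinuousLinearEquiv.unitsEquiv ℝ C(𝕀, E) e, ?_⟩
  refine (hasFDerivAt_sub_primitive_superposition X hX u).congr_fderiv ?_
  rw [← he]
  rfl

/-- Integral curves from x solve Ψ(u) = const x with Ψ(u) = u - ∫ X(s, u). The inverse function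
theorem at the zero curve, a solution by `h0`, gives curves on all of [0, 1] depending smoothly on x
in sup norm. -/
theorem exists_smooth_integral_curves (X : ℝ × E → E) (hX : ContDiff ℝ ∞ X)
    (h0 : ∀ s ∈ 𝕀, X (s, 0) = 0) :
    ∃ Φ : E → C(𝕀, E), (∀ᶠ x in 𝓝 0, ContDiffAt ℝ ∞ Φ x) ∧ Φ 0 = 0 ∧
      ∀ᶠ x in 𝓝 0, Φ x - primitive E (superposition X hX.continuous (Φ x)) = constFunction E x := by
  set Ψ : C(𝕀, E) → C(𝕀, E) := fun u ↦ u - primitive E (superposition X hX.continuous u) with hΨ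
  have hΨs : ContDiff ℝ ∞ Ψ :=
    contDiff_id.sub ((primitive E).contDiff.comp (contDiff_superposition X hX))
  have hs0 : superposition X hX.continuous 0 = 0 := by
    ext t
    exact h0 t t.2
  have hΨ0 : Ψ 0 = 0 := by simp [hΨ, hs0]
  obtain ⟨e, he⟩ := exists_equiv_hasFDerivAt_sub_primitive X hX 0
  set P := hΨs.contDiffAt.toOpenPartialHomeomorph Ψ he (by simp) with hP
  have hPc : (P : C(𝕀, E) → C(𝕀, E)) = Ψ := rfl
  have h0s : (0 : C(𝕀, E)) ∈ P.source :=
    hΨs.contDiffAt.mem_toOpenPartialHomeomorph_source he (by simp)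
  have h0t : (0 : C(𝕀, E)) ∈ P.target := by
    have := P.map_source h0s
    rwa [hPc, hΨ0] at this
  have hc : ∀ᶠ x in 𝓝 (0 : E), constFunction E x ∈ P.target := by
    refine (constFunction E).continuous.continuousAt.eventually (P.open_target.mem_nhds ?_)
    rwa [map_zero]
  refine ⟨fun x ↦ P.symm (constFunction E x), ?_, ?_, ?_⟩
  -- The derivative of Ψ is invertible at every curve, so the local inverse is smooth on its whole
  -- domain and not only at 0.
  · filter_upwards [hc] with x hx
    obtain ⟨e', he'⟩ := exists_equiv_hasFDerivAt_sub_primitive X hX (P.symm (constFunction E x))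
    exact (P.contDiffAt_symm hx he' hΨs.contDiffAt).comp x
      (constFunction E).contDiff.contDiffAt
  · have := P.left_inv h0s
    rw [hPc, hΨ0] at this
    beta_reduce
    rwa [map_zero]
  · filter_upwards [hc] with x hx
    exact P.right_inv hx

/-- Outside [0, 1] the flow is frozen by `projIcc`. The last clause is the first variation equation,
obtained by differentiating the integral equation in x. -/
theorem exists_smooth_flow (X : ℝ × E → E) (hX : ContDiff ℝ ∞ X)
    (h0 : ∀ s ∈ 𝕀, X (s, 0) = 0) :
    ∃ Φ : ℝ → E → E, (∀ s, Φ s 0 = 0) ∧ (∀ᶠ x in 𝓝 0, ∀ s, ContDiffAt ℝ ∞ (Φ s) x) ∧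
      (∀ ε > 0, ∀ᶠ x in 𝓝 0, ∀ s, ‖Φ s x‖ < ε) ∧
      ∀ᶠ x in 𝓝 0, Φ 0 x = x ∧
        (∀ s ∈ 𝕀, HasDerivWithinAt (fun s ↦ Φ s x) (X (s, Φ s x)) 𝕀 s) ∧
        ∀ v, fderiv ℝ (Φ 0) x v = v ∧ ∀ s ∈ 𝕀, HasDerivWithinAt (fun s ↦ fderiv ℝ (Φ s) x v)
          (fderiv ℝ X (s, Φ s x) (0, fderiv ℝ (Φ s) x v)) 𝕀 s := by
  obtain ⟨Φ, hΦs, hΦ0, hΦ⟩ := exists_smooth_integral_curves X hX h0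
  have hev : ∀ (s : ℝ), (fun x ↦ Φ x (projIcc 0 1 zero_le_one s)) =
      (ContinuousMap.evalCLM ℝ (projIcc 0 1 zero_le_one s) : C(𝕀, E) →L[ℝ] E) ∘ Φ :=
    fun s ↦ rfl
  refine ⟨fun s x ↦ Φ x (projIcc 0 1 zero_le_one s), fun s ↦ by simp [hΦ0], ?_,
    fun ε hε ↦ ?_, ?_⟩
  · filter_upwards [hΦs] with x hx s
    rw [hev]
    exact (ContinuousLinearMap.contDiff _).contDiffAt.comp x hx
  · have h := hΦs.self_of_nhds.continuousAt.norm.eventually_lt_const (show ‖Φ 0‖ < ε by simpa [hΦ0] using hε)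
    filter_upwards [h] with x hx s
    exact ((Φ x).norm_coe_le_norm _).trans_lt hx
  · have hdiff : ∀ᶠ x in 𝓝 0, DifferentiableAt ℝ Φ x := by
      filter_upwards [hΦs] with x hx using hx.differentiableAt (by simp)
    filter_upwards [hΦ, hΦ.eventually_nhds, hdiff] with x hx hxe hxd
    have hfd : ∀ s v, fderiv ℝ (fun x ↦ Φ x (projIcc 0 1 zero_le_one s)) x v =
        fderiv ℝ Φ x v (projIcc 0 1 zero_le_one s) := by
      intro s v
      rw [hev, ((ContinuousLinearMap.hasFDerivAt _).comp x hxd.hasFDerivAt).fderiv]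
      rfl
    have hx' : ∀ t : 𝕀, Φ x t = x + primitive E (superposition X hX.continuous (Φ x)) t := by
      intro t
      have := DFunLike.congr_fun hx t
      rw [ContinuousMap.sub_apply, constFunction_apply] at this
      exact sub_eq_iff_eq_add.1 this
    have hv : ∀ v, fderiv ℝ Φ x v - volterra (superpositionDeriv X hX (Φ x)) (fderiv ℝ Φ x v) =
        constFunction E v := by
      intro v
      have h1 := (hasFDerivAt_sub_primitive_superposition X hX (Φ x)).comp x hxd.hasFDerivAt
      have h2 := (constFunction E).hasFDerivAt (x := x)
      have h3 := (h2.congr_of_eventuallyEq hxe).unique h1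
      have h4 := DFunLike.congr_fun h3 v
      exact h4.symm
    have hv' : ∀ v (t : 𝕀), fderiv ℝ Φ x v t = v +
        volterra (superpositionDeriv X hX (Φ x)) (fderiv ℝ Φ x v) t := by
      intro v t
      have := DFunLike.congr_fun (hv v) t
      rw [ContinuousMap.sub_apply, constFunction_apply] at this
      exact sub_eq_iff_eq_add.1 this
    have hp0 : projIcc (0 : ℝ) 1 zero_le_one 0 = 0 := projIcc_left _
    refine ⟨?_, fun s hs ↦ ?_, fun v ↦ ⟨?_, fun s hs ↦ ?_⟩⟩
    · simp only [hp0, hx' 0, primitive_zero, add_zero]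
    · have h1 := (hasDerivWithinAt_primitive (superposition X hX.continuous (Φ x))
        ⟨s, hs⟩).const_add x
      have h2 : superposition X hX.continuous (Φ x) ⟨s, hs⟩ =
          X (s, Φ x (projIcc 0 1 zero_le_one s)) := by
        rw [projIcc_of_mem _ hs]; rfl
      rw [h2] at h1
      exact h1.congr_of_mem (fun t _ ↦ hx' _) hs
    · rw [hfd, hp0, hv', volterra, ContinuousLinearMap.comp_apply, primitive_zero, add_zero]
    · simp only [hfd]
      have h1 := (hasDerivWithinAt_primitive (ContinuousMap.pointwiseApply 𝕀 E E
        (superpositionDeriv X hX (Φ x)) (fderiv ℝ Φ x v)) ⟨s, hs⟩).const_add v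
      have h2 : ContinuousMap.pointwiseApply 𝕀 E E
        (superpositionDeriv X hX (Φ x)) (fderiv ℝ Φ x v) ⟨s, hs⟩ =
          fderiv ℝ X (s, Φ x (projIcc 0 1 zero_le_one s))
            (0, fderiv ℝ Φ x v (projIcc 0 1 zero_le_one s)) := by
        rw [projIcc_of_mem _ hs]; rfl
      rw [h2] at h1
      exact h1.congr_of_mem (fun t _ ↦ hv' v _) hs

end Flow

/-! ### Smooth extension -/

section Extension

variable {E : Type*} [NormedAddCommGroup E] [NormedSpace ℝ E] [FiniteDimensional ℝ E]
  {F : Type*} [NormedAddCommGroup F] [NormedSpace ℝ F]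

/-- A function which is smooth on a neighbourhood of a closed set agrees near that set with a
globally smooth function. -/
lemma exists_contDiff_eventuallyEq {C U : Set E} (hC : IsClosed C) (hU : IsOpen U) (hCU : C ⊆ U)
    {f : E → F} (hf : ContDiffOn ℝ ∞ f U) :
    ∃ f' : E → F, ContDiff ℝ ∞ f' ∧ ∀ x ∈ C, f' =ᶠ[𝓝 x] f := by
  obtain ⟨χ, h0, h1, -⟩ := exists_contMDiffMap_zero_one_nhds_of_isClosed 𝓘(ℝ, E) (n := (⊤ : ℕ∞))
    hU.isClosed_compl hC (disjoint_compl_left_iff_subset.2 hCU)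
  refine ⟨fun x ↦ χ x • f x, contDiff_iff_contDiffAt.2 fun x ↦ ?_, fun x hx ↦ ?_⟩
  · by_cases hx : x ∈ U
    · exact χ.contMDiff.contDiff.contDiffAt.smul (hf.contDiffAt (hU.mem_nhds hx))
    · refine (contDiffAt_const (c := 0)).congr_of_eventuallyEq ?_
      filter_upwards [Filter.eventually_iff.1 h0 |> (nhds_le_nhdsSet hx ·)] with y hy
      rw [hy, zero_smul]
  · filter_upwards [Filter.eventually_iff.1 h1 |> (nhds_le_nhdsSet hx ·)] with y hy
    rw [hy, one_smul]

end Extension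

/-! ### The Moser trick for contact forms -/

section Moser

/-- The exterior derivative of a one-form on a vector space. -/
def extDerivForm {E : Type*} [NormedAddCommGroup E] [NormedSpace ℝ E] (α : E → E →L[ℝ] ℝ) (x : E) :
    E →L[ℝ] E →L[ℝ] ℝ :=
  fderiv ℝ α x - (fderiv ℝ α x).flip

lemma extDerivForm_apply {E : Type*} [NormedAddCommGroup E] [NormedSpace ℝ E]
    (α : E → E →L[ℝ] ℝ) (x u v : E) :
    extDerivForm α x u v = fderiv ℝ α x u v - fderiv ℝ α x v u := rfl

variable {E : Type*} [NormedAddCommGroup E] [NormedSpace ℝ E]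

/-- The map `(X, μ) ↦ (a(X), σ(X, ·) - μ a)`. -/
def bordered (a : E →L[ℝ] ℝ) (σ : E →L[ℝ] E →L[ℝ] ℝ) : E × ℝ →L[ℝ] ℝ × (E →L[ℝ] ℝ) :=
  (ContinuousLinearMap.inl ℝ ℝ (E →L[ℝ] ℝ)).comp (a.comp (ContinuousLinearMap.fst ℝ E ℝ)) +
  (ContinuousLinearMap.inr ℝ ℝ (E →L[ℝ] ℝ)).comp (σ.comp (ContinuousLinearMap.fst ℝ E ℝ) -
    ContinuousLinearMap.smulRightL ℝ _ _ (ContinuousLinearMap.snd ℝ E ℝ) a)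

@[simp] lemma bordered_apply (a : E →L[ℝ] ℝ) (σ : E →L[ℝ] E →L[ℝ] ℝ) (z : E × ℝ) :
    bordered a σ z = (a z.1, σ z.1 - z.2 • a) := by
  simp [bordered]

lemma ContDiff.bordered {G : Type*} [NormedAddCommGroup G] [NormedSpace ℝ G]
    {a : G → E →L[ℝ] ℝ} {σ : G → E →L[ℝ] E →L[ℝ] ℝ} (ha : ContDiff ℝ ∞ a)
    (hσ : ContDiff ℝ ∞ σ) : ContDiff ℝ ∞ fun x ↦ bordered (a x) (σ x) := by
  unfold _root_.bordered
  fun_prop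

lemma ContDiff.extDerivForm {α : E → E →L[ℝ] ℝ} (hα : ContDiff ℝ ∞ α) :
    ContDiff ℝ ∞ (extDerivForm α) := by
  have h := hα.fderiv_right (m := ∞) (by simp)
  have hf : IsBoundedLinearMap ℝ (fun A : E →L[ℝ] E →L[ℝ] ℝ ↦ A.flip) :=
    IsLinearMap.with_bound ⟨fun _ _ ↦ rfl, fun _ _ ↦ rfl⟩ 1 fun A ↦ by simp
  have hf' : ContDiff ℝ ∞ (fun A : E →L[ℝ] E →L[ℝ] ℝ ↦ A.flip) := hf.contDiff
  exact h.sub (hf'.comp h)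

/-- `σ` is nondegenerate on the kernel of `a`. -/
structure IsContactPair (a : E →L[ℝ] ℝ) (σ : E →L[ℝ] E →L[ℝ] ℝ) : Prop where
  ne_zero : a ≠ 0
  eq_zero : ∀ (X : E) (μ : ℝ), a X = 0 → σ X = μ • a → X = 0

/-- Injectivity is the contact condition, and both sides have dimension dim E + 1. -/
lemma IsContactPair.exists_equiv [FiniteDimensional ℝ E] {a : E →L[ℝ] ℝ}
    {σ : E →L[ℝ] E →L[ℝ] ℝ} (h : IsContactPair a σ) :
    ∃ e : (E × ℝ) ≃L[ℝ] ℝ × (E →L[ℝ] ℝ), (e : E × ℝ →L[ℝ] ℝ × (E →L[ℝ] ℝ)) = bordered a σ := by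
  have hinj : Function.Injective (bordered a σ : E × ℝ →ₗ[ℝ] ℝ × (E →L[ℝ] ℝ)) := by
    rw [← LinearMap.ker_eq_bot, LinearMap.ker_eq_bot']
    rintro ⟨X, μ⟩ hz
    have hz' : (a X, σ X - μ • a) = 0 := by simpa using hz
    rw [Prod.mk_eq_zero, sub_eq_zero] at hz'
    obtain rfl := h.eq_zero X μ hz'.1 hz'.2
    have h2 := hz'.2
    rw [map_zero, eq_comm, smul_eq_zero, or_iff_left h.ne_zero] at h2
    rw [h2, Prod.mk_zero_zero]
  have hdim : Module.finrank ℝ (E × ℝ) = Module.finrank ℝ (ℝ × (E →L[ℝ] ℝ)) := by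
    rw [Module.finrank_prod, Module.finrank_prod, add_comm, add_right_inj]
    rw [← (LinearMap.toContinuousLinearMap (𝕜 := ℝ) (E := E) (F' := ℝ)).finrank_eq]
    exact (Subspace.dual_finrank_eq).symm
  refine ⟨(LinearEquiv.ofInjectiveOfFinrankEq _ hinj hdim).toContinuousLinearEquiv, ?_⟩
  ext z <;> rfl
end Moser

/-! ### The Moser vector field and the contact forms along its flow -/

section MoserFlow

local notation "𝕀" => Icc (0 : ℝ) 1

/-- Grönwall uniqueness. -/
lemma eq_zero_of_norm_deriv_le {F : Type*} [NormedAddCommGroup F] [NormedSpace ℝ F]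
    {f f' : ℝ → F} {K : ℝ} (hf : ∀ s ∈ 𝕀, HasDerivWithinAt f (f' s) 𝕀 s) (h0 : f 0 = 0)
    (hK : ∀ s ∈ 𝕀, ‖f' s‖ ≤ K * ‖f s‖) : ∀ s ∈ 𝕀, f s = 0 :=
  eq_zero_of_abs_deriv_le_mul_abs_self_of_eq_zero_right
    (fun s hs ↦ (hf s hs).continuousWithinAt)
    (fun s hs ↦ (hf s (Ico_subset_Icc_self hs)).mono_of_mem_nhdsWithin (Icc_mem_nhdsGE_of_mem hs))
    h0 (fun s hs ↦ hK s (Ico_subset_Icc_self hs))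

/-- Uniqueness backwards in time, by the reversal s ↦ 1 - s. -/
lemma eq_zero_of_norm_deriv_le_left {F : Type*} [NormedAddCommGroup F] [NormedSpace ℝ F]
    {f f' : ℝ → F} {K : ℝ} (hf : ∀ s ∈ 𝕀, HasDerivWithinAt f (f' s) 𝕀 s) (h1 : f 1 = 0)
    (hK : ∀ s ∈ 𝕀, ‖f' s‖ ≤ K * ‖f s‖) : f 0 = 0 := by
  have hm : MapsTo (fun s : ℝ ↦ 1 - s) 𝕀 𝕀 := fun s hs ↦ ⟨by linarith [hs.2], by linarith [hs.1]⟩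
  have := eq_zero_of_norm_deriv_le (f := fun s ↦ f (1 - s)) (f' := fun s ↦ - f' (1 - s)) (K := K)
    (fun s hs ↦ by
      have h2 : HasDerivWithinAt (fun s : ℝ ↦ 1 - s) (-1) 𝕀 s := by
        simpa using (hasDerivWithinAt_id s 𝕀).const_sub 1
      simpa [Function.comp_def] using (hf (1 - s) (hm hs)).scomp s h2 hm)
    (by simpa using h1) (fun s hs ↦ by simpa using hK _ (hm hs)) 1 (by simp)
  simpa using this

variable {E : Type} [NormedAddCommGroup E] [NormedSpace ℝ E] [FiniteDimensional ℝ E]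

/-- These are Moser's equations for the path α_s = α + sβ. They are linear in (X, μ), with matrix
`bordered`. At x = 0 this matrix is invertible and independent of s, because β and dβ vanish there;
the solution has X = 0 since the right side is -β. Near [0, 1] × {0} the matrix stays invertible,
and a smooth cutoff makes the solution global. -/
lemma exists_moser_field {α β : E → E →L[ℝ] ℝ} (hα : ContDiff ℝ ∞ α) (hβ : ContDiff ℝ ∞ β)
    (hβ0 : β 0 = 0) (hdβ : extDerivForm β 0 = 0)
    (hc : IsContactPair (α 0) (extDerivForm α 0)) :
    ∃ (X : ℝ × E → E) (μ : ℝ × E → ℝ), ContDiff ℝ ∞ X ∧ ContDiff ℝ ∞ μ ∧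
      (∀ s ∈ 𝕀, X (s, 0) = 0) ∧ ∀ s ∈ 𝕀, ∀ᶠ z in 𝓝 ((s, 0) : ℝ × E),
        (α z.2 + z.1 • β z.2) (X z) = 0 ∧
        (extDerivForm α z.2 + z.1 • extDerivForm β z.2) (X z) =
          μ z • (α z.2 + z.1 • β z.2) - β z.2 := by
  set B : ℝ × E → (E × ℝ →L[ℝ] ℝ × (E →L[ℝ] ℝ)) := fun z ↦ bordered (α z.2 + z.1 • β z.2)
    (extDerivForm α z.2 + z.1 • extDerivForm β z.2) with hB
  have hBs : ContDiff ℝ ∞ B := by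
    have h1 := hα.extDerivForm
    have h2 := hβ.extDerivForm
    exact ContDiff.bordered (by fun_prop)
      ((h1.comp contDiff_snd).add (contDiff_fst.smul (h2.comp contDiff_snd)))
  have hB0 : ∀ s : ℝ, B (s, 0) = bordered (α 0) (extDerivForm α 0) := by
    intro s
    simp only [hB, hβ0, hdβ, smul_zero, add_zero]
  obtain ⟨e, he⟩ := hc.exists_equiv
  set U : Set (ℝ × E) := B ⁻¹' range ((↑) : ((E × ℝ) ≃L[ℝ] ℝ × (E →L[ℝ] ℝ)) →
    (E × ℝ →L[ℝ] ℝ × (E →L[ℝ] ℝ))) with hU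
  have hUo : IsOpen U := (ContinuousLinearEquiv.isOpen).preimage hBs.continuous
  have hCU : 𝕀 ×ˢ ({0} : Set E) ⊆ U := by
    rintro ⟨s, x⟩ ⟨-, hx⟩
    obtain rfl : x = 0 := hx
    exact ⟨e, by rw [he, hB0]⟩
  set R : ℝ × E → E × ℝ := fun z ↦ (B z).inverse (0, - β z.2) with hR
  have hRs : ContDiffOn ℝ ∞ R U := by
    rintro z ⟨e', he'⟩
    have h1 : ContDiffAt ℝ ∞ ContinuousLinearMap.inverse (B z) := he' ▸ contDiffAt_map_inverse e'
    have h2 : ContDiffAt ℝ ∞ (fun z ↦ (B z).inverse) z := h1.comp z hBs.contDiffAt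
    have h3 : ContDiffAt ℝ ∞ (fun z : ℝ × E ↦ ((0 : ℝ), - β z.2)) z := by fun_prop
    exact (h2.clm_apply h3).contDiffWithinAt
  have hRB : ∀ z ∈ U, B z (R z) = (0, - β z.2) := by
    rintro z ⟨e', he'⟩
    rw [hR]
    simp only [← he']
    simp
  obtain ⟨R', hR's, hR'⟩ := exists_contDiff_eventuallyEq
    (isClosed_Icc.prod (isClosed_singleton (x := (0 : E)))) hUo hCU hRs
  refine ⟨fun z ↦ (R' z).1, fun z ↦ (R' z).2, contDiff_fst.comp hR's, contDiff_snd.comp hR's,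
    fun s hs ↦ ?_, fun s hs ↦ ?_⟩
  · have h1 := (hR' (s, 0) ⟨hs, rfl⟩).eq_of_nhds
    simp only [h1, hR, hβ0, neg_zero, Prod.mk_zero_zero, map_zero, Prod.fst_zero]
  · filter_upwards [hR' (s, 0) ⟨hs, rfl⟩, hUo.mem_nhds (hCU ⟨hs, rfl⟩)] with z hz hzU
    have h1 := hRB z hzU
    rw [← hz, hB, bordered_apply, Prod.mk.injEq] at h1
    refine ⟨h1.1, ?_⟩
    have h2 := h1.2
    rw [sub_eq_iff_eq_add] at h2
    rw [h2]
    abel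

omit [FiniteDimensional ℝ E] in
/-- The derivative of `α_s(w)` along the Moser flow. -/
lemma moser_derivative {α β : E → E →L[ℝ] ℝ} (hα : ContDiff ℝ ∞ α) (hβ : ContDiff ℝ ∞ β)
    {X : ℝ × E → E} {μ : ℝ × E → ℝ} (hX : ContDiff ℝ ∞ X) {γ w : ℝ → E} {s : ℝ}
    (hz : ∀ᶠ z in 𝓝 (s, γ s), (α z.2 + z.1 • β z.2) (X z) = 0 ∧
        (extDerivForm α z.2 + z.1 • extDerivForm β z.2) (X z) =
          μ z • (α z.2 + z.1 • β z.2) - β z.2)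
    (hγ : HasDerivWithinAt γ (X (s, γ s)) 𝕀 s)
    (hw : HasDerivWithinAt w (fderiv ℝ X (s, γ s) (0, w s)) 𝕀 s) :
    HasDerivWithinAt (fun s ↦ (α (γ s) + s • β (γ s)) (w s))
      (μ (s, γ s) * (α (γ s) + s • β (γ s)) (w s)) 𝕀 s := by
  have dα : HasFDerivAt α (fderiv ℝ α (γ s)) (γ s) := (hα.differentiable (by simp) _).hasFDerivAt
  have dβ : HasFDerivAt β (fderiv ℝ β (γ s)) (γ s) := (hβ.differentiable (by simp) _).hasFDerivAt
  have dX : HasFDerivAt X (fderiv ℝ X (s, γ s)) (s, γ s) :=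
    (hX.differentiable (by simp) _).hasFDerivAt
  have dX' : HasFDerivAt (fun x ↦ X (s, x))
      ((fderiv ℝ X (s, γ s)).comp (ContinuousLinearMap.inr ℝ ℝ E)) (γ s) :=
    dX.comp (γ s) (hasFDerivAt_prodMk_right s (γ s))
  have hA := (dα.comp_hasDerivWithinAt s hγ).add
    ((hasDerivWithinAt_id s 𝕀).smul (dβ.comp_hasDerivWithinAt s hγ))
  have hy := hA.clm_apply hw
  have hS := (dα.add (dβ.const_smul s)).clm_apply dX'
  -- The derivative consists of dα_s(X, w), of the derivative of α_s(X) in the direction w, and of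
  -- β(w). The second vanishes because α_s(X) is zero on a neighbourhood, and the first equals μ
  -- α_s(w) - β(w).
  have hzero : (fun x ↦ (α x + s • β x) (X (s, x))) =ᶠ[𝓝 (γ s)] fun _ ↦ (0 : ℝ) := by
    have hc : ContinuousAt (fun x ↦ ((s, x) : ℝ × E)) (γ s) := by fun_prop
    filter_upwards [hc.eventually hz] with x hx using hx.1
  have h1 := (hS.congr_of_eventuallyEq hzero.symm).unique (hasFDerivAt_const (0 : ℝ) (γ s))
  have h2 := DFunLike.congr_fun h1 (w s)
  have h3 := DFunLike.congr_fun hz.self_of_nhds.2 (w s)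
  refine hy.congr_deriv ?_
  simp [extDerivForm] at h2 h3 ⊢
  linarith

end MoserFlow

section MoserMap

local notation "𝕀" => Icc (0 : ℝ) 1

variable {E : Type} [NormedAddCommGroup E] [NormedSpace ℝ E] [FiniteDimensional ℝ E]

/-- **Gray stability near a point**: two contact forms which agree at `0`, together with their
exterior derivatives, have isomorphic kernels near `0`. -/
theorem exists_moser_map {α α' : E → E →L[ℝ] ℝ} (hα : ContDiff ℝ ∞ α) {U : Set E} (hU : IsOpen U)
    (h0U : (0 : E) ∈ U) (hα' : ContDiffOn ℝ ∞ α' U) (h0 : α 0 = α' 0)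
    (hd : extDerivForm α 0 = extDerivForm α' 0)
    (hc : IsContactPair (α 0) (extDerivForm α 0)) :
    ∃ Φ : E → E, Φ 0 = 0 ∧ (∀ᶠ x in 𝓝 0, ContDiffAt ℝ ∞ Φ x) ∧
      Function.Injective (fderiv ℝ Φ 0) ∧
      ∀ᶠ x in 𝓝 0, ∀ v, α x v = 0 → α' (Φ x) (fderiv ℝ Φ x v) = 0 := by
  -- β is globally smooth but equals α' - α only near 0.
  obtain ⟨β, hβ, hβe⟩ := exists_contDiff_eventuallyEq (isClosed_singleton (x := (0 : E))) hU
    (singleton_subset_iff.2 h0U) (hα'.sub hα.contDiffOn)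
  replace hβe := hβe 0 rfl
  have hβ0 : β 0 = 0 := by rw [hβe.eq_of_nhds, h0, sub_self]
  have hdβ : extDerivForm β 0 = 0 := by
    have h1 : fderiv ℝ β 0 = fderiv ℝ α' 0 - fderiv ℝ α 0 := by
      rw [hβe.fderiv_eq]
      exact fderiv_sub ((hα'.contDiffAt (hU.mem_nhds h0U)).differentiableAt (by simp))
        (hα.differentiable (by simp) 0)
    ext u v
    have h2 := DFunLike.congr_fun (DFunLike.congr_fun hd u) v
    simp only [extDerivForm_apply, h1, sub_apply,
      zero_apply] at h2 ⊢
    linarith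
  obtain ⟨X, μ, hX, hμ, hX0, hXμ⟩ := exists_moser_field hα hβ hβ0 hdβ hc
  obtain ⟨Φ, hΦ0, hΦs, hΦε, hΦ⟩ := exists_smooth_flow X hX hX0
  have hXb : Continuous fun s : ℝ ↦
      (fderiv ℝ X (s, 0)).comp (ContinuousLinearMap.inr ℝ ℝ E) := by
    have := hX.continuous_fderiv (by simp)
    fun_prop
  -- Compactness of [0, 1] makes the neighbourhoods of the points (s, 0) uniform in s.
  have hnear : ∀ᶠ x in 𝓝 (0 : E), ∀ s ∈ 𝕀, ∀ᶠ z in 𝓝 ((s, x) : ℝ × E),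
        (α z.2 + z.1 • β z.2) (X z) = 0 ∧
        (extDerivForm α z.2 + z.1 • extDerivForm β z.2) (X z) =
          μ z • (α z.2 + z.1 • β z.2) - β z.2 := by
    refine isCompact_Icc.eventually_forall_of_forall_eventually fun s hs ↦ ?_
    have h1 := (hXμ s hs).eventually_nhds
    have h2 : Filter.Tendsto (fun z : E × ℝ ↦ (z.2, z.1)) (𝓝 (0, s)) (𝓝 (s, 0)) :=
      Continuous.tendsto' (by fun_prop) _ _ rfl
    exact h2.eventually h1
  obtain ⟨ε, hε, hball⟩ := Metric.eventually_nhds_iff_ball.1 (hnear.and hβe)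
  refine ⟨Φ 1, hΦ0 1, hΦs.mono fun x hx ↦ hx 1, ?_, ?_⟩
  -- At the equilibrium 0 the first variation is a linear equation, so a vector killed at time 1 was
  -- already zero at time 0.
  · rw [injective_iff_map_eq_zero]
    intro v hv
    obtain ⟨C, hC⟩ := isCompact_Icc.exists_bound_of_continuousOn (s := 𝕀) hXb.continuousOn
    obtain ⟨-, -, h⟩ := hΦ.self_of_nhds
    obtain ⟨h1, h2⟩ := h v
    rw [← h1]
    refine eq_zero_of_norm_deriv_le_left (f := fun s ↦ fderiv ℝ (Φ s) 0 v) h2 hv (K := C)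
      fun s hs ↦ ?_
    rw [hΦ0]
    exact (((fderiv ℝ X (s, 0)).comp (ContinuousLinearMap.inr ℝ ℝ E)).le_opNorm _).trans
      (mul_le_mul_of_nonneg_right (hC s hs) (norm_nonneg _))
  · filter_upwards [hΦ, hΦε ε hε] with x hx hxε v hv
    obtain ⟨hx1, hx2, hx3⟩ := hx
    obtain ⟨hx4, hx5⟩ := hx3 v
    have hmem : ∀ s, Φ s x ∈ Metric.ball (0 : E) ε := fun s ↦ by simpa using hxε s
    have hcont : ContinuousOn (fun s ↦ μ (s, Φ s x)) 𝕀 :=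
      hμ.continuous.comp_continuousOn
        (continuousOn_id.prodMk fun s hs ↦ (hx2 s hs).continuousWithinAt)
    obtain ⟨C, hC⟩ := isCompact_Icc.exists_bound_of_continuousOn hcont
    -- The function y(s) = α_s(dΦ_s v) solves y' = μ y and starts at 0, so it vanishes at s = 1,
    -- where α_1 = α'.
    have key := eq_zero_of_norm_deriv_le
      (f := fun s ↦ (α (Φ s x) + s • β (Φ s x)) (fderiv ℝ (Φ s) x v)) (K := C)
      (fun s hs ↦ moser_derivative hα hβ hX ((hball _ (hmem s)).1 s hs) (hx2 s hs) (hx5 s hs))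
      (by simpa [hx1, hx4] using hv)
      (fun s hs ↦ by
        rw [norm_mul]
        exact mul_le_mul_of_nonneg_right (hC s hs) (norm_nonneg _)) 1 (by simp)
    simpa [(hball _ (hmem 1)).2] using key

end MoserMap

/-! ### Symplectic bases -/

section SymplecticBasis

/-- Choose v, w with σ(v, w) = c and recurse on their common orthogonal `ker T`, of codimension 2.
The scale c is left free because dθ pairs ∂/∂x_i with ∂/∂y_i to 4 rather than 1. -/
lemma exists_symplectic_family (n : ℕ) : ∀ {V : Type} [AddCommGroup V] [Module ℝ V]
    [FiniteDimensional ℝ V] (σ : V →ₗ[ℝ] V →ₗ[ℝ] ℝ), (∀ v, σ v v = 0) →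
    (∀ v, (∀ w, σ v w = 0) → v = 0) → Module.finrank ℝ V = 2 * n → ∀ c : ℝ, c ≠ 0 →
    ∃ e f : Fin n → V, (∀ i j, σ (e i) (e j) = 0) ∧ (∀ i j, σ (f i) (f j) = 0) ∧
      ∀ i j, σ (e i) (f j) = if i = j then c else 0 := by
  induction n with
  | zero => exact fun σ _ _ _ c _ ↦ ⟨Fin.elim0, Fin.elim0, fun i ↦ i.elim0, fun i ↦ i.elim0,
      fun i ↦ i.elim0⟩
  | succ n ih =>
    intro V _ _ _ σ halt hnd hdim c hc
    have hskew : ∀ v w, σ v w = - σ w v := fun v w ↦ by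
      have := halt (v + w)
      simp only [map_add, LinearMap.add_apply, halt, zero_add, add_zero] at this
      linarith
    have : Nontrivial V := Module.nontrivial_of_finrank_pos (R := ℝ) (by omega)
    obtain ⟨v, hv⟩ := exists_ne (0 : V)
    obtain ⟨w', hw'⟩ : ∃ w, σ v w ≠ 0 := by
      by_contra! h
      exact hv (hnd v h)
    set w : V := (c / σ v w') • w' with hw
    have hvw : σ v w = c := by
      rw [hw, map_smul, smul_eq_mul, div_mul_cancel₀ _ hw']
    have hwv : σ w v = -c := by rw [hskew, hvw]
    set T : V →ₗ[ℝ] ℝ × ℝ := (σ v).prod (σ w) with hT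
    have hTs : LinearMap.range T = ⊤ := by
      rw [LinearMap.range_eq_top]
      rintro ⟨a, b⟩
      refine ⟨(a / c) • w - (b / c) • v, ?_⟩
      simp [hT, halt, hvw, hwv, hc]
    have hker : Module.finrank ℝ (LinearMap.ker T) = 2 * n := by
      have := LinearMap.finrank_range_add_finrank_ker T
      rw [hTs, finrank_top, Module.finrank_prod, Module.finrank_self] at this
      omega
    have hmem : ∀ u : LinearMap.ker T, σ v u = 0 ∧ σ w u = 0 := fun u ↦ by
      simpa [hT] using u.2
    obtain ⟨e, f, hee, hff, hef⟩ := ih (σ.domRestrict₁₂ (LinearMap.ker T) (LinearMap.ker T))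
      (fun u ↦ halt u) (fun u hu ↦ by
        ext
        refine hnd u fun x ↦ ?_
        -- y is the projection of x to `ker T`. As u is orthogonal to v and w, it pairs with x as it
        -- does with y.
        set y : V := x - (σ v x / c) • w + (σ w x / c) • v with hy
        have hyk : y ∈ LinearMap.ker T := by
          simp [hT, hy, halt, hvw, hwv, hc]
        have h1 : σ u y = 0 := hu ⟨y, hyk⟩
        have h2 : σ u w = 0 := by rw [hskew, (hmem u).2, neg_zero]
        have h3 : σ u v = 0 := by rw [hskew, (hmem u).1, neg_zero]
        simpa [hy, h2, h3] using h1) hker c hc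
    have hev : ∀ u : LinearMap.ker T, σ u v = 0 := fun u ↦ by
      rw [hskew, (hmem u).1, neg_zero]
    have hew : ∀ u : LinearMap.ker T, σ u w = 0 := fun u ↦ by
      rw [hskew, (hmem u).2, neg_zero]
    refine ⟨Fin.cons v fun i ↦ e i, Fin.cons w fun i ↦ f i, ?_, ?_, ?_⟩
    · refine Fin.cases (Fin.cases ?_ fun j ↦ ?_) fun i ↦ Fin.cases ?_ fun j ↦ ?_
      · exact halt v
      · exact (hmem (e j)).1
      · exact hev (e i)
      · exact hee i j
    · refine Fin.cases (Fin.cases ?_ fun j ↦ ?_) fun i ↦ Fin.cases ?_ fun j ↦ ?_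
      · exact halt w
      · exact (hmem (f j)).2
      · exact hew (f i)
      · exact hff i j
    · refine Fin.cases (Fin.cases ?_ fun j ↦ ?_) fun i ↦ Fin.cases ?_ fun j ↦ ?_
      · simpa using hvw
      · simpa [(Fin.succ_ne_zero _).symm] using (hmem (f j)).1
      · simpa using hew (e i)
      · simpa using (show σ (e i) (f j) = _ from hef i j)

end SymplecticBasis

/-! ### The standard contact form -/

namespace Heisenberg

variable {n : ℕ}

/-- The bilinear form `2 ∑ (u_{x_i} v_{y_i} - u_{y_i} v_{x_i})`. -/
def omega (n : ℕ) : Heisenberg n →L[ℝ] Heisenberg n →L[ℝ] ℝ :=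
  LinearMap.toContinuousLinearMap
    ((LinearMap.toContinuousLinearMap : (Heisenberg n →ₗ[ℝ] ℝ) ≃ₗ[ℝ] _).toLinearMap.comp
      (LinearMap.mk₂ ℝ (fun u v : Heisenberg n ↦ 2 * ∑ i, (u (ix i) * v (iy i) - u (iy i) * v (ix i)))
        (fun u u' v ↦ by
          simp only [PiLp.add_apply, ← mul_add, ← Finset.sum_add_distrib]
          exact congrArg _ (Finset.sum_congr rfl fun i _ ↦ by ring))
        (fun c u v ↦ by
          simp only [PiLp.smul_apply, smul_eq_mul, Finset.mul_sum]
          exact Finset.sum_congr rfl fun i _ ↦ by ring)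
        (fun u v v' ↦ by
          simp only [PiLp.add_apply, ← mul_add, ← Finset.sum_add_distrib]
          exact congrArg _ (Finset.sum_congr rfl fun i _ ↦ by ring))
        (fun c u v ↦ by
          simp only [PiLp.smul_apply, smul_eq_mul, Finset.mul_sum]
          exact Finset.sum_congr rfl fun i _ ↦ by ring)))

lemma omega_apply (u v : Heisenberg n) :
    omega n u v = 2 * ∑ i, (u (ix i) * v (iy i) - u (iy i) * v (ix i)) := rfl

/-- The contact form `dt - 2 ∑ (y_i dx_i - x_i dy_i)`. -/
def theta (n : ℕ) (p : Heisenberg n) : Heisenberg n →L[ℝ] ℝ :=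
  EuclideanSpace.proj it + omega n p

lemma theta_apply (p v : Heisenberg n) : theta n p v = v it + omega n p v := rfl

lemma contDiff_theta : ContDiff ℝ ∞ (theta n) :=
  contDiff_const.add (omega n).contDiff

lemma extDerivForm_theta (p u v : Heisenberg n) :
    extDerivForm (theta n) p u v = 4 * ∑ i, (u (ix i) * v (iy i) - u (iy i) * v (ix i)) := by
  have h : fderiv ℝ (theta n) p = omega n := ((omega n).hasFDerivAt.const_add _).fderiv
  rw [extDerivForm_apply, h, omega_apply, omega_apply, ← mul_sub, ← Finset.sum_sub_distrib,
    Finset.mul_sum, Finset.mul_sum]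
  exact Finset.sum_congr rfl fun i _ ↦ by ring

lemma mem_horizontal_iff {p v : Heisenberg n} : v ∈ horizontal n p ↔ theta n p v = 0 := by
  have hsum : omega n p v = - (2 * ∑ i, (p (iy i) * v (ix i) - p (ix i) * v (iy i))) := by
    rw [omega_apply, ← mul_neg, ← Finset.sum_neg_distrib]
    exact congrArg _ (Finset.sum_congr rfl fun i _ ↦ by ring)
  rw [theta_apply, hsum]
  constructor
  · intro h
    rw [t_eq_of_mem h]
    ring
  · intro h
    have hv : v = ∑ i, v (ix i) • X i p + ∑ i, v (iy i) • Y i p := by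
      ext ((j | j) | j)
      · simp [X, Y, Pi.single_apply]
      · simp [X, Y, Pi.single_apply]
      · have : v it = 2 * ∑ i, (p (iy i) * v (ix i) - p (ix i) * v (iy i)) := by linarith
        simp [X, Y] at this ⊢
        rw [this, ← sub_eq_add_neg, ← Finset.sum_sub_distrib, ← Finset.sum_sub_distrib,
          Finset.mul_sum]
        exact Finset.sum_congr rfl fun i _ ↦ by ring
    rw [hv]
    refine add_mem (sum_mem fun i _ ↦ ?_) (sum_mem fun i _ ↦ ?_)
    · exact Submodule.smul_mem _ _ (Submodule.subset_span (Or.inl ⟨i, rfl⟩))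
    · exact Submodule.smul_mem _ _ (Submodule.subset_span (Or.inr ⟨i, rfl⟩))

lemma isContactPair_theta : IsContactPair (theta n 0) (extDerivForm (theta n) 0) := by
  constructor
  · intro h
    have := DFunLike.congr_fun h (EuclideanSpace.single it 1)
    simp [theta_apply] at this
  · intro X μ hX h
    have ht : X it = 0 := by simpa [theta_apply] using hX
    have hx : ∀ i, X (ix i) = 0 := fun i ↦ by
      have := DFunLike.congr_fun h (EuclideanSpace.single (iy i) 1)
      simpa [extDerivForm_theta, theta_apply, Pi.single_apply] using this
    have hy : ∀ i, X (iy i) = 0 := fun i ↦ by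
      have := DFunLike.congr_fun h (EuclideanSpace.single (ix i) 1)
      simpa [extDerivForm_theta, theta_apply, Pi.single_apply] using this
    ext ((i | i) | i)
    · exact hx i
    · exact hy i
    · exact ht

lemma finrank_eq : Module.finrank ℝ (Heisenberg n) = 2 * n + 1 := by
  simp [Index]
  ring

/-- The linear normal form of a contact form and its exterior derivative at a point. -/
theorem exists_linear_normal_form {E : Type} [NormedAddCommGroup E] [NormedSpace ℝ E]
    [FiniteDimensional ℝ E] (hE : Module.finrank ℝ E = 2 * n + 1) {a : E →L[ℝ] ℝ}
    {σ : E →L[ℝ] E →L[ℝ] ℝ} (halt : ∀ v, σ v v = 0) (h : IsContactPair a σ) :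
    ∃ L : Heisenberg n ≃L[ℝ] E, (∀ v, a (L v) = theta n 0 v) ∧
      ∀ u v, σ (L u) (L v) = extDerivForm (theta n) 0 u v := by
  have hskew : ∀ v w, σ v w = - σ w v := fun v w ↦ by
    have := halt (v + w)
    simp only [map_add, add_apply, halt, zero_add, add_zero] at this
    linarith
  -- R is the Reeb vector: a(R) = 1 and σ(R, ·) = μ a, where evaluation at R forces μ = 0. It splits
  -- E into a line in the kernel of σ and the symplectic space ker a.
  obtain ⟨B, hB⟩ := h.exists_equiv
  obtain ⟨⟨R, μ⟩, hz⟩ := B.surjective (1, 0)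
  have hz' : bordered a σ (R, μ) = (1, 0) := by rw [← hB]; exact hz
  rw [bordered_apply, Prod.mk.injEq, sub_eq_zero] at hz'
  obtain ⟨haR, hσR⟩ := hz'
  have hμ : μ = 0 := by
    have := DFunLike.congr_fun hσR R
    simpa [halt, haR] using this.symm
  have hσR0 : ∀ v, σ R v = 0 := fun v ↦ by simp [hσR, hμ]
  have hσR0' : ∀ v, σ v R = 0 := fun v ↦ by rw [hskew, hσR0, neg_zero]
  set K : Submodule ℝ E := LinearMap.ker (a : E →ₗ[ℝ] ℝ) with hK
  let τ : E →ₗ[ℝ] E →ₗ[ℝ] ℝ := (ContinuousLinearMap.coeLM ℝ).comp (σ : E →ₗ[ℝ] E →L[ℝ] ℝ)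
  have hdim : Module.finrank ℝ K = 2 * n := by
    have h1 := LinearMap.finrank_range_add_finrank_ker (a : E →ₗ[ℝ] ℝ)
    have h2 : LinearMap.range (a : E →ₗ[ℝ] ℝ) = ⊤ :=
      LinearMap.range_eq_top.2 fun c ↦ ⟨c • R, by simp [haR]⟩
    rw [h2, finrank_top, Module.finrank_self, hE] at h1
    change 1 + Module.finrank ℝ K = _ at h1
    omega
  obtain ⟨e, f, hee, hff, hef⟩ := exists_symplectic_family n (τ.domRestrict₁₂ K K)
    (fun u ↦ halt u) (fun u hu ↦ by
      ext
      refine h.eq_zero u 0 u.2 ?_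
      rw [zero_smul]
      ext v
      have hv : v - a v • R ∈ K := by simp [hK, haR]
      have h1 : σ u (v - a v • R) = 0 := hu ⟨_, hv⟩
      simpa [hσR0'] using h1) hdim 4 (by norm_num)
  have hae : ∀ i, a (e i) = 0 := fun i ↦ (e i).2
  have haf : ∀ i, a (f i) = 0 := fun i ↦ (f i).2
  replace hee : ∀ i j, σ (e i) (e j) = 0 := hee
  replace hff : ∀ i j, σ (f i) (f j) = 0 := hff
  replace hef : ∀ i j, σ (e i) (f j) = if i = j then 4 else 0 := hef
  have hfe : ∀ i j, σ (f i) (e j) = if i = j then -4 else 0 := fun i j ↦ by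
    rw [hskew, hef]
    split_ifs with h1 h2 h2
    · rfl
    · exact absurd h1.symm h2
    · exact absurd h2.symm h1
    · simp
  let L : Heisenberg n →ₗ[ℝ] E :=
    { toFun := fun v ↦ v it • R + ∑ i, (v (ix i) • (e i : E) + v (iy i) • (f i : E))
      map_add' := fun u v ↦ by
        simp only [PiLp.add_apply, add_smul, Finset.sum_add_distrib]
        abel
      map_smul' := fun c v ↦ by
        simp only [PiLp.smul_apply, smul_eq_mul, mul_smul, ← smul_add, ← Finset.smul_sum,
          RingHom.id_apply] }
  have hL : ∀ v, L v = v it • R + ∑ i, (v (ix i) • (e i : E) + v (iy i) • (f i : E)) := fun v ↦ rfl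
  have haL : ∀ v, a (L v) = theta n 0 v := fun v ↦ by
    simp [hL, haR, hae, haf, theta_apply]
  have hσL : ∀ u v, σ (L u) (L v) = extDerivForm (theta n) 0 u v := fun u v ↦ by
    simp only [hL, map_add, map_sum, map_smul, add_apply, FunLike.coe_sum, Finset.sum_apply,
      smul_apply, hσR0, hσR0', hee, hff, hef, hfe, smul_eq_mul, mul_zero, zero_add, add_zero,
      mul_ite, Finset.sum_add_distrib, Finset.sum_ite_eq', Finset.mem_univ,
      if_true, extDerivForm_theta, Finset.mul_sum, Finset.sum_const_zero]
    rw [← Finset.sum_add_distrib]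
    exact Finset.sum_congr rfl fun i _ ↦ by ring
  have hinj : Function.Injective L := by
    rw [← LinearMap.ker_eq_bot, LinearMap.ker_eq_bot']
    intro v hv
    refine isContactPair_theta.eq_zero v 0 ?_ ?_
    · rw [← haL, hv, map_zero]
    · ext w
      rw [← hσL, hv]
      simp
  refine ⟨(LinearEquiv.ofInjectiveOfFinrankEq L hinj
    (finrank_eq.trans hE.symm)).toContinuousLinearEquiv, haL, hσL⟩

end Heisenberg

/-! ### The Darboux theorem -/

section Darboux

variable {n : ℕ} {E : Type} [NormedAddCommGroup E] [NormedSpace ℝ E] [FiniteDimensional ℝ E]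

/-- A smooth map with injective derivative at a point, between spaces of the same dimension, is
injective near that point, with injective derivative. -/
lemma exists_mem_nhds_injOn {F : Type} [NormedAddCommGroup F] [NormedSpace ℝ F]
    [FiniteDimensional ℝ F] (hFE : Module.finrank ℝ F = Module.finrank ℝ E) {f : F → E} {x : F}
    (hf : ContDiffAt ℝ ∞ f x) (hinj : Function.Injective (fderiv ℝ f x)) :
    ∃ s ∈ 𝓝 x, InjOn f s ∧ ∀ y ∈ s, Function.Injective (fderiv ℝ f y) := by
  let e : F ≃L[ℝ] E := (LinearEquiv.ofInjectiveOfFinrankEq (fderiv ℝ f x : F →ₗ[ℝ] E)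
    hinj hFE).toContinuousLinearEquiv
  have he : (e : F →L[ℝ] E) = fderiv ℝ f x := rfl
  have hd : HasFDerivAt f (e : F →L[ℝ] E) x := by
    rw [he]
    exact (hf.differentiableAt (by simp)).hasFDerivAt
  set P := hf.toOpenPartialHomeomorph f hd (by simp) with hP
  have h1 : P.source ∈ 𝓝 x :=
    P.open_source.mem_nhds (hf.mem_toOpenPartialHomeomorph_source hd (by simp))
  have h2 : ∀ᶠ y in 𝓝 x, fderiv ℝ f y ∈ range ((↑) : (F ≃L[ℝ] E) → (F →L[ℝ] E)) := by
    have hc : ContinuousAt (fderiv ℝ f) x :=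
      (hf.fderiv_right (m := 0) (by simp)).continuousAt
    exact hc.eventually (he ▸ ContinuousLinearEquiv.nhds e)
  refine ⟨_, Filter.inter_mem h1 h2, P.injOn.mono inter_subset_left, fun y hy ↦ ?_⟩
  obtain ⟨e', he'⟩ := hy.2
  rw [← he']
  exact e'.injective

/-- The Darboux theorem: near a point, the kernel of a contact form on a vector space is
isomorphic to the standard distribution of the Heisenberg group near `0`. -/
theorem exists_darboux_chart (hE : Module.finrank ℝ E = 2 * n + 1) {α : E → E →L[ℝ] ℝ} {U : Set E}
    (hU : IsOpen U) (hα : ContDiffOn ℝ ∞ α U) {p : E} (hp : p ∈ U)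
    (hc : IsContactPair (α p) (extDerivForm α p)) :
    ∃ (r : ℝ) (Ψ : Heisenberg n → E), 0 < r ∧ Ψ 0 = p ∧ ContDiffOn ℝ ∞ Ψ (Metric.ball 0 r) ∧
      InjOn Ψ (Metric.ball 0 r) ∧ MapsTo Ψ (Metric.ball 0 r) U ∧
      ∀ x ∈ Metric.ball 0 r, Function.Injective (fderiv ℝ Ψ x) ∧
        ∀ v, Heisenberg.theta n x v = 0 → α (Ψ x) (fderiv ℝ Ψ x v) = 0 := by
  obtain ⟨L, hL, hLσ⟩ := Heisenberg.exists_linear_normal_form hE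
    (fun v ↦ by rw [extDerivForm_apply, sub_self]) hc
  -- In the affine coordinates A the form and its exterior derivative take the standard values at 0,
  -- as `exists_moser_map` requires.
  set A : Heisenberg n → E := fun x ↦ p + L x with hA
  have hAs : ContDiff ℝ ∞ A := contDiff_const.add L.contDiff
  have hAd : ∀ x, HasFDerivAt A (L : Heisenberg n →L[ℝ] E) x := fun x ↦
    L.hasFDerivAt.const_add p
  have hA0 : A 0 = p := by simp [hA]
  set U' : Set (Heisenberg n) := A ⁻¹' U with hU'
  have hU'o : IsOpen U' := hU.preimage hAs.continuous
  have h0U' : (0 : Heisenberg n) ∈ U' := by rwa [hU', mem_preimage, hA0]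
  set α' : Heisenberg n → Heisenberg n →L[ℝ] ℝ := fun x ↦ (α (A x)).comp (L : Heisenberg n →L[ℝ] E)
  have hα's : ContDiffOn ℝ ∞ α' U' :=
    (hα.comp hAs.contDiffOn (mapsTo_preimage _ _)).clm_comp contDiffOn_const
  have hαd : HasFDerivAt α (fderiv ℝ α p) (A 0) := by
    rw [hA0]
    exact ((hα.contDiffAt (hU.mem_nhds hp)).differentiableAt (by simp)).hasFDerivAt
  have hα'd : ∀ u v, fderiv ℝ α' 0 u v = fderiv ℝ α p (L u) (L v) := by
    intro u v
    have h1 := (hαd.comp 0 (hAd 0)).clm_comp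
      (hasFDerivAt_const (L : Heisenberg n →L[ℝ] E) (0 : Heisenberg n))
    rw [show fderiv ℝ α' 0 = _ from h1.fderiv]
    simp
  obtain ⟨Φ, hΦ0, hΦs, hΦi, hΦ⟩ := exists_moser_map (Heisenberg.contDiff_theta (n := n)) hU'o h0U'
    hα's (by
      ext v
      simp only [α', hA0]
      exact (hL v).symm) (by
      ext u v
      rw [← hLσ, extDerivForm_apply, extDerivForm_apply, hα'd, hα'd]) Heisenberg.isContactPair_theta
  obtain ⟨s, hs, hsinj, hsd⟩ := exists_mem_nhds_injOn rfl hΦs.self_of_nhds hΦi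
  have hUe : ∀ᶠ x in 𝓝 (0 : Heisenberg n), Φ x ∈ U' :=
    hΦs.self_of_nhds.continuousAt.eventually (hU'o.mem_nhds (by rwa [hΦ0]))
  obtain ⟨r, hr, hball⟩ := Metric.eventually_nhds_iff_ball.1
    (hΦs.and (hΦ.and (hUe.and hs)))
  have hfd : ∀ x ∈ Metric.ball 0 r, ∀ v, fderiv ℝ (A ∘ Φ) x v = L (fderiv ℝ Φ x v) := by
    intro x hx v
    rw [((hAd (Φ x)).comp x ((hball x hx).1.differentiableAt (by simp)).hasFDerivAt).fderiv]
    rfl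
  refine ⟨r, A ∘ Φ, hr, by simp [hΦ0, hA0], fun x hx ↦ ?_, fun x hx y hy hxy ↦ ?_, fun x hx ↦ ?_,
    fun x hx ↦ ⟨fun u v huv ↦ ?_, fun v hv ↦ ?_⟩⟩
  · exact (hAs.contDiffAt.comp x (hball x hx).1).contDiffWithinAt
  · refine hsinj (hball x hx).2.2.2 (hball y hy).2.2.2 (L.injective ?_)
    simpa [hA] using hxy
  · exact (hball x hx).2.2.1
  · rw [hfd x hx, hfd x hx] at huv
    exact hsd x (hball x hx).2.2.2 (L.injective huv)
  · rw [hfd x hx]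
    exact (hball x hx).2.1 v hv

end Darboux

/-! ### A contact embedding of the Heisenberg group into a ball -/

namespace Heisenberg

variable {n : ℕ}

/-- The point with given coordinates. -/
def mk (x y : Fin n → ℝ) (t : ℝ) : Heisenberg n :=
  WithLp.toLp 2 (Sum.elim (Sum.elim x y) fun _ ↦ t)

@[simp] lemma mk_ix (x y : Fin n → ℝ) (t : ℝ) (i : Fin n) : mk x y t (ix i) = x i := rfl
@[simp] lemma mk_iy (x y : Fin n → ℝ) (t : ℝ) (i : Fin n) : mk x y t (iy i) = y i := rfl
@[simp] lemma mk_it (x y : Fin n → ℝ) (t : ℝ) : mk x y t it = t := rfl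

lemma ext_coord {p q : Heisenberg n} (hx : ∀ i, p (ix i) = q (ix i))
    (hy : ∀ i, p (iy i) = q (iy i)) (ht : p it = q it) : p = q := by
  ext ((i | i) | i)
  exacts [hx i, hy i, ht]

lemma contDiff_coord (k : Index n) : ContDiff ℝ ∞ fun p : Heisenberg n ↦ p k :=
  (EuclideanSpace.proj (𝕜 := ℝ) k).contDiff

lemma contDiff_mk {x y : Heisenberg n → Fin n → ℝ} {t : Heisenberg n → ℝ}
    (hx : ∀ i, ContDiff ℝ ∞ fun p ↦ x p i) (hy : ∀ i, ContDiff ℝ ∞ fun p ↦ y p i)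
    (ht : ContDiff ℝ ∞ t) : ContDiff ℝ ∞ fun p ↦ mk (x p) (y p) (t p) := by
  rw [contDiff_piLp]
  rintro ((i | i) | i)
  exacts [hx i, hy i, ht]

/-- The derivative of a coordinate of a smooth map, computed along a line. -/
lemma fderiv_coord {f : Heisenberg n → Heisenberg n} (hf : ContDiff ℝ ∞ f) {p v : Heisenberg n}
    {k : Index n} {d : ℝ} (h : HasDerivAt (fun s : ℝ ↦ f (p + s • v) k) d 0) :
    fderiv ℝ f p v k = d := by
  have h1 : HasDerivAt (fun s : ℝ ↦ p + s • v) v 0 := by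
    simpa using ((hasDerivAt_id (0 : ℝ)).smul_const v).const_add p
  have h2 : HasFDerivAt f (fderiv ℝ f p) (p + (0 : ℝ) • v) := by
    rw [zero_smul, add_zero]
    exact (hf.differentiable (by simp) p).hasFDerivAt
  have h3 := (EuclideanSpace.proj (𝕜 := ℝ) k).hasFDerivAt.comp_hasDerivAt (0 : ℝ)
    (h2.comp_hasDerivAt (0 : ℝ) h1)
  exact h3.unique h

lemma hasDerivAt_coord (p v : Heisenberg n) (k : Index n) :
    HasDerivAt (fun s : ℝ ↦ (p + s • v) k) (v k) 0 := by
  simpa using ((hasDerivAt_id (0 : ℝ)).mul_const (v k)).const_add (p k)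

/-- `f` is an injective immersion which maps the kernel of `a` to the kernel of `b`. -/
structure IsFormEmbedding (a b : Heisenberg n → Heisenberg n →L[ℝ] ℝ)
    (f : Heisenberg n → Heisenberg n) : Prop where
  contDiff : ContDiff ℝ ∞ f
  injective : Function.Injective f
  fderiv_eq_zero : ∀ p v, fderiv ℝ f p v = 0 → v = 0
  form_eq_zero : ∀ p v, a p v = 0 → b (f p) (fderiv ℝ f p v) = 0

lemma IsFormEmbedding.comp {a b c : Heisenberg n → Heisenberg n →L[ℝ] ℝ}
    {f g : Heisenberg n → Heisenberg n} (hg : IsFormEmbedding b c g) (hf : IsFormEmbedding a b f) :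
    IsFormEmbedding a c (g ∘ f) := by
  have h : ∀ p v, fderiv ℝ (g ∘ f) p v = fderiv ℝ g (f p) (fderiv ℝ f p v) := fun p v ↦ by
    rw [fderiv_comp p (hg.contDiff.differentiable (by simp) _)
      (hf.contDiff.differentiable (by simp) _)]
    rfl
  refine ⟨hg.contDiff.comp hf.contDiff, hg.injective.comp hf.injective, fun p v hv ↦ ?_,
    fun p v hv ↦ ?_⟩
  · rw [h] at hv
    exact hf.fderiv_eq_zero p v (hg.fderiv_eq_zero _ _ hv)
  · rw [h]
    exact hg.form_eq_zero _ _ (hf.form_eq_zero p v hv)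

/-- The contact form `dt - ∑ y_i dx_i` of the space of one-jets. -/
def jetForm (n : ℕ) (p : Heisenberg n) : Heisenberg n →L[ℝ] ℝ :=
  EuclideanSpace.proj it - ∑ i, p (iy i) • EuclideanSpace.proj (ix i)

lemma jetForm_apply (p v : Heisenberg n) :
    jetForm n p v = v it - ∑ i, p (iy i) * v (ix i) := by
  simp [jetForm]

/-- The isomorphism from the Heisenberg group to the space of one-jets. -/
def toJet (p : Heisenberg n) : Heisenberg n :=
  mk (fun i ↦ p (ix i)) (fun i ↦ 4 * p (iy i)) (p it + 2 * ∑ i, p (ix i) * p (iy i))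

/-- The isomorphism from the space of one-jets to the Heisenberg group. -/
def ofJet (p : Heisenberg n) : Heisenberg n :=
  mk (fun i ↦ p (ix i)) (fun i ↦ 4⁻¹ * p (iy i)) (p it - 2⁻¹ * ∑ i, p (ix i) * p (iy i))

lemma ofJet_toJet (p : Heisenberg n) : ofJet (toJet p) = p := by
  refine ext_coord (fun i ↦ rfl) (fun i ↦ by simp [ofJet, toJet]) ?_
  simp only [ofJet, toJet, mk_ix, mk_iy, mk_it, mul_left_comm _ (4 : ℝ), ← Finset.mul_sum]
  ring

lemma toJet_ofJet (p : Heisenberg n) : toJet (ofJet p) = p := by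
  refine ext_coord (fun i ↦ rfl) (fun i ↦ by simp [ofJet, toJet]) ?_
  simp only [ofJet, toJet, mk_ix, mk_iy, mk_it, mul_left_comm _ (4⁻¹ : ℝ), ← Finset.mul_sum]
  ring

lemma contDiff_toJet : ContDiff ℝ ∞ (toJet (n := n)) := by
  have := contDiff_coord (n := n)
  exact contDiff_mk (fun i ↦ by fun_prop) (fun i ↦ by fun_prop) (by fun_prop)

lemma contDiff_ofJet : ContDiff ℝ ∞ (ofJet (n := n)) := by
  have := contDiff_coord (n := n)
  exact contDiff_mk (fun i ↦ by fun_prop) (fun i ↦ by fun_prop) (by fun_prop)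

lemma hasDerivAt_sum_mul (p v : Heisenberg n) :
    HasDerivAt (fun s : ℝ ↦ ∑ i, (p + s • v) (ix i) * (p + s • v) (iy i))
      (∑ i, (v (ix i) * p (iy i) + p (ix i) * v (iy i))) 0 := by
  have h := HasDerivAt.fun_sum (u := Finset.univ) fun i _ ↦
    (hasDerivAt_coord p v (ix i)).mul (hasDerivAt_coord p v (iy i))
  simpa using h

/-- The shift of t adds 2 d(∑ x_i y_i), which turns -4 ∑ y_i dx_i into the antisymmetric part 2 ∑
(x_i dy_i - y_i dx_i) of `theta`. -/
lemma isFormEmbedding_toJet : IsFormEmbedding (theta n) (jetForm n) toJet := by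
  have hx : ∀ p v i, fderiv ℝ (toJet (n := n)) p v (ix i) = v (ix i) := fun p v i ↦
    fderiv_coord contDiff_toJet (hasDerivAt_coord p v (ix i))
  have hy : ∀ p v i, fderiv ℝ (toJet (n := n)) p v (iy i) = 4 * v (iy i) := fun p v i ↦
    fderiv_coord contDiff_toJet ((hasDerivAt_coord p v (iy i)).const_mul 4)
  have ht : ∀ p v, fderiv ℝ (toJet (n := n)) p v it =
      v it + 2 * ∑ i, (v (ix i) * p (iy i) + p (ix i) * v (iy i)) := fun p v ↦
    fderiv_coord contDiff_toJet ((hasDerivAt_coord p v it).add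
      ((hasDerivAt_sum_mul p v).const_mul 2))
  refine ⟨contDiff_toJet, Function.LeftInverse.injective ofJet_toJet, fun p v hv ↦ ?_,
    fun p v hv ↦ ?_⟩
  · have h := fun k ↦ congrArg (fun w : Heisenberg n ↦ w k) hv
    have h1 : ∀ i, v (ix i) = 0 := fun i ↦ by simpa [hx] using h (ix i)
    have h2 : ∀ i, v (iy i) = 0 := fun i ↦ by simpa [hy] using h (iy i)
    exact ext_coord h1 h2 (by simpa [ht, h1, h2] using h it)
  · rw [theta_apply, omega_apply] at hv
    rw [jetForm_apply, ht, ← hv, add_sub_assoc, Finset.mul_sum, Finset.mul_sum,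
      ← Finset.sum_sub_distrib]
    refine congrArg _ (Finset.sum_congr rfl fun i _ ↦ ?_)
    simp only [hx, toJet, mk_iy]
    ring

lemma isFormEmbedding_ofJet : IsFormEmbedding (jetForm n) (theta n) ofJet := by
  have hx : ∀ p v i, fderiv ℝ (ofJet (n := n)) p v (ix i) = v (ix i) := fun p v i ↦
    fderiv_coord contDiff_ofJet (hasDerivAt_coord p v (ix i))
  have hy : ∀ p v i, fderiv ℝ (ofJet (n := n)) p v (iy i) = 4⁻¹ * v (iy i) := fun p v i ↦
    fderiv_coord contDiff_ofJet ((hasDerivAt_coord p v (iy i)).const_mul 4⁻¹)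
  have ht : ∀ p v, fderiv ℝ (ofJet (n := n)) p v it =
      v it - 2⁻¹ * ∑ i, (v (ix i) * p (iy i) + p (ix i) * v (iy i)) := fun p v ↦
    fderiv_coord contDiff_ofJet ((hasDerivAt_coord p v it).sub
      ((hasDerivAt_sum_mul p v).const_mul 2⁻¹))
  refine ⟨contDiff_ofJet, Function.LeftInverse.injective toJet_ofJet, fun p v hv ↦ ?_,
    fun p v hv ↦ ?_⟩
  · have h := fun k ↦ congrArg (fun w : Heisenberg n ↦ w k) hv
    have h1 : ∀ i, v (ix i) = 0 := fun i ↦ by simpa [hx] using h (ix i)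
    have h2 : ∀ i, v (iy i) = 0 := fun i ↦ by simpa [hy] using h (iy i)
    exact ext_coord h1 h2 (by simpa [ht, h1, h2] using h it)
  · rw [jetForm_apply, sub_eq_zero] at hv
    rw [theta_apply, omega_apply, ht, hv, Finset.mul_sum, Finset.mul_sum,
      ← Finset.sum_sub_distrib, ← Finset.sum_add_distrib]
    refine Finset.sum_eq_zero fun i _ ↦ ?_
    simp only [hx, hy, ofJet, mk_ix, mk_iy]
    ring

/-- The Legendre transformation of the space of one-jets. -/
def legendre (p : Heisenberg n) : Heisenberg n :=
  mk (fun i ↦ p (iy i)) (fun i ↦ - p (ix i)) (p it - ∑ i, p (ix i) * p (iy i))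

lemma contDiff_legendre : ContDiff ℝ ∞ (legendre (n := n)) := by
  have := contDiff_coord (n := n)
  exact contDiff_mk (fun i ↦ by fun_prop) (fun i ↦ by fun_prop) (by fun_prop)

/-- The form is preserved exactly. The map converts bounds on x and t into a bound on y and a bound
on t that grows linearly in x. -/
lemma isFormEmbedding_legendre : IsFormEmbedding (jetForm n) (jetForm n) legendre := by
  have hx : ∀ p v i, fderiv ℝ (legendre (n := n)) p v (ix i) = v (iy i) := fun p v i ↦
    fderiv_coord contDiff_legendre (hasDerivAt_coord p v (iy i))
  have hy : ∀ p v i, fderiv ℝ (legendre (n := n)) p v (iy i) = - v (ix i) := fun p v i ↦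
    fderiv_coord contDiff_legendre (hasDerivAt_coord p v (ix i)).neg
  have ht : ∀ p v, fderiv ℝ (legendre (n := n)) p v it =
      v it - ∑ i, (v (ix i) * p (iy i) + p (ix i) * v (iy i)) := fun p v ↦
    fderiv_coord contDiff_legendre ((hasDerivAt_coord p v it).sub (hasDerivAt_sum_mul p v))
  refine ⟨contDiff_legendre, fun p q hpq ↦ ?_, fun p v hv ↦ ?_, fun p v hv ↦ ?_⟩
  · have h := fun k ↦ congrArg (fun w : Heisenberg n ↦ w k) hpq
    have h1 : ∀ i, p (ix i) = q (ix i) := fun i ↦ by simpa [legendre] using h (iy i)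
    have h2 : ∀ i, p (iy i) = q (iy i) := fun i ↦ by simpa [legendre] using h (ix i)
    exact ext_coord h1 h2 (by simpa [legendre, h1, h2] using h it)
  · have h := fun k ↦ congrArg (fun w : Heisenberg n ↦ w k) hv
    have h1 : ∀ i, v (ix i) = 0 := fun i ↦ by simpa [hy] using h (iy i)
    have h2 : ∀ i, v (iy i) = 0 := fun i ↦ by simpa [hx] using h (ix i)
    exact ext_coord h1 h2 (by simpa [ht, h1, h2] using h it)
  · rw [jetForm_apply, sub_eq_zero] at hv
    rw [jetForm_apply, ht, hv, ← Finset.sum_sub_distrib, ← Finset.sum_sub_distrib]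
    refine Finset.sum_eq_zero fun i _ ↦ ?_
    simp only [hx, legendre, mk_iy]
    ring

end Heisenberg

/-! ### Lifts of point transformations to the space of one-jets -/

namespace Heisenberg

variable {n : ℕ}

lemma contDiff_arctan_comp {f : Heisenberg n → ℝ} (hf : ContDiff ℝ ∞ f) :
    ContDiff ℝ ∞ fun p ↦ Real.arctan (f p) :=
  Real.contDiff_arctan.comp hf

/-- The lift to the space of one-jets of the map `arctan` in each of the variables `x_i` and `t`. -/
def arctanLift (p : Heisenberg n) : Heisenberg n :=
  mk (fun i ↦ Real.arctan (p (ix i)))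
    (fun i ↦ p (iy i) * ((1 + p (ix i) ^ 2) / (1 + p it ^ 2))) (Real.arctan (p it))

lemma contDiff_arctanLift : ContDiff ℝ ∞ (arctanLift (n := n)) := by
  have h := contDiff_coord (n := n)
  refine contDiff_mk (fun i ↦ contDiff_arctan_comp (h _)) (fun i ↦ ?_) (contDiff_arctan_comp (h _))
  exact (h _).mul (ContDiff.div (by fun_prop) (by fun_prop) fun p ↦ by positivity)

/-- A map of the (x, t)-space lifts by letting y transform as the slope dt/dx. Here the jet form
pulls back to 1 / (1 + t ^ 2) times itself. -/
lemma isFormEmbedding_arctanLift : IsFormEmbedding (jetForm n) (jetForm n) arctanLift := by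
  have hx : ∀ p v i, fderiv ℝ (arctanLift (n := n)) p v (ix i) =
      1 / (1 + p (ix i) ^ 2) * v (ix i) := fun p v i ↦
    fderiv_coord contDiff_arctanLift ((hasDerivAt_coord p v (ix i)).arctan.congr_deriv (by simp))
  have ht : ∀ p v, fderiv ℝ (arctanLift (n := n)) p v it = 1 / (1 + p it ^ 2) * v it := fun p v ↦
    fderiv_coord contDiff_arctanLift ((hasDerivAt_coord p v it).arctan.congr_deriv (by simp))
  have hpos : ∀ x : ℝ, 1 + x ^ 2 ≠ 0 := fun x ↦ by positivity
  refine ⟨contDiff_arctanLift, fun p q hpq ↦ ?_, fun p v hv ↦ ?_, fun p v hv ↦ ?_⟩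
  · have h := fun k ↦ congrArg (fun w : Heisenberg n ↦ w k) hpq
    have h1 : ∀ i, p (ix i) = q (ix i) := fun i ↦ Real.arctan_injective (h (ix i))
    have h2 : p it = q it := Real.arctan_injective (h it)
    refine ext_coord h1 (fun i ↦ ?_) h2
    have h3 : p (iy i) * ((1 + p (ix i) ^ 2) / (1 + p it ^ 2)) =
      q (iy i) * ((1 + q (ix i) ^ 2) / (1 + q it ^ 2)) := h (iy i)
    rw [h1, h2] at h3
    exact mul_right_cancel₀ (div_ne_zero (hpos _) (hpos _)) h3
  · have h := fun k ↦ congrArg (fun w : Heisenberg n ↦ w k) hv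
    have h1 : ∀ i, v (ix i) = 0 := fun i ↦ by simpa [hx, hpos] using h (ix i)
    have h2 : v it = 0 := by simpa [ht, hpos] using h it
    refine ext_coord h1 (fun i ↦ ?_) h2
    have h3 : fderiv ℝ (arctanLift (n := n)) p v (iy i) =
        v (iy i) * ((1 + p (ix i) ^ 2) / (1 + p it ^ 2)) := by
      refine fderiv_coord contDiff_arctanLift ?_
      -- Since v has no component along x or t, the factor multiplying y is constant along the line.
      have h4 : (fun s : ℝ ↦ arctanLift (p + s • v) (iy i)) =
          fun s ↦ (p + s • v) (iy i) * ((1 + p (ix i) ^ 2) / (1 + p it ^ 2)) := by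
        funext s
        simp [arctanLift, h1, h2]
      rw [h4]
      exact (hasDerivAt_coord p v (iy i)).mul_const _
    have h5 := h (iy i)
    simp only [h3] at h5
    simpa [hpos] using h5
  · rw [jetForm_apply, sub_eq_zero] at hv
    rw [jetForm_apply, ht, hv, Finset.mul_sum, ← Finset.sum_sub_distrib]
    refine Finset.sum_eq_zero fun i _ ↦ ?_
    have h1 := hpos (p (ix i))
    have h2 := hpos (p it)
    simp only [hx, arctanLift, mk_iy]
    field_simp
    ring

/-- The function `1 + ∑ x_i ^ 2`. -/
def weight (p : Heisenberg n) : ℝ := 1 + ∑ i, p (ix i) ^ 2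

lemma one_le_weight (p : Heisenberg n) : 1 ≤ weight p := by
  have : 0 ≤ ∑ i, p (ix i) ^ 2 := Finset.sum_nonneg fun i _ ↦ sq_nonneg _
  unfold weight
  linarith

lemma weight_ne_zero (p : Heisenberg n) : weight p ≠ 0 := by
  linarith [one_le_weight p]

/-- The lift to the space of one-jets of `(x, t) ↦ (arctan x_i, t / (1 + ∑ x_i ^ 2))`. -/
def weightLift (p : Heisenberg n) : Heisenberg n :=
  mk (fun i ↦ Real.arctan (p (ix i)))
    (fun i ↦ (1 + p (ix i) ^ 2) / weight p * (p (iy i) - 2 * (p (ix i) * p it / weight p)))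
    (p it / weight p)

lemma contDiff_weight : ContDiff ℝ ∞ (weight (n := n)) := by
  have h := contDiff_coord (n := n)
  unfold weight
  fun_prop

lemma contDiff_weightLift : ContDiff ℝ ∞ (weightLift (n := n)) := by
  have h := contDiff_coord (n := n)
  have hw := contDiff_weight (n := n)
  refine contDiff_mk (fun i ↦ contDiff_arctan_comp (h _)) (fun i ↦ ?_)
    ((h _).div hw weight_ne_zero)
  refine (ContDiff.div (by fun_prop) hw weight_ne_zero).mul ((h _).sub (contDiff_const.mul ?_))
  exact ((h _).mul (h _)).div hw weight_ne_zero

lemma hasDerivAt_weight (p v : Heisenberg n) :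
    HasDerivAt (fun s : ℝ ↦ weight (p + s • v)) (∑ i, 2 * p (ix i) * v (ix i)) 0 := by
  have h := (HasDerivAt.fun_sum (u := Finset.univ) fun i _ ↦
    (hasDerivAt_coord p v (ix i)).pow 2).const_add 1
  exact h.congr_deriv (by simp)

/-- With W = `weight`, the jet form pulls back to 1 / W times itself: the correction -2 x_i t / W of
y absorbs the derivative of W. -/
lemma isFormEmbedding_weightLift : IsFormEmbedding (jetForm n) (jetForm n) weightLift := by
  have hx : ∀ p v i, fderiv ℝ (weightLift (n := n)) p v (ix i) =
      1 / (1 + p (ix i) ^ 2) * v (ix i) := fun p v i ↦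
    fderiv_coord contDiff_weightLift ((hasDerivAt_coord p v (ix i)).arctan.congr_deriv (by simp))
  have ht : ∀ p v, fderiv ℝ (weightLift (n := n)) p v it =
      (v it * weight p - p it * ∑ i, 2 * p (ix i) * v (ix i)) / weight p ^ 2 := fun p v ↦
    fderiv_coord contDiff_weightLift (((hasDerivAt_coord p v it).div (hasDerivAt_weight p v)
      (by simpa using weight_ne_zero p)).congr_deriv (by simp))
  have hpos : ∀ x : ℝ, 1 + x ^ 2 ≠ 0 := fun x ↦ by positivity
  have hW := weight_ne_zero (n := n)
  refine ⟨contDiff_weightLift, fun p q hpq ↦ ?_, fun p v hv ↦ ?_, fun p v hv ↦ ?_⟩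
  · have h := fun k ↦ congrArg (fun w : Heisenberg n ↦ w k) hpq
    have h1 : ∀ i, p (ix i) = q (ix i) := fun i ↦ Real.arctan_injective (h (ix i))
    have hw : weight p = weight q := by simp [weight, h1]
    have h2 : p it / weight p = q it / weight q := h it
    rw [hw] at h2
    replace h2 : p it = q it := (div_left_inj' (hW q)).1 h2
    refine ext_coord h1 (fun i ↦ ?_) h2
    have h3 : (1 + p (ix i) ^ 2) / weight p * (p (iy i) - 2 * (p (ix i) * p it / weight p)) =
      (1 + q (ix i) ^ 2) / weight q * (q (iy i) - 2 * (q (ix i) * q it / weight q)) := h (iy i)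
    rw [h1, h2, hw] at h3
    have h4 := mul_left_cancel₀ (div_ne_zero (hpos _) (hW _)) h3
    linarith
  · have h := fun k ↦ congrArg (fun w : Heisenberg n ↦ w k) hv
    have h1 : ∀ i, v (ix i) = 0 := fun i ↦ by simpa [hx, hpos] using h (ix i)
    have h2 : v it = 0 := by simpa [ht, hW, h1] using h it
    refine ext_coord h1 (fun i ↦ ?_) h2
    have h3 : fderiv ℝ (weightLift (n := n)) p v (iy i) =
        (1 + p (ix i) ^ 2) / weight p * v (iy i) := by
      refine fderiv_coord contDiff_weightLift ?_
      have h4 : (fun s : ℝ ↦ weightLift (p + s • v) (iy i)) =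
          fun s ↦ (1 + p (ix i) ^ 2) / weight p *
            ((p + s • v) (iy i) - 2 * (p (ix i) * p it / weight p)) := by
        funext s
        simp [weightLift, weight, h1, h2]
      rw [h4]
      exact ((hasDerivAt_coord p v (iy i)).sub_const _).const_mul _
    have h5 := h (iy i)
    simp only [h3] at h5
    simpa [hpos, hW] using h5
  · rw [jetForm_apply, sub_eq_zero] at hv
    have hsum : ∀ i, weightLift p (iy i) * fderiv ℝ (weightLift (n := n)) p v (ix i) =
        1 / weight p * (p (iy i) * v (ix i)) -
          p it / weight p ^ 2 * (2 * p (ix i) * v (ix i)) := fun i ↦ by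
      have h1 := hpos (p (ix i))
      have h2 := hW p
      simp only [hx, weightLift, mk_iy]
      field_simp
    rw [jetForm_apply, ht, Finset.sum_congr rfl fun i _ ↦ hsum i, Finset.sum_sub_distrib,
      ← Finset.mul_sum, ← Finset.mul_sum, ← hv]
    have h2 := hW p
    field_simp
    ring

/-- The dilations of the Heisenberg group. -/
def dilation (r : ℝ) (p : Heisenberg n) : Heisenberg n :=
  mk (fun i ↦ r * p (ix i)) (fun i ↦ r * p (iy i)) (r ^ 2 * p it)

lemma contDiff_dilation (r : ℝ) : ContDiff ℝ ∞ (dilation (n := n) r) := by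
  have h := contDiff_coord (n := n)
  exact contDiff_mk (fun i ↦ by fun_prop) (fun i ↦ by fun_prop) (by fun_prop)

/-- The weight 2 of t matches the quadratic part of `theta`, so the form is multiplied by r ^ 2. -/
lemma isFormEmbedding_dilation {r : ℝ} (hr : r ≠ 0) :
    IsFormEmbedding (theta n) (theta n) (dilation r) := by
  have hx : ∀ p v i, fderiv ℝ (dilation (n := n) r) p v (ix i) = r * v (ix i) := fun p v i ↦
    fderiv_coord (contDiff_dilation r) ((hasDerivAt_coord p v (ix i)).const_mul r)
  have hy : ∀ p v i, fderiv ℝ (dilation (n := n) r) p v (iy i) = r * v (iy i) := fun p v i ↦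
    fderiv_coord (contDiff_dilation r) ((hasDerivAt_coord p v (iy i)).const_mul r)
  have ht : ∀ p v, fderiv ℝ (dilation (n := n) r) p v it = r ^ 2 * v it := fun p v ↦
    fderiv_coord (contDiff_dilation r) ((hasDerivAt_coord p v it).const_mul (r ^ 2))
  refine ⟨contDiff_dilation r, fun p q hpq ↦ ?_, fun p v hv ↦ ?_, fun p v hv ↦ ?_⟩
  · have h := fun k ↦ congrArg (fun w : Heisenberg n ↦ w k) hpq
    exact ext_coord (fun i ↦ mul_left_cancel₀ hr (h (ix i)))
      (fun i ↦ mul_left_cancel₀ hr (h (iy i))) (mul_left_cancel₀ (pow_ne_zero 2 hr) (h it))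
  · have h := fun k ↦ congrArg (fun w : Heisenberg n ↦ w k) hv
    exact ext_coord (fun i ↦ by simpa [hx, hr] using h (ix i))
      (fun i ↦ by simpa [hy, hr] using h (iy i)) (by simpa [ht, hr] using h it)
  · rw [theta_apply, omega_apply] at hv
    have h : r ^ 2 * (v it + 2 * ∑ i, (p (ix i) * v (iy i) - p (iy i) * v (ix i))) = 0 := by
      rw [hv, mul_zero]
    rw [theta_apply, omega_apply, ht, ← h, mul_add, mul_left_comm (r ^ 2), Finset.mul_sum (a := r ^ 2)]
    congr 2
    refine Finset.sum_congr rfl fun i _ ↦ ?_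
    simp only [hx, hy, dilation, mk_ix, mk_iy]
    ring

lemma norm_le_of_coord_le {p : Heisenberg n} {C : ℝ} (hC : 0 ≤ C) (h : ∀ k, |p k| ≤ C) :
    ‖p‖ ≤ (2 * n + 1) * C := by
  have h1 : ‖p‖ ^ 2 ≤ ((2 * n + 1) * C) ^ 2 := by
    rw [EuclideanSpace.norm_sq_eq]
    calc ∑ k, ‖p k‖ ^ 2 ≤ ∑ _k : Index n, C ^ 2 :=
          Finset.sum_le_sum fun k _ ↦ pow_le_pow_left₀ (norm_nonneg _) (h k) 2
      _ = (2 * n + 1) * C ^ 2 := by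
          rw [Finset.sum_const, Finset.card_univ, nsmul_eq_mul]
          simp only [Fintype.card_sum, Fintype.card_fin, Fintype.card_unit]
          push_cast
          ring
      _ ≤ (2 * n + 1) ^ 2 * C ^ 2 := by
          refine mul_le_mul_of_nonneg_right ?_ (sq_nonneg C)
          have : (0 : ℝ) ≤ n := by positivity
          nlinarith
      _ = _ := by ring
  exact le_of_sq_le_sq h1 (by positivity)

end Heisenberg

/-! ### Boundedness of the image and shrinking by dilations -/

namespace Heisenberg

variable {n : ℕ}

lemma abs_arctan_le_two (x : ℝ) : |Real.arctan x| ≤ 2 := by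
  have h1 := Real.arctan_lt_pi_div_two x
  have h2 := Real.neg_pi_div_two_lt_arctan x
  have h3 := Real.pi_lt_four
  exact abs_le.2 ⟨by linarith, by linarith⟩

lemma one_add_sq_le_weight (p : Heisenberg n) (i : Fin n) : 1 + p (ix i) ^ 2 ≤ weight p := by
  have := Finset.single_le_sum (f := fun j ↦ p (ix j) ^ 2) (fun j _ ↦ sq_nonneg _)
    (Finset.mem_univ i)
  unfold weight
  linarith

lemma abs_mul_abs_le_weight (p : Heisenberg n) (i j : Fin n) :
    |p (ix i)| * |p (ix j)| ≤ weight p := by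
  have h1 := one_add_sq_le_weight p i
  have h2 := one_add_sq_le_weight p j
  have h3 := sq_abs (p (ix i))
  have h4 := sq_abs (p (ix j))
  nlinarith [sq_nonneg (|p (ix i)| - |p (ix j)|)]

lemma abs_le_weight (p : Heisenberg n) (i : Fin n) : |p (ix i)| ≤ weight p := by
  have h1 := one_add_sq_le_weight p i
  have h3 := sq_abs (p (ix i))
  nlinarith [sq_nonneg (|p (ix i)| - 1)]

/-- The height grows at most linearly in x, so division by W, which is quadratic in x, bounds both t
/ W and x_i t / W. Moreover (1 + x_i ^ 2) / W ≤ 1. -/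
lemma weightLift_bounded {p : Heisenberg n} (hy : ∀ i, |p (iy i)| ≤ 2)
    (ht : |p it| ≤ 2 + 2 * ∑ i, |p (ix i)|) :
    (∀ i, |weightLift p (ix i)| ≤ 2) ∧ (∀ i, |weightLift p (iy i)| ≤ 6 + 4 * n) ∧
      |weightLift p it| ≤ 2 + 2 * n := by
  have hW := one_le_weight p
  have hW0 : 0 < weight p := by linarith
  refine ⟨fun i ↦ abs_arctan_le_two _, fun i ↦ ?_, ?_⟩
  · have h1 : |p (ix i) * p it / weight p| ≤ 2 + 2 * n := by
      rw [abs_div, abs_mul, abs_of_pos hW0, div_le_iff₀ hW0]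
      have h2 : ∑ j, |p (ix i)| * |p (ix j)| ≤ n * weight p := by
        refine (Finset.sum_le_sum fun j _ ↦ abs_mul_abs_le_weight p i j).trans (le_of_eq ?_)
        simp
      rw [← Finset.mul_sum] at h2
      have h3 := mul_le_mul_of_nonneg_left ht (abs_nonneg (p (ix i)))
      have h4 := abs_le_weight p i
      nlinarith
    have h2 : |(1 + p (ix i) ^ 2) / weight p| ≤ 1 := by
      rw [abs_div, abs_of_pos hW0, abs_of_pos (by positivity), div_le_one hW0]
      exact one_add_sq_le_weight p i
    have h3 : |p (iy i) - 2 * (p (ix i) * p it / weight p)| ≤ 6 + 4 * n := by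
      refine (abs_sub _ _).trans ?_
      rw [abs_mul, abs_two]
      linarith [hy i]
    simp only [weightLift, mk_iy]
    rw [abs_mul]
    exact (mul_le_mul h2 h3 (abs_nonneg _) zero_le_one).trans (by rw [one_mul])
  · simp only [weightLift, mk_it]
    rw [abs_div, abs_of_pos hW0, div_le_iff₀ hW0]
    have h2 : ∑ j, |p (ix j)| ≤ n * weight p := by
      refine (Finset.sum_le_sum fun j _ ↦ abs_le_weight p j).trans (le_of_eq ?_)
      simp
    nlinarith

/-- After `arctanLift` both x and t are bounded and y is free. The Legendre transformation exchanges
the roles of x and y, which gives the hypotheses of `weightLift_bounded`. -/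
lemma legendre_arctanLift_bounded (p : Heisenberg n) :
    (∀ i, |legendre (arctanLift p) (iy i)| ≤ 2) ∧ |legendre (arctanLift p) it| ≤
      2 + 2 * ∑ i, |legendre (arctanLift p) (ix i)| := by
  refine ⟨fun i ↦ ?_, ?_⟩
  · simpa [legendre, arctanLift] using abs_arctan_le_two _
  · simp only [legendre, mk_ix, mk_it]
    refine (abs_sub _ _).trans (add_le_add (abs_arctan_le_two _) ?_)
    refine (Finset.abs_sum_le_sum_abs _ _).trans ?_
    rw [Finset.mul_sum]
    refine Finset.sum_le_sum fun i _ ↦ ?_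
    rw [abs_mul]
    exact mul_le_mul_of_nonneg_right (abs_arctan_le_two _) (abs_nonneg _)

/-- A contact embedding of the Heisenberg group with bounded image. -/
def boundedEmbedding : Heisenberg n → Heisenberg n :=
  ofJet ∘ weightLift ∘ legendre ∘ arctanLift ∘ toJet

lemma isFormEmbedding_boundedEmbedding :
    IsFormEmbedding (theta n) (theta n) boundedEmbedding :=
  isFormEmbedding_ofJet.comp <| isFormEmbedding_weightLift.comp <|
    isFormEmbedding_legendre.comp <| isFormEmbedding_arctanLift.comp isFormEmbedding_toJet

lemma boundedEmbedding_zero : boundedEmbedding (0 : Heisenberg n) = 0 := by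
  have h1 : toJet (0 : Heisenberg n) = 0 := ext_coord (by simp [toJet]) (by simp [toJet])
    (by simp [toJet])
  have h2 : arctanLift (0 : Heisenberg n) = 0 := ext_coord (by simp [arctanLift])
    (by simp [arctanLift]) (by simp [arctanLift])
  have h3 : legendre (0 : Heisenberg n) = 0 := ext_coord (by simp [legendre])
    (by simp [legendre]) (by simp [legendre])
  have h4 : weightLift (0 : Heisenberg n) = 0 := ext_coord (by simp [weightLift])
    (by simp [weightLift]) (by simp [weightLift])
  have h5 : ofJet (0 : Heisenberg n) = 0 := ext_coord (by simp [ofJet]) (by simp [ofJet])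
    (by simp [ofJet])
  simp [boundedEmbedding, h1, h2, h3, h4, h5]

lemma exists_abs_boundedEmbedding_le :
    ∃ C : ℝ, 0 ≤ C ∧ ∀ (p : Heisenberg n) (k : Index n), |boundedEmbedding p k| ≤ C := by
  -- The largest bound is that of the last coordinate: 2 + 2n for t, plus half of |∑ x_i y_i| ≤ 2n(6
  -- + 4n).
  refine ⟨2 + 2 * n + (n + 1) * (6 + 4 * n), by positivity, fun p ↦ ?_⟩
  obtain ⟨h1, h2⟩ := legendre_arctanLift_bounded (toJet p)
  obtain ⟨hx, hy, ht⟩ := weightLift_bounded h1 h2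
  set q := weightLift (legendre (arctanLift (toJet p))) with hq
  have hb : boundedEmbedding p = ofJet q := rfl
  have hn : (0 : ℝ) ≤ n := by positivity
  rw [hb]
  rintro ((i | i) | i)
  · refine (hx i).trans ?_
    nlinarith
  · change |4⁻¹ * q (iy i)| ≤ _
    rw [abs_mul, abs_of_pos (by norm_num)]
    nlinarith [hy i, abs_nonneg (q (iy i))]
  · change |q it - 2⁻¹ * ∑ i, q (ix i) * q (iy i)| ≤ _
    have h3 : |∑ i, q (ix i) * q (iy i)| ≤ n * (2 * (6 + 4 * n)) := by
      refine (Finset.abs_sum_le_sum_abs _ _).trans ?_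
      refine (Finset.sum_le_sum (g := fun _ ↦ (2 * (6 + 4 * n) : ℝ)) fun i _ ↦ ?_).trans
        (le_of_eq (by simp))
      rw [abs_mul]
      exact mul_le_mul (hx i) (hy i) (abs_nonneg _) zero_le_two
    refine (abs_sub _ _).trans ?_
    rw [abs_mul, abs_of_pos (by norm_num : (0 : ℝ) < 2⁻¹)]
    nlinarith

/-- The Heisenberg group has contact embeddings in arbitrarily small neighbourhoods of `0`. -/
theorem exists_embedding_ball (n : ℕ) {r : ℝ} (hr : 0 < r) :
    ∃ f : Heisenberg n → Heisenberg n, IsFormEmbedding (theta n) (theta n) f ∧ f 0 = 0 ∧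
      ∀ p, f p ∈ Metric.ball 0 r := by
  obtain ⟨C, hC, hb⟩ := exists_abs_boundedEmbedding_le (n := n)
  -- s ≤ 1 gives s ^ 2 ≤ s, so every coordinate shrinks at least by the factor s. The last + 1 in
  -- the denominator makes the norm bound strict.
  set s : ℝ := min 1 (r / ((2 * n + 1) * (C + 1) + 1)) with hs
  have hD : (0 : ℝ) < (2 * n + 1) * (C + 1) + 1 := by positivity
  have hs0 : 0 < s := lt_min one_pos (by positivity)
  have hs1 : s ≤ 1 := min_le_left _ _
  refine ⟨dilation s ∘ boundedEmbedding,
    (isFormEmbedding_dilation hs0.ne').comp isFormEmbedding_boundedEmbedding, ?_, fun p ↦ ?_⟩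
  · rw [Function.comp_apply, boundedEmbedding_zero]
    exact ext_coord (by simp [dilation]) (by simp [dilation]) (by simp [dilation])
  · rw [mem_ball_zero_iff]
    have h1 : ∀ k, |dilation s (boundedEmbedding p) k| ≤ s * (C + 1) := by
      have h2 : ∀ k, s * |boundedEmbedding p k| ≤ s * (C + 1) := fun k ↦
        mul_le_mul_of_nonneg_left ((hb p k).trans (by linarith)) hs0.le
      rintro ((i | i) | i)
      · change |s * _| ≤ _
        rw [abs_mul, abs_of_pos hs0]
        exact h2 _
      · change |s * _| ≤ _
        rw [abs_mul, abs_of_pos hs0]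
        exact h2 _
      · change |s ^ 2 * _| ≤ _
        rw [abs_mul, abs_of_pos (by positivity)]
        refine le_trans (mul_le_mul_of_nonneg_right ?_ (abs_nonneg _)) (h2 it)
        nlinarith
    refine (norm_le_of_coord_le (by positivity) h1).trans_lt ?_
    have h3 : s * ((2 * n + 1) * (C + 1) + 1) ≤ r := by
      rw [← le_div_iff₀ hD]
      exact min_le_right _ _
    nlinarith

end Heisenberg

/-! ### Contact structures in a chart -/

section ChartForm

variable {E : Type} [NormedAddCommGroup E] [NormedSpace ℝ E]
  {M : Type*} [TopologicalSpace M] [ChartedSpace E M] [IsManifold 𝓘(ℝ, E) ∞ M]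

/-- The expression of a vector field in the chart at `p`. -/
def inChart (p : M) (V : ∀ q : M, TangentSpace 𝓘(ℝ, E) q) (x : E) : E :=
  VectorField.mpullbackWithin 𝓘(ℝ, E) 𝓘(ℝ, E) (extChartAt 𝓘(ℝ, E) p).symm V (range 𝓘(ℝ, E)) x

/-- The derivative of the inverse of the chart at `p`. -/
def chartDeriv (p : M) (x : E) : E →L[ℝ] TangentSpace 𝓘(ℝ, E) ((extChartAt 𝓘(ℝ, E) p).symm x) :=
  mfderivWithin 𝓘(ℝ, E) 𝓘(ℝ, E) (extChartAt 𝓘(ℝ, E) p).symm (range 𝓘(ℝ, E)) x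

lemma chartDeriv_isInvertible {p : M} {x : E} (hx : x ∈ (extChartAt 𝓘(ℝ, E) p).target) :
    (chartDeriv p x).IsInvertible :=
  isInvertible_mfderivWithin_extChartAt_symm hx

lemma chartDeriv_inChart {p : M} (V : ∀ q : M, TangentSpace 𝓘(ℝ, E) q) {x : E}
    (hx : x ∈ (extChartAt 𝓘(ℝ, E) p).target) :
    chartDeriv p x (inChart p V x) = V ((extChartAt 𝓘(ℝ, E) p).symm x) :=
  (chartDeriv_isInvertible hx).self_apply_inverse _

/-- The bracket is computed in the chart at p and carried back by the inverse of the derivative of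
that chart, which at p itself is the identity of `E`. Stating `key` for operators on `E` avoids
rewriting inside dependent tangent space types. -/
lemma mlieBracket_eq (p : M) (V W : ∀ q : M, TangentSpace 𝓘(ℝ, E) q) :
    VectorField.mlieBracket 𝓘(ℝ, E) V W p =
      VectorField.lieBracket ℝ (inChart p V) (inChart p W) (extChartAt 𝓘(ℝ, E) p p) := by
  have key : ∀ (A : E →L[ℝ] E) (w : E), A = ContinuousLinearMap.id ℝ E → A.inverse w = w := by
    rintro _ w rfl
    simp
  refine (key _ _ mfderiv_extChartAt_self).trans ?_
  change VectorField.lieBracketWithin ℝ (inChart p V) (inChart p W)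
    ((extChartAt 𝓘(ℝ, E) p).symm ⁻¹' univ ∩ range 𝓘(ℝ, E)) (extChartAt 𝓘(ℝ, E) p p) = _
  have hset : (extChartAt 𝓘(ℝ, E) p).symm ⁻¹' univ ∩ range 𝓘(ℝ, E) = univ := by simp
  rw [hset, VectorField.lieBracketWithin_univ]

lemma contDiffAt_inChart [CompleteSpace E] {p : M} {V : ∀ q : M, TangentSpace 𝓘(ℝ, E) q} {x : E}
    (hx : x ∈ (extChartAt 𝓘(ℝ, E) p).target)
    (hV : ContMDiffAt 𝓘(ℝ, E) 𝓘(ℝ, E).tangent ∞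
      (fun p ↦ (⟨p, V p⟩ : TangentBundle 𝓘(ℝ, E) M)) ((extChartAt 𝓘(ℝ, E) p).symm x)) :
    ContDiffAt ℝ ∞ (inChart p V) x := by
  have : IsManifold 𝓘(ℝ, E) 1 M := IsManifold.of_le (n := ∞) (by simp)
  have h1 : ContMDiffAt 𝓘(ℝ, E) 𝓘(ℝ, E) ∞ (extChartAt 𝓘(ℝ, E) p).symm x :=
    (contMDiffOn_extChartAt_symm p).contMDiffAt ((isOpen_extChartAt_target p).mem_nhds hx)
  have h2 : (mfderiv 𝓘(ℝ, E) 𝓘(ℝ, E) (extChartAt 𝓘(ℝ, E) p).symm x).IsInvertible := by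
    have := chartDeriv_isInvertible hx
    rwa [chartDeriv, modelWithCornersSelf_coe, range_id, mfderivWithin_univ] at this
  have h3 := hV.mpullback_vectorField_preimage h1 h2 (by simp)
  have h4 := contMDiffAt_vectorSpace_iff_contDiffAt.1 h3
  have h5 : inChart p V = VectorField.mpullback 𝓘(ℝ, E) 𝓘(ℝ, E) (extChartAt 𝓘(ℝ, E) p).symm V := by
    funext x
    rw [inChart, modelWithCornersSelf_coe, range_id, VectorField.mpullbackWithin_univ]
  rw [h5]
  exact h4

lemma chartDeriv_self_apply (p : M) (v : E) :
    chartDeriv p (extChartAt 𝓘(ℝ, E) p p) v = v := by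
  have key : ∀ (A : E →L[ℝ] E) (w : E), A = ContinuousLinearMap.id ℝ E → A w = w := by
    rintro _ w rfl
    simp
  exact key _ _ mfderivWithin_range_extChartAt_symm

/-- The two base points are equal, but not definitionally, hence the transport through `key`. -/
lemma chartDeriv_self_mem_iff (p : M) (S : ∀ q : M, Submodule ℝ (TangentSpace 𝓘(ℝ, E) q))
    (v : E) :
    chartDeriv p (extChartAt 𝓘(ℝ, E) p p) v ∈
      S ((extChartAt 𝓘(ℝ, E) p).symm (extChartAt 𝓘(ℝ, E) p p)) ↔
      (show TangentSpace 𝓘(ℝ, E) p from v) ∈ S p := by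
  have key : ∀ q, q = p → ∀ w : E, w = v → ((show TangentSpace 𝓘(ℝ, E) q from w) ∈ S q ↔
      (show TangentSpace 𝓘(ℝ, E) p from v) ∈ S p) := by
    rintro q rfl w rfl
    rfl
  exact key _ (extChartAt_to_inv p) _ (chartDeriv_self_apply p v)

lemma inChart_self (p : M) (V : ∀ q : M, TangentSpace 𝓘(ℝ, E) q) :
    inChart p V (extChartAt 𝓘(ℝ, E) p p) = V p := by
  have h := chartDeriv_inChart V (mem_extChartAt_target (I := 𝓘(ℝ, E)) p)
  have key : ∀ q, q = p → ∀ w : E, w = V q → w = V p := by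
    rintro q rfl w rfl
    rfl
  exact key _ (extChartAt_to_inv p) _ ((chartDeriv_self_apply p _).symm.trans h)

end ChartForm

/-! ### Hyperplane fields as kernels of forms, and Cartan's formula -/

section Frames

variable {E : Type} [NormedAddCommGroup E] [NormedSpace ℝ E]

/-- A hyperplane field with a smooth frame is locally the kernel of a smooth form. -/
theorem exists_form_of_frame [FiniteDimensional ℝ E] {k : ℕ} (hE : Module.finrank ℝ E = k + 1) {U₀ : Set E}
    (hU₀ : IsOpen U₀) {x₀ : E} (hx₀ : x₀ ∈ U₀) {v : Fin k → E → E}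
    (hv : ∀ i, ContDiffOn ℝ ∞ (v i) U₀)
    (hli : LinearIndependent ℝ (fun i ↦ v i x₀)) :
    ∃ (U : Set E) (α : E → E →L[ℝ] ℝ), IsOpen U ∧ x₀ ∈ U ∧ U ⊆ U₀ ∧ ContDiffOn ℝ ∞ α U ∧
      ∀ x ∈ U, α x ≠ 0 ∧ ∀ w, α x w = 0 ↔ w ∈ Submodule.span ℝ (range fun i ↦ v i x) := by
  obtain ⟨e, he⟩ : ∃ e, e ∉ Submodule.span ℝ (range fun i ↦ v i x₀) := by
    by_contra! h
    have h1 : Submodule.span ℝ (range fun i ↦ v i x₀) = ⊤ := eq_top_iff.2 fun x _ ↦ h x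
    have h2 := finrank_span_eq_card hli
    rw [h1, finrank_top, hE, Fintype.card_fin] at h2
    omega
  -- The frame is completed by a constant vector e, transverse to it at x₀, and α reads off the
  -- e-coordinate wherever the completed frame is a basis.
  let B : E → ((Fin k → ℝ) × ℝ) →L[ℝ] E := fun x ↦
    ∑ i, (((ContinuousLinearMap.proj i).comp (ContinuousLinearMap.fst ℝ (Fin k → ℝ) ℝ)).smulRight
      (v i x)) + (ContinuousLinearMap.snd ℝ (Fin k → ℝ) ℝ).smulRight e
  have hB : ∀ x c, B x c = ∑ i, c.1 i • v i x + c.2 • e := by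
    intro x c
    simp [B]
  have hBs : ContDiffOn ℝ ∞ B U₀ := by
    refine (ContDiffOn.sum fun i _ ↦ ?_).add contDiffOn_const
    exact contDiffOn_const.smulRight (hv i)
  have hinj : Function.Injective (B x₀) := by
    rw [injective_iff_map_eq_zero]
    intro c hc
    rw [hB] at hc
    have h2 : c.2 = 0 := by
      by_contra h2
      apply he
      have : e = (-c.2⁻¹) • ∑ i, c.1 i • v i x₀ := by
        rw [eq_neg_of_add_eq_zero_left hc]
        simp [smul_smul, h2]
      rw [this]
      exact Submodule.smul_mem _ _ (Submodule.sum_mem _ fun i _ ↦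
        Submodule.smul_mem _ _ (Submodule.subset_span ⟨i, rfl⟩))
    rw [h2, zero_smul, add_zero] at hc
    have h1 := Fintype.linearIndependent_iff.1 hli _ hc
    exact Prod.ext (funext h1) h2
  have hdim : Module.finrank ℝ ((Fin k → ℝ) × ℝ) = Module.finrank ℝ E := by
    simp [hE]
  let e₀ : ((Fin k → ℝ) × ℝ) ≃L[ℝ] E :=
    (LinearEquiv.ofInjectiveOfFinrankEq (B x₀).toLinearMap hinj hdim).toContinuousLinearEquiv
  have he₀ : (e₀ : ((Fin k → ℝ) × ℝ) →L[ℝ] E) = B x₀ := by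
    exact ContinuousLinearMap.ext fun c ↦ rfl
  refine ⟨U₀ ∩ B ⁻¹' range ((↑) : (((Fin k → ℝ) × ℝ) ≃L[ℝ] E) → _),
    fun x ↦ (ContinuousLinearMap.snd ℝ (Fin k → ℝ) ℝ).comp (B x).inverse,
    hBs.continuousOn.isOpen_inter_preimage hU₀ ContinuousLinearEquiv.isOpen,
    ⟨hx₀, e₀, he₀⟩, inter_subset_left, ?_, ?_⟩
  · intro x hx
    obtain ⟨hx, e', he'⟩ := hx
    have h1 : ContDiffAt ℝ ∞ B x := (hBs x hx).contDiffAt (hU₀.mem_nhds hx)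
    have h2 : ContDiffAt ℝ ∞ ContinuousLinearMap.inverse (B x) := by
      rw [← he']
      exact contDiffAt_map_inverse e'
    exact (contDiffAt_const.clm_comp (h2.comp x h1)).contDiffWithinAt
  · rintro x ⟨hx, e', he'⟩
    have he : ∀ c, e' c = ∑ i, c.1 i • v i x + c.2 • e := by
      intro c
      rw [← hB, ← he']
      rfl
    have hα : ∀ w, ((ContinuousLinearMap.snd ℝ (Fin k → ℝ) ℝ).comp (B x).inverse) w
        = (e'.symm w).2 := by
      intro w
      rw [← he', ContinuousLinearMap.inverse_equiv]
      rfl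
    constructor
    · intro h0
      change (ContinuousLinearMap.snd ℝ (Fin k → ℝ) ℝ).comp (B x).inverse = 0 at h0
      have h1 := hα (e' (0, 1))
      rw [h0] at h1
      simp at h1
    · intro w
      rw [hα]
      constructor
      · intro hw
        rw [← e'.apply_symm_apply w, he, hw, zero_smul, add_zero]
        exact Submodule.sum_mem _ fun i _ ↦
          Submodule.smul_mem _ _ (Submodule.subset_span ⟨i, rfl⟩)
      · intro hw
        obtain ⟨c, rfl⟩ := (Submodule.mem_span_range_iff_exists_fun ℝ).1 hw
        have : ∑ i, c i • v i x = e' (c, 0) := by simp [he]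
        rw [this, e'.symm_apply_apply]

/-- Cartan's formula dα(v, w) = v(α(w)) - w(α(v)) - α([v, w]); the first two terms vanish because v
and w are sections of the kernel near x. -/
lemma extDerivForm_eq_neg_lieBracket {α : E → E →L[ℝ] ℝ} {v w : E → E} {x : E}
    (hα : DifferentiableAt ℝ α x) (hv : DifferentiableAt ℝ v x) (hw : DifferentiableAt ℝ w x)
    (hv0 : ∀ᶠ y in 𝓝 x, α y (v y) = 0) (hw0 : ∀ᶠ y in 𝓝 x, α y (w y) = 0) :
    extDerivForm α x (v x) (w x) = -α x (VectorField.lieBracket ℝ v w x) := by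
  have key : ∀ {u : E → E}, DifferentiableAt ℝ u x → (∀ᶠ y in 𝓝 x, α y (u y) = 0) → ∀ z,
      fderiv ℝ α x z (u x) = -α x (fderiv ℝ u x z) := by
    intro u hu hu0 z
    have h1 := hα.hasFDerivAt.clm_apply hu.hasFDerivAt
    have h2 : HasFDerivAt (fun y ↦ α y (u y)) (0 : E →L[ℝ] ℝ) x :=
      (hasFDerivAt_const (0 : ℝ) x).congr_of_eventuallyEq hu0
    have h3 := congrArg (fun A ↦ A z) (h1.unique h2)
    simp at h3
    linarith
  rw [extDerivForm_apply, key hw hw0, key hv hv0, VectorField.lieBracket_eq, map_sub]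
  ring

end Frames

section ContactForm

variable {E : Type} [NormedAddCommGroup E] [NormedSpace ℝ E] [FiniteDimensional ℝ E]
  {M : Type*} [TopologicalSpace M] [ChartedSpace E M] [IsManifold 𝓘(ℝ, E) ∞ M]

/-- A contact structure is, in a chart, the kernel of a contact form. -/
theorem IsContactStructure.exists_form {n : ℕ} (hE : Module.finrank ℝ E = 2 * n + 1)
    {ξ : ∀ p : M, Submodule ℝ (TangentSpace 𝓘(ℝ, E) p)}
    (hξ : IsContactStructure 𝓘(ℝ, E) ξ n) (p : M) :
    ∃ (U : Set E) (α : E → E →L[ℝ] ℝ), IsOpen U ∧ extChartAt 𝓘(ℝ, E) p p ∈ U ∧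
      U ⊆ (extChartAt 𝓘(ℝ, E) p).target ∧ ContDiffOn ℝ ∞ α U ∧
      IsContactPair (α (extChartAt 𝓘(ℝ, E) p p))
        (extDerivForm α (extChartAt 𝓘(ℝ, E) p p)) ∧
      ∀ x ∈ U, ∀ v, α x v = 0 → chartDeriv p x v ∈ ξ ((extChartAt 𝓘(ℝ, E) p).symm x) := by
  obtain ⟨O, V, hO, hpO, hVs, hV⟩ := hξ.isDistribution p
  set χ := extChartAt 𝓘(ℝ, E) p with hχ
  have hxt : χ p ∈ χ.target := mem_extChartAt_target p
  set U₀ : Set E := χ.target ∩ χ.symm ⁻¹' O with hU₀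
  have hU₀o : IsOpen U₀ :=
    (continuousOn_extChartAt_symm p).isOpen_inter_preimage (isOpen_extChartAt_target p) hO
  have hsymm : χ.symm (χ p) = p := extChartAt_to_inv p
  have hx₀ : χ p ∈ U₀ := ⟨hxt, by rw [mem_preimage, hsymm]; exact hpO⟩
  let v : Fin (2 * n) → E → E := fun i ↦ inChart p (fun q ↦ (V i q : TangentSpace 𝓘(ℝ, E) q))
  have hvs : ∀ i, ContDiffOn ℝ ∞ (v i) U₀ := fun i x hx ↦
    (contDiffAt_inChart hx.1 ((hVs i).contMDiffAt (hO.mem_nhds hx.2))).contDiffWithinAt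
  have hspan : ∀ x ∈ U₀, ∀ w, w ∈ Submodule.span ℝ (range fun i ↦ v i x) ↔
      chartDeriv p x w ∈ ξ (χ.symm x) := by
    intro x hx w
    obtain ⟨e, he⟩ := chartDeriv_isInvertible hx.1
    have hv : ∀ i, chartDeriv p x (v i x) = V i (χ.symm x) := fun i ↦ chartDeriv_inChart _ hx.1
    constructor
    · intro hw
      obtain ⟨c, rfl⟩ := (Submodule.mem_span_range_iff_exists_fun ℝ).1 hw
      rw [map_sum]
      refine Submodule.sum_mem _ fun i _ ↦ ?_
      rw [map_smul, hv]
      exact Submodule.smul_mem _ _ (V i _).2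
    · intro hw
      have h1 : (⟨_, hw⟩ : ξ (χ.symm x)) ∈ Submodule.span ℝ (range fun i ↦ V i (χ.symm x)) := by
        rw [(hV _ hx.2).2]
        trivial
      obtain ⟨c, hc⟩ := (Submodule.mem_span_range_iff_exists_fun ℝ).1 h1
      refine (Submodule.mem_span_range_iff_exists_fun ℝ).2 ⟨c, ?_⟩
      have hinj : Function.Injective (chartDeriv p x) := by
        rw [← he]
        exact e.injective
      apply hinj
      rw [map_sum]
      have h2 := congrArg Subtype.val hc
      simp only [AddSubmonoidClass.coe_finsetSum, Submodule.coe_smul] at h2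
      rw [← h2]
      refine Finset.sum_congr rfl fun i _ ↦ ?_
      rw [map_smul, hv]
  have hli : LinearIndependent ℝ (fun i ↦ v i (χ p)) := by
    have h1 := (hV p hpO).1.map' (ξ p).subtype (Submodule.ker_subtype _)
    have h2 : (fun i ↦ v i (χ p)) = fun i ↦ ((V i p : TangentSpace 𝓘(ℝ, E) p) : E) :=
      funext fun i ↦ inChart_self p _
    rw [h2]
    exact h1
  obtain ⟨U, α, hU, hxU, hUU, hα, hker⟩ := exists_form_of_frame hE hU₀o hx₀ hvs hli
  have hker' : ∀ x ∈ U, ∀ w, α x w = 0 ↔ chartDeriv p x w ∈ ξ (χ.symm x) := fun x hx w ↦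
    ((hker x hx).2 w).trans (hspan x (hUU hx) w)
  have hself : ∀ w : E, α (χ p) w = 0 ↔ (show TangentSpace 𝓘(ℝ, E) p from w) ∈ ξ p := fun w ↦
    (hker' _ hxU w).trans (chartDeriv_self_mem_iff p ξ w)
  refine ⟨U, α, hU, hxU, fun x hx ↦ (hUU hx).1, hα, ⟨(hker _ hxU).1, ?_⟩,
    fun x hx v hv ↦ (hker' x hx v).1 hv⟩
  -- A nonzero X in the kernel with dα(X, ·) = μ α extends to a section Z of ξ with constant
  -- coefficients in the frame. For any smooth section W near p one gets α([Z, W]) = -dα(X, W) = -μ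
  -- α(W) = 0 at p, against the nondegeneracy of the bracket form.
  intro X μ hX hσ
  by_contra hX0
  have hXξ := (hself X).1 hX
  have h1 : (⟨_, hXξ⟩ : ξ p) ∈ Submodule.span ℝ (range fun i ↦ V i p) := by
    rw [(hV _ hpO).2]
    trivial
  obtain ⟨c, hc⟩ := (Submodule.mem_span_range_iff_exists_fun ℝ).1 h1
  let Z : ∀ q : M, ξ q := fun q ↦ ∑ i, c i • V i q
  have hZs : IsSmoothSectionOn 𝓘(ℝ, E) ξ Z O := by
    have := ContMDiffOn.sum_section (I := 𝓘(ℝ, E)) (F := E) (V := TangentSpace 𝓘(ℝ, E))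
      (s := Finset.univ) (n := ∞)
      (t := fun i q ↦ c i • (V i q : TangentSpace 𝓘(ℝ, E) q)) (u := O)
      fun i _ ↦ (hVs i).const_smul_section (a := c i)
    refine this.congr fun q _ ↦ ?_
    simp [Z]
  have hZp : Z p = ⟨_, hXξ⟩ := hc
  obtain ⟨O', W, hO', hpO', hWs, hbr⟩ := hξ.nondegenerate p O Z hO hpO hZs
    (by rw [hZp]; exact fun h ↦ hX0 (congrArg Subtype.val h))
  apply hbr
  rw [mlieBracket_eq]
  refine (hself _).1 ?_
  set z := inChart p (fun q ↦ (Z q : TangentSpace 𝓘(ℝ, E) q))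
  set w := inChart p (fun q ↦ (W q : TangentSpace 𝓘(ℝ, E) q))
  have hzX : z (χ p) = X := (inChart_self p _).trans (congrArg Subtype.val hZp)
  have hsec : ∀ Y : ∀ q : M, ξ q, ∀ᶠ x in 𝓝 (χ p),
      α x (inChart p (fun q ↦ (Y q : TangentSpace 𝓘(ℝ, E) q)) x) = 0 := by
    intro Y
    filter_upwards [hU.mem_nhds hxU] with x hx
    rw [hker' x hx, chartDeriv_inChart _ (hUU hx).1]
    exact (Y _).2
  have hdiff : ∀ (Y : ∀ q : M, ξ q) (O : Set M), IsOpen O → p ∈ O →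
      IsSmoothSectionOn 𝓘(ℝ, E) ξ Y O →
      DifferentiableAt ℝ (inChart p (fun q ↦ (Y q : TangentSpace 𝓘(ℝ, E) q))) (χ p) := by
    intro Y O hO hp hY
    refine (contDiffAt_inChart hxt (hY.contMDiffAt (hO.mem_nhds ?_))).differentiableAt (by simp)
    rw [← hχ, hsymm]
    exact hp
  have h3 := extDerivForm_eq_neg_lieBracket
    (((hα _ hxU).contDiffAt (hU.mem_nhds hxU)).differentiableAt (by simp))
    (hdiff Z O hO hpO hZs) (hdiff W O' hO' hpO' hWs) (hsec Z) (hsec W)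
  change extDerivForm α (χ p) (z (χ p)) (w (χ p)) = _ at h3
  rw [hzX, hσ] at h3
  have h4 : α (χ p) (w (χ p)) = 0 := (hsec W).self_of_nhds
  rw [smul_apply, h4, smul_zero] at h3
  exact neg_eq_zero.1 h3.symm

end ContactForm

/-! ### Open embeddings of the Heisenberg group in contact manifolds -/

section OpenEmbedding

variable {E F : Type} [NormedAddCommGroup E] [NormedSpace ℝ E]
  [NormedAddCommGroup F] [NormedSpace ℝ F]
  {M : Type*} [TopologicalSpace M] [ChartedSpace E M]

variable (E) in
/-- `φ` is a smooth open embedding of a vector space in a manifold, with inverse `ψ`. -/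
structure IsOpenSmoothEmbedding (φ : F → M) (ψ : M → F) : Prop where
  contMDiff : ContMDiff 𝓘(ℝ, F) 𝓘(ℝ, E) ∞ φ
  isOpenMap : IsOpenMap φ
  leftInverse : ∀ x, ψ (φ x) = x
  contMDiffOn : ContMDiffOn 𝓘(ℝ, E) 𝓘(ℝ, F) ∞ ψ (range φ)

lemma mfderiv_extChartAt_symm_comp [IsManifold 𝓘(ℝ, E) ∞ M] {f : F → E} (hf : ContDiff ℝ ∞ f) (p : M) (x : F)
    (hfp : f x ∈ (extChartAt 𝓘(ℝ, E) p).target) (v : F) :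
    mfderiv 𝓘(ℝ, F) 𝓘(ℝ, E) ((extChartAt 𝓘(ℝ, E) p).symm ∘ f) x v =
      chartDeriv p (f x) (fderiv ℝ f x v) := by
  have h1 : MDifferentiableAt 𝓘(ℝ, E) 𝓘(ℝ, E) (extChartAt 𝓘(ℝ, E) p).symm (f x) :=
    ((contMDiffOn_extChartAt_symm p).contMDiffAt
      ((isOpen_extChartAt_target p).mem_nhds hfp)).mdifferentiableAt (n := ∞) (by simp)
  have h2 : MDifferentiableAt 𝓘(ℝ, F) 𝓘(ℝ, E) f x :=
    hf.contMDiff.mdifferentiableAt (by simp)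
  have h3 : mfderiv 𝓘(ℝ, E) 𝓘(ℝ, E) (extChartAt 𝓘(ℝ, E) p).symm (f x) = chartDeriv p (f x) := by
    rw [chartDeriv, modelWithCornersSelf_coe, range_id, mfderivWithin_univ]
  rw [mfderiv_comp x h1 h2, h3, mfderiv_eq_fderiv]
  rfl

variable [FiniteDimensional ℝ E] [FiniteDimensional ℝ F]

/-- An injective smooth map with injective derivatives, between spaces of the same dimension, is an
open embedding with smooth inverse. -/
theorem exists_openPartialHomeomorph (hFE : Module.finrank ℝ F = Module.finrank ℝ E) {f : F → E}
    (hf : ContDiff ℝ ∞ f) (hinj : Function.Injective f)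
    (hinj' : ∀ x, Function.Injective (fderiv ℝ f x)) :
    ∃ P : OpenPartialHomeomorph F E, P.source = univ ∧ (∀ x, P x = f x) ∧
      ContDiffOn ℝ ∞ P.symm P.target := by
  let e : F → F ≃L[ℝ] E := fun x ↦ (LinearEquiv.ofInjectiveOfFinrankEq (fderiv ℝ f x : F →ₗ[ℝ] E)
    (hinj' x) hFE).toContinuousLinearEquiv
  have he : ∀ x, HasStrictFDerivAt f (e x : F →L[ℝ] E) x := fun x ↦
    hf.contDiffAt.hasStrictFDerivAt (by simp)
  have hopen : IsOpenMap f := isOpenMap_of_hasStrictFDerivAt_equiv he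
  have hemb : IsOpenEmbedding f := .of_continuous_injective_isOpenMap hf.continuous hinj hopen
  refine ⟨hemb.toOpenPartialHomeomorph f, rfl, fun _ ↦ rfl, ?_⟩
  intro y hy
  exact ((hemb.toOpenPartialHomeomorph f).contDiffAt_symm hy
    (he _).hasFDerivAt hf.contDiffAt).contDiffWithinAt

variable [IsManifold 𝓘(ℝ, E) ∞ M]

/-- An open embedding of a vector space in the target of a chart, composed with the inverse of the
chart, is a smooth open embedding. -/
theorem exists_isOpenSmoothEmbedding (hFE : Module.finrank ℝ F = Module.finrank ℝ E) {f : F → E}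
    (hf : ContDiff ℝ ∞ f) (hinj : Function.Injective f)
    (hinj' : ∀ x, Function.Injective (fderiv ℝ f x)) (p : M)
    (hfp : ∀ x, f x ∈ (extChartAt 𝓘(ℝ, E) p).target) :
    ∃ ψ : M → F, IsOpenSmoothEmbedding E ((extChartAt 𝓘(ℝ, E) p).symm ∘ f) ψ := by
  obtain ⟨P, hPs, hPf, hP⟩ := exists_openPartialHomeomorph hFE hf hinj hinj'
  refine ⟨P.symm ∘ extChartAt 𝓘(ℝ, E) p, ?_, ?_, ?_, ?_⟩
  · intro x
    exact ((contMDiffOn_extChartAt_symm p).contMDiffAt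
      ((isOpen_extChartAt_target p).mem_nhds (hfp x))).comp x hf.contMDiff.contMDiffAt
  · intro O hO
    have hfO : IsOpen (f '' O) := by
      have := P.isOpen_image_of_subset_source hO (by rw [hPs]; exact subset_univ _)
      rwa [image_congr fun x _ ↦ hPf x] at this
    rw [image_comp]
    refine (chartAt E p).isOpen_image_symm_of_subset_target hfO ?_
    rintro _ ⟨x, -, rfl⟩
    simpa [extChartAt_target] using hfp x
  · intro x
    rw [Function.comp_apply, Function.comp_apply, (extChartAt 𝓘(ℝ, E) p).right_inv (hfp x), ← hPf,
      P.left_inv (by rw [hPs]; trivial)]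
  · rintro _ ⟨x, rfl⟩
    have h1 : ContMDiffAt 𝓘(ℝ, E) 𝓘(ℝ, E) ∞ (extChartAt 𝓘(ℝ, E) p)
        ((extChartAt 𝓘(ℝ, E) p).symm (f x)) := by
      refine contMDiffAt_extChartAt' ?_
      have := (extChartAt 𝓘(ℝ, E) p).map_target (hfp x)
      rwa [extChartAt_source] at this
    have h2 : f x ∈ P.target := hPf x ▸ P.map_source (by rw [hPs]; trivial)
    have h3 : ContMDiffAt 𝓘(ℝ, E) 𝓘(ℝ, F) ∞ P.symm
        (extChartAt 𝓘(ℝ, E) p ((extChartAt 𝓘(ℝ, E) p).symm (f x))) := by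
      rw [(extChartAt 𝓘(ℝ, E) p).right_inv (hfp x)]
      exact ((hP _ h2).contDiffAt (P.open_target.mem_nhds h2)).contMDiffAt
    exact (h3.comp _ h1).contMDiffWithinAt

/-- In equal dimensions the complement of an immersion is trivial, hence `PUnit`. With f, followed
by a linear identification of E with F, as chart of the source and the chart at p in the target, the
map becomes linear. -/
theorem isSmoothEmbedding_extChartAt_symm_comp (hFE : Module.finrank ℝ F = Module.finrank ℝ E)
    {f : F → E} (hf : ContDiff ℝ ∞ f) (hinj : Function.Injective f)
    (hinj' : ∀ x, Function.Injective (fderiv ℝ f x)) (p : M)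
    (hfp : ∀ x, f x ∈ (extChartAt 𝓘(ℝ, E) p).target) :
    Manifold.IsSmoothEmbedding 𝓘(ℝ, F) 𝓘(ℝ, E) ∞ ((extChartAt 𝓘(ℝ, E) p).symm ∘ f) := by
  obtain ⟨P, hPs, hPf, hP⟩ := exists_openPartialHomeomorph hFE hf hinj hinj'
  obtain ⟨ψ, hψ⟩ := exists_isOpenSmoothEmbedding hFE hf hinj hinj' p hfp
  have hinj : Function.Injective ((extChartAt 𝓘(ℝ, E) p).symm ∘ f) :=
    Function.LeftInverse.injective hψ.leftInverse
  refine ⟨?_, (IsOpenEmbedding.of_continuous_injective_isOpenMap hψ.contMDiff.continuous hinj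
    hψ.isOpenMap).isEmbedding⟩
  let L : F ≃L[ℝ] E := ContinuousLinearEquiv.ofFinrankEq hFE
  let Q : OpenPartialHomeomorph F F := P.trans L.symm.toHomeomorph.toOpenPartialHomeomorph
  have hQ : Q ∈ IsManifold.maximalAtlas 𝓘(ℝ, F) ∞ F := by
    rw [IsManifold.mem_maximalAtlas_iff_contMDiffOn, contMDiffOn_iff_contDiffOn,
      contMDiffOn_iff_contDiffOn]
    constructor
    · refine (L.symm.contDiff.comp hf).contDiffOn.congr fun x _ ↦ ?_
      exact congrArg L.symm (hPf x)
    · refine hP.comp L.contDiff.contDiffOn fun x hx ↦ ?_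
      simpa [Q] using hx
  have key : Manifold.IsImmersionOfComplement PUnit.{1} 𝓘(ℝ, F) 𝓘(ℝ, E) ∞
      ((extChartAt 𝓘(ℝ, E) p).symm ∘ f) := by
    intro x
    refine Manifold.IsImmersionAtOfComplement.mk_of_continuousAt
      hψ.contMDiff.continuous.continuousAt
      ((ContinuousLinearEquiv.prodUnique ℝ F PUnit).trans L) Q (chartAt E p) ?_ ?_ hQ
      (IsManifold.chart_mem_maximalAtlas p) ?_
    · simp [Q, hPs]
    · have := (extChartAt 𝓘(ℝ, E) p).map_target (hfp x)
      rwa [extChartAt_source] at this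
    · intro u hu
      have hu' : L u ∈ P.target := by simpa [Q] using hu
      change extChartAt 𝓘(ℝ, E) p ((extChartAt 𝓘(ℝ, E) p).symm (f (P.symm (L u)))) = L u
      rw [(extChartAt 𝓘(ℝ, E) p).right_inv (hfp _), ← hPf, P.right_inv hu']
  exact key.isImmersion

end OpenEmbedding

section ContactEmbedding

variable {n : ℕ} {E : Type} [NormedAddCommGroup E] [NormedSpace ℝ E] [FiniteDimensional ℝ E]
  {M : Type*} [TopologicalSpace M] [ChartedSpace E M] [IsManifold 𝓘(ℝ, E) ∞ M]

/-- Every point of a contact manifold is the image of `0` under an open distributional embedding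
of the Heisenberg group. -/
theorem IsContactStructure.exists_embedding (hE : Module.finrank ℝ E = 2 * n + 1)
    {ξ : ∀ p : M, Submodule ℝ (TangentSpace 𝓘(ℝ, E) p)}
    (hξ : IsContactStructure 𝓘(ℝ, E) ξ n) (p : M) :
    ∃ (φ : Heisenberg n → M) (ψ : M → Heisenberg n), IsOpenSmoothEmbedding E φ ψ ∧
      IsOpenDistributionalEmbedding 𝓘(ℝ, E) 𝓘(ℝ, Heisenberg n) (Heisenberg.distribution n) ξ φ ∧
      φ 0 = p := by
  obtain ⟨U, α, hU, hpU, hUt, hα, hpair, hker⟩ := hξ.exists_form hE p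
  obtain ⟨r, Ψ, hr, hΨ0, hΨ, hΨi, hΨU, hΨd⟩ := exists_darboux_chart hE hU hα hpU hpair
  -- Ψ is a contact embedding on a ball only; f compresses the whole group into it.
  obtain ⟨f, hf, hf0, hfr⟩ := Heisenberg.exists_embedding_ball n hr
  have hat : ∀ x, ContDiffAt ℝ ∞ Ψ (f x) := fun x ↦
    (hΨ _ (hfr x)).contDiffAt (Metric.isOpen_ball.mem_nhds (hfr x))
  have hs : ContDiff ℝ ∞ (Ψ ∘ f) :=
    contDiff_iff_contDiffAt.2 fun x ↦ (hat x).comp x hf.contDiff.contDiffAt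
  have hinj : Function.Injective (Ψ ∘ f) := fun x y h ↦ hf.injective (hΨi (hfr x) (hfr y) h)
  have hd : ∀ x v, fderiv ℝ (Ψ ∘ f) x v = fderiv ℝ Ψ (f x) (fderiv ℝ f x v) := by
    intro x v
    rw [fderiv_comp x ((hat x).differentiableAt (by simp))
      (hf.contDiff.contDiffAt.differentiableAt (by simp))]
    rfl
  have hinj' : ∀ x, Function.Injective (fderiv ℝ (Ψ ∘ f) x) := by
    intro x
    rw [injective_iff_map_eq_zero]
    intro v hv
    rw [hd] at hv
    exact hf.fderiv_eq_zero _ _ ((injective_iff_map_eq_zero _).1 (hΨd _ (hfr x)).1 _ hv)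
  have hFE : Module.finrank ℝ (Heisenberg n) = Module.finrank ℝ E := by
    rw [hE, Heisenberg.finrank_eq]
  have ht : ∀ x, (Ψ ∘ f) x ∈ (extChartAt 𝓘(ℝ, E) p).target := fun x ↦ hUt (hΨU (hfr x))
  obtain ⟨ψ, hψ⟩ := exists_isOpenSmoothEmbedding hFE hs hinj hinj' p ht
  refine ⟨_, ψ, hψ, ⟨isSmoothEmbedding_extChartAt_symm_comp hFE hs hinj hinj' p ht,
    hψ.isOpenMap, ?_⟩, ?_⟩
  · intro x v hv
    rw [mfderiv_extChartAt_symm_comp hs p x (ht x) v]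
    refine hker _ (hΨU (hfr x)) _ ?_
    refine (congrArg (α (Ψ (f x))) (hd x v)).trans ?_
    exact (hΨd _ (hfr x)).2 _ (hf.form_eq_zero _ _ (Heisenberg.mem_horizontal_iff.1 hv))
  · simp [hf0, hΨ0]

end ContactEmbedding

/-! ### Comparison of the metrics -/

section Comparison

variable {n : ℕ} {E : Type} [NormedAddCommGroup E] [NormedSpace ℝ E]
  {M : Type*} [TopologicalSpace M] [ChartedSpace E M]

lemma IsOpenSmoothEmbedding.mfderiv_injective {F : Type} [NormedAddCommGroup F] [NormedSpace ℝ F]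
    {φ : F → M} {ψ : M → F} (hφ : IsOpenSmoothEmbedding E φ ψ) (x : F) :
    Function.Injective (mfderiv 𝓘(ℝ, F) 𝓘(ℝ, E) φ x) := by
  have h1 : HasMFDerivAt 𝓘(ℝ, F) 𝓘(ℝ, E) φ x (mfderiv 𝓘(ℝ, F) 𝓘(ℝ, E) φ x) :=
    (hφ.contMDiff.mdifferentiable (by simp) x).hasMFDerivAt
  have h2 : HasMFDerivAt 𝓘(ℝ, E) 𝓘(ℝ, F) ψ (φ x) (mfderiv 𝓘(ℝ, E) 𝓘(ℝ, F) ψ (φ x)) :=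
    (((hφ.contMDiffOn _ ⟨x, rfl⟩).contMDiffAt
      (hφ.isOpenMap.isOpen_range.mem_nhds ⟨x, rfl⟩)).mdifferentiableAt (by simp)).hasMFDerivAt
  have h3 := h2.comp x h1
  rw [show ψ ∘ φ = id from funext hφ.leftInverse] at h3
  have h4 := hasMFDerivAt_unique h3 (hasMFDerivAt_id x)
  intro v w hvw
  have key : ∀ (B : E →L[ℝ] F) (A : F →L[ℝ] E), B.comp A = ContinuousLinearMap.id ℝ F →
      ∀ v w, A v = A w → v = w := by
    intro B A hBA v w h
    have := congrArg B h
    rw [← ContinuousLinearMap.comp_apply, ← ContinuousLinearMap.comp_apply, hBA] at this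
    exact this
  exact key _ _ h4 v w hvw

lemma IsDistribution.finrank_eq [IsManifold 𝓘(ℝ, E) ∞ M] {k : ℕ} {ξ : ∀ p : M, Submodule ℝ (TangentSpace 𝓘(ℝ, E) p)}
    (hξ : IsDistribution 𝓘(ℝ, E) ξ k) (p : M) : Module.finrank ℝ (ξ p) = k := by
  obtain ⟨U, V, -, hp, -, hV⟩ := hξ p
  have h := finrank_span_eq_card (hV p hp).1
  rwa [(hV p hp).2, finrank_top, Fintype.card_fin] at h

variable {ξ : ∀ p : M, Submodule ℝ (TangentSpace 𝓘(ℝ, E) p)}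
  {φ : Heisenberg n → M} {ψ : M → Heisenberg n}

/-- An open distributional embedding identifies the distributions. -/
theorem mfderiv_mem_iff [FiniteDimensional ℝ E] [IsManifold 𝓘(ℝ, E) ∞ M]
    (hφ : IsOpenSmoothEmbedding E φ ψ)
    (hξ : IsDistribution 𝓘(ℝ, E) ξ (2 * n))
    (hd : ∀ x v, v ∈ Heisenberg.distribution n x → mfderiv 𝓘(ℝ, Heisenberg n) 𝓘(ℝ, E) φ x v ∈ ξ (φ x))
    (x v : Heisenberg n) : mfderiv 𝓘(ℝ, Heisenberg n) 𝓘(ℝ, E) φ x v ∈ ξ (φ x) ↔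
      v ∈ Heisenberg.horizontal n x := by
  refine ⟨fun h ↦ ?_, hd x v⟩
  have key : ∀ (A : Heisenberg n →L[ℝ] E) (S : Submodule ℝ E), Function.Injective A →
      Module.finrank ℝ S = 2 * n → (∀ w, w ∈ Heisenberg.horizontal n x → A w ∈ S) → A v ∈ S →
      v ∈ Heisenberg.horizontal n x := by
    intro A S hA hS hAS hv
    by_contra hv'
    rw [Heisenberg.mem_horizontal_iff] at hv'
    -- Horizontal vectors form a hyperplane, so one further vector sent into S would force all 2n +
    -- 1 dimensions injectively into 2n.
    have hall : ∀ w, A w ∈ S := by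
      intro w
      set c := Heisenberg.theta n x w / Heisenberg.theta n x v
      have h1 : A (w - c • v) ∈ S := by
        apply hAS
        rw [Heisenberg.mem_horizontal_iff, map_sub, map_smul, smul_eq_mul, div_mul_cancel₀ _ hv',
          sub_self]
      have h2 : A w = A (w - c • v) + c • A v := by simp
      rw [h2]
      exact S.add_mem h1 (S.smul_mem _ hv)
    have := LinearMap.finrank_le_finrank_of_injective
      (f := (A : Heisenberg n →ₗ[ℝ] E).codRestrict S hall)
      fun a b hab ↦ hA (congrArg Subtype.val hab)
    rw [hS, Heisenberg.finrank_eq] at this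
    omega
  exact key _ (ξ (φ x)) (hφ.mfderiv_injective x) (hξ.finrank_eq _) (hd x) h

namespace Heisenberg

/-- The frame `X_1, …, X_n, Y_1, …, Y_n`. -/
def frame (i : Fin n ⊕ Fin n) (p : Heisenberg n) : Heisenberg n :=
  Sum.elim (fun i ↦ X i p) (fun i ↦ Y i p) i

lemma frame_mem (i : Fin n ⊕ Fin n) (p : Heisenberg n) : frame i p ∈ horizontal n p := by
  rcases i with i | i
  · exact Submodule.subset_span (Or.inl ⟨i, rfl⟩)
  · exact Submodule.subset_span (Or.inr ⟨i, rfl⟩)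

lemma eq_sum_frame {p v : Heisenberg n} (hv : v ∈ horizontal n p) :
    v = ∑ i, v (Sum.inl i) • frame i p := by
  have ht := t_eq_of_mem hv
  rw [Fintype.sum_sum_type]
  refine ext_coord (fun i ↦ ?_) (fun i ↦ ?_) ?_
  · simp [frame, X, Y, Finset.sum_apply, Pi.single_apply]
  · simp [frame, X, Y, Finset.sum_apply, Pi.single_apply]
  · rw [ht, Finset.mul_sum]
    simp [frame, X, Y, ← Finset.sum_add_distrib]
    exact Finset.sum_congr rfl fun i _ ↦ by ring

lemma contDiff_frame (i : Fin n ⊕ Fin n) : ContDiff ℝ ∞ (frame (n := n) i) := by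
  rcases i with i | i
  · exact contDiff_const.add ((contDiff_const.mul (contDiff_coord _)).smul contDiff_const)
  · exact contDiff_const.sub ((contDiff_const.mul (contDiff_coord _)).smul contDiff_const)

end Heisenberg

open Classical in
/-- The image of the vector field `Z`, as a section of `ξ`. -/
def pushSection (ξ : ∀ p : M, Submodule ℝ (TangentSpace 𝓘(ℝ, E) p)) (φ : Heisenberg n → M)
    (ψ : M → Heisenberg n) (Z : Heisenberg n → Heisenberg n) (q : M) : ξ q :=
  if h : (show TangentSpace 𝓘(ℝ, E) q from
    mfderiv 𝓘(ℝ, Heisenberg n) 𝓘(ℝ, E) φ (ψ q) (Z (ψ q))) ∈ ξ q then ⟨_, h⟩ else 0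

/-- On the image of φ the default value 0 is not used. The transport is needed because ψ (φ x) and x
are only propositionally equal. -/
lemma pushSection_apply (hφ : ∀ x, ψ (φ x) = x) {Z : Heisenberg n → Heisenberg n} {x : Heisenberg n}
    (h : mfderiv 𝓘(ℝ, Heisenberg n) 𝓘(ℝ, E) φ x (Z x) ∈ ξ (φ x)) :
    pushSection ξ φ ψ Z (φ x) = ⟨_, h⟩ := by
  have key : ∀ y, y = x → (show E from mfderiv 𝓘(ℝ, Heisenberg n) 𝓘(ℝ, E) φ y (Z y)) =
      mfderiv 𝓘(ℝ, Heisenberg n) 𝓘(ℝ, E) φ x (Z x) := by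
    rintro y rfl
    rfl
  have h1 := key _ (hφ x)
  have h2 : (show TangentSpace 𝓘(ℝ, E) (φ x) from
    mfderiv 𝓘(ℝ, Heisenberg n) 𝓘(ℝ, E) φ (ψ (φ x)) (Z (ψ (φ x)))) ∈ ξ (φ x) :=
    Eq.subst (motive := fun w : E ↦ (show TangentSpace 𝓘(ℝ, E) (φ x) from w) ∈ ξ (φ x)) h1.symm h
  rw [pushSection, dif_pos h2]
  exact Subtype.ext h1

/-- The section is the tangent map of φ, after Z, after the smooth inverse ψ. -/
lemma isSmoothSectionOn_pushSection [IsManifold 𝓘(ℝ, E) ∞ M] (hφ : IsOpenSmoothEmbedding E φ ψ)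
    {Z : Heisenberg n → Heisenberg n} (hZ : ContDiff ℝ ∞ Z)
    (h : ∀ x, mfderiv 𝓘(ℝ, Heisenberg n) 𝓘(ℝ, E) φ x (Z x) ∈ ξ (φ x)) :
    IsSmoothSectionOn 𝓘(ℝ, E) ξ (pushSection ξ φ ψ Z) (range φ) := by
  have h1 : ContMDiff 𝓘(ℝ, Heisenberg n).tangent 𝓘(ℝ, E).tangent ∞
      (tangentMap 𝓘(ℝ, Heisenberg n) 𝓘(ℝ, E) φ) :=
    hφ.contMDiff.contMDiff_tangentMap (by simp)
  have h2 : ContMDiff 𝓘(ℝ, Heisenberg n) 𝓘(ℝ, Heisenberg n).tangent ∞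
      (fun x ↦ (⟨x, Z x⟩ : TangentBundle 𝓘(ℝ, Heisenberg n) (Heisenberg n))) :=
    contMDiff_vectorSpace_iff_contDiff.2 hZ
  refine ((h1.comp h2).comp_contMDiffOn hφ.contMDiffOn).congr ?_
  rintro _ ⟨x, rfl⟩
  rw [pushSection_apply hφ.leftInverse (h x)]
  simp only [Function.comp_apply, hφ.leftInverse]
  rfl

/-- On a compact set, the sub-Riemannian norm of the image of a horizontal vector is comparable
to its norm. -/
theorem exists_speed_comparison [IsManifold 𝓘(ℝ, E) ∞ M]
    (hφ : IsOpenSmoothEmbedding E φ ψ)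
    (hD : ∀ x v : Heisenberg n, mfderiv 𝓘(ℝ, Heisenberg n) 𝓘(ℝ, E) φ x v ∈ ξ (φ x) ↔
      v ∈ Heisenberg.horizontal n x)
    (g : SubRiemannianMetric 𝓘(ℝ, E) ξ) {K : Set (Heisenberg n)} (hK : IsCompact K) :
    ∃ C : ℝ≥0, ∀ x ∈ K, ∀ v ∈ Heisenberg.horizontal n x,
      ‖v‖ₑ ≤ C * g.speed (φ x) (mfderiv 𝓘(ℝ, Heisenberg n) 𝓘(ℝ, E) φ x v) ∧
      g.speed (φ x) (mfderiv 𝓘(ℝ, Heisenberg n) 𝓘(ℝ, E) φ x v) ≤ C * ‖v‖ₑ := by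
  have hZ : ∀ i x, mfderiv 𝓘(ℝ, Heisenberg n) 𝓘(ℝ, E) φ x (Heisenberg.frame i x) ∈ ξ (φ x) :=
    fun i x ↦ (hD x _).2 (Heisenberg.frame_mem i x)
  let V : Fin n ⊕ Fin n → ∀ q : M, ξ q := fun i ↦ pushSection ξ φ ψ (Heisenberg.frame i)
  have hV : ∀ i x, V i (φ x) = ⟨_, hZ i x⟩ := fun i x ↦ pushSection_apply hφ.leftInverse (hZ i x)
  let G : Fin n ⊕ Fin n → Fin n ⊕ Fin n → Heisenberg n → ℝ := fun i j x ↦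
    g.inner (φ x) (V i (φ x)) (V j (φ x))
  have hG : ∀ i j, Continuous (G i j) := fun i j ↦
    ((g.smooth _ (V i) (V j) hφ.isOpenMap.isOpen_range
      (isSmoothSectionOn_pushSection hφ (Heisenberg.contDiff_frame i) (hZ i))
      (isSmoothSectionOn_pushSection hφ (Heisenberg.contDiff_frame j) (hZ j))).continuousOn
      ).comp_continuous hφ.contMDiff.continuous fun x ↦ ⟨x, rfl⟩
  -- q is the quadratic form of the Gram matrix of g in the pushed frame. It is continuous in all
  -- pairs (x, v), but is the squared speed only for horizontal v.
  let q : Heisenberg n × Heisenberg n → ℝ := fun z ↦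
    ∑ i, ∑ j, z.2 (Sum.inl i) * (z.2 (Sum.inl j) * G i j z.1)
  have hq : Continuous q := by
    have hc : ∀ i : Fin n ⊕ Fin n, Continuous fun z : Heisenberg n × Heisenberg n ↦
        z.2 (Sum.inl i) := fun i ↦ (Heisenberg.contDiff_coord _).continuous.comp continuous_snd
    exact continuous_finsetSum _ fun i _ ↦ continuous_finsetSum _ fun j _ ↦
      (hc i).mul ((hc j).mul ((hG i j).comp continuous_fst))
  have hqg : ∀ x v, ∀ hv : v ∈ Heisenberg.horizontal n x,
      g.inner (φ x) ⟨_, (hD x v).2 hv⟩ ⟨_, (hD x v).2 hv⟩ = q (x, v) := by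
    intro x v hv
    have h1 : (⟨_, (hD x v).2 hv⟩ : ξ (φ x)) = ∑ i, v (Sum.inl i) • V i (φ x) := by
      have key : ∀ A : Heisenberg n →L[ℝ] E, A v =
          ∑ i, v (Sum.inl i) • A (Heisenberg.frame i x) := by
        intro A
        conv_lhs => rw [Heisenberg.eq_sum_frame hv]
        rw [map_sum]
        simp only [map_smul]
      refine Subtype.ext ((key (mfderiv 𝓘(ℝ, Heisenberg n) 𝓘(ℝ, E) φ x)).trans ?_)
      simp only [hV, AddSubmonoidClass.coe_finsetSum, Submodule.coe_smul]
      rfl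
    rw [h1]
    simp only [map_sum, map_smul, LinearMap.sum_apply, LinearMap.smul_apply, smul_eq_mul, q,
      Finset.mul_sum, G]
    exact Finset.sum_comm.trans (Finset.sum_congr rfl fun i _ ↦ Finset.sum_congr rfl fun j _ ↦ by
      ring)
  have hspeed : ∀ x, ∀ v ∈ Heisenberg.horizontal n x,
      g.speed (φ x) (mfderiv 𝓘(ℝ, Heisenberg n) 𝓘(ℝ, E) φ x v) =
        ENNReal.ofReal (Real.sqrt (q (x, v))) := by
    intro x v hv
    rw [SubRiemannianMetric.speed, dif_pos ((hD x v).2 hv), hqg x v hv]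
  have hpos : ∀ x, ∀ v ∈ Heisenberg.horizontal n x, v ≠ 0 → 0 < q (x, v) := by
    intro x v hv hv0
    rw [← hqg x v hv]
    refine g.pos _ _ fun h ↦ hv0 (hφ.mfderiv_injective x ?_)
    exact (congrArg Subtype.val h).trans (map_zero (mfderiv 𝓘(ℝ, Heisenberg n) 𝓘(ℝ, E) φ x)).symm
  let S : Set (Heisenberg n × Heisenberg n) := (K ×ˢ Metric.sphere 0 1) ∩
    {z | Heisenberg.theta n z.1 z.2 = 0}
  have hS : IsCompact S := (hK.prod (isCompact_sphere 0 1)).inter_right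
    (isClosed_eq ((Heisenberg.contDiff_theta.continuous.comp continuous_fst).clm_apply
      continuous_snd) continuous_const)
  have hSmem : ∀ x ∈ K, ∀ v ∈ Heisenberg.horizontal n x, v ≠ 0 → (x, ‖v‖⁻¹ • v) ∈ S := by
    intro x hx v hv hv0
    refine ⟨⟨hx, ?_⟩, ?_⟩
    · rw [mem_sphere_zero_iff_norm, norm_smul, norm_inv, norm_norm,
        inv_mul_cancel₀ (norm_ne_zero_iff.2 hv0)]
    · change Heisenberg.theta n x (‖v‖⁻¹ • v) = 0
      rw [map_smul, Heisenberg.mem_horizontal_iff.1 hv, smul_zero]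
  -- On the compact set of horizontal unit vectors over K, q lies between some m > 0 and B.
  -- Homogeneity extends this to all horizontal vectors, with a constant dominating both 1 / √m and
  -- √B.
  obtain ⟨m, hm, hmS⟩ := hS.exists_forall_le' hq.continuousOn (a := 0) fun z hz ↦ by
    refine hpos z.1 z.2 (Heisenberg.mem_horizontal_iff.2 hz.2) fun h ↦ ?_
    have := mem_sphere_zero_iff_norm.1 hz.1.2
    rw [h, norm_zero] at this
    exact zero_ne_one this
  obtain ⟨B, hB⟩ := hS.exists_bound_of_continuousOn hq.continuousOn
  set c : ℝ := (Real.sqrt m)⁻¹ + Real.sqrt B with hc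
  have hm' : 0 < Real.sqrt m := Real.sqrt_pos.2 hm
  have hc0 : 0 ≤ c := add_nonneg (inv_nonneg.2 hm'.le) (Real.sqrt_nonneg _)
  refine ⟨c.toNNReal, fun x hx v hv ↦ ?_⟩
  have hcC : ((c.toNNReal : ℝ≥0) : ℝ≥0∞) = ENNReal.ofReal c := rfl
  rw [hspeed x v hv, hcC, ← ofReal_norm, ← ENNReal.ofReal_mul hc0, ← ENNReal.ofReal_mul hc0]
  suffices h : ‖v‖ ≤ c * Real.sqrt (q (x, v)) ∧ Real.sqrt (q (x, v)) ≤ c * ‖v‖ from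
    ⟨ENNReal.ofReal_le_ofReal h.1, ENNReal.ofReal_le_ofReal h.2⟩
  by_cases hv0 : v = 0
  · have : q (x, 0) = 0 := by simp [q]
    simp [hv0, this]
  have hw := hSmem x hx v hv hv0
  have hqv : Real.sqrt (q (x, v)) = ‖v‖ * Real.sqrt (q (x, ‖v‖⁻¹ • v)) := by
    have h1 : q (x, v) = ‖v‖ ^ 2 * q (x, ‖v‖⁻¹ • v) := by
      have h2 : ‖v‖ ≠ 0 := norm_ne_zero_iff.2 hv0
      simp only [q, Finset.mul_sum, PiLp.smul_apply, smul_eq_mul]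
      refine Finset.sum_congr rfl fun i _ ↦ Finset.sum_congr rfl fun j _ ↦ ?_
      field_simp
    rw [h1, Real.sqrt_mul (sq_nonneg _), Real.sqrt_sq (norm_nonneg _)]
  have h1 : Real.sqrt m ≤ Real.sqrt (q (x, ‖v‖⁻¹ • v)) := Real.sqrt_le_sqrt (hmS _ hw)
  have h2 : Real.sqrt (q (x, ‖v‖⁻¹ • v)) ≤ Real.sqrt B :=
    Real.sqrt_le_sqrt ((Real.le_norm_self _).trans (hB _ hw))
  have h3 := norm_nonneg v
  rw [hqv]
  constructor
  · have h4 : 1 ≤ c * Real.sqrt (q (x, ‖v‖⁻¹ • v)) := by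
      calc (1 : ℝ) = (Real.sqrt m)⁻¹ * Real.sqrt m := (inv_mul_cancel₀ hm'.ne').symm
        _ ≤ c * Real.sqrt (q (x, ‖v‖⁻¹ • v)) :=
          mul_le_mul (by linarith [Real.sqrt_nonneg B]) h1 hm'.le hc0
    nlinarith
  · have h4 : Real.sqrt (q (x, ‖v‖⁻¹ • v)) ≤ c := by linarith [inv_nonneg.2 hm'.le]
    nlinarith

end Comparison

/-! ### Horizontal paths in the image of an embedding -/

section Paths

variable {n : ℕ} {E : Type} [NormedAddCommGroup E] [NormedSpace ℝ E]
  {M : Type*} [TopologicalSpace M] [ChartedSpace E M]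
  {ξ : ∀ p : M, Submodule ℝ (TangentSpace 𝓘(ℝ, E) p)}

namespace Heisenberg

/-- A smooth horizontal curve in the vector space `Heisenberg n`. -/
structure IsHorizontalCurve (a b : ℝ) (η : ℝ → Heisenberg n) : Prop where
  lt : a < b
  contDiffOn : ContDiffOn ℝ ∞ η (Icc a b)
  mem : ∀ t ∈ Icc a b, derivWithin η (Icc a b) t ∈ horizontal n (η t)

/-- The Euclidean length of a curve. -/
def curveLength (a b : ℝ) (η : ℝ → Heisenberg n) : ℝ≥0∞ :=
  ∫⁻ t in Icc a b, ‖derivWithin η (Icc a b) t‖ₑ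

end Heisenberg

/-- This is the chain rule, stated in `E` because the tangent spaces at γ t and at φ (η t) are
different types. -/
lemma IsOpenSmoothEmbedding.mfderivWithin_eq {φ : Heisenberg n → M} {ψ : M → Heisenberg n}
    (hφ : IsOpenSmoothEmbedding E φ ψ) {a b : ℝ} (hab : a < b)
    {γ : ℝ → M} {η : ℝ → Heisenberg n} (hη : ContDiffOn ℝ ∞ η (Icc a b))
    (hγ : EqOn γ (φ ∘ η) (Icc a b)) {t : ℝ} (ht : t ∈ Icc a b) :
    (show E from mfderivWithin 𝓘(ℝ, ℝ) 𝓘(ℝ, E) γ (Icc a b) t (1 : ℝ)) =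
      mfderiv 𝓘(ℝ, Heisenberg n) 𝓘(ℝ, E) φ (η t) (derivWithin η (Icc a b) t) := by
  have hu : UniqueMDiffWithinAt 𝓘(ℝ, ℝ) (Icc a b) t :=
    (uniqueDiffOn_Icc hab t ht).uniqueMDiffWithinAt
  have h1 : MDifferentiableAt 𝓘(ℝ, Heisenberg n) 𝓘(ℝ, E) φ (η t) :=
    hφ.contMDiff.mdifferentiable (by simp) _
  have h2 : MDifferentiableWithinAt 𝓘(ℝ, ℝ) 𝓘(ℝ, Heisenberg n) η (Icc a b) t :=
    (hη.contMDiffOn t ht).mdifferentiableWithinAt (by simp)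
  have h3 := (h1.hasMFDerivAt.comp_hasMFDerivWithinAt t h2.hasMFDerivWithinAt).congr_mono hγ (hγ ht)
    Subset.rfl
  have h4 := h3.mfderivWithin hu
  have key : ∀ A B : ℝ →L[ℝ] E, A = B → A 1 = B 1 := fun A B h ↦ by rw [h]
  refine (key _ _ h4).trans ?_
  change mfderiv 𝓘(ℝ, Heisenberg n) 𝓘(ℝ, E) φ (η t)
    (mfderivWithin 𝓘(ℝ, ℝ) 𝓘(ℝ, Heisenberg n) η (Icc a b) t (1 : ℝ)) = _
  rw [mfderivWithin_eq_fderivWithin]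
  rfl

variable [IsManifold 𝓘(ℝ, E) ∞ M]

namespace SubRiemannianMetric

lemma speed_congr (g : SubRiemannianMetric 𝓘(ℝ, E) ξ) {p q : M} (h : p = q) {v w : E}
    (hv : v = w) : g.speed p v = g.speed q w := by
  subst h hv
  rfl

/-- This serves to cut a path at its first exit time. -/
lemma length_mono (g : SubRiemannianMetric 𝓘(ℝ, E) ξ) {a b c : ℝ} {γ : ℝ → M}
    (hγ : IsHorizontalPath 𝓘(ℝ, E) ξ a b γ) (hac : a < c) (hcb : c ≤ b) :
    IsHorizontalPath 𝓘(ℝ, E) ξ a c γ ∧ g.length a c γ ≤ g.length a b γ := by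
  have hsub : Icc a c ⊆ Icc a b := Icc_subset_Icc_right hcb
  have hd : ∀ t ∈ Icc a c, mfderivWithin 𝓘(ℝ, ℝ) 𝓘(ℝ, E) γ (Icc a c) t =
      mfderivWithin 𝓘(ℝ, ℝ) 𝓘(ℝ, E) γ (Icc a b) t := fun t ht ↦
    mfderivWithin_subset hsub (uniqueDiffOn_Icc hac t ht).uniqueMDiffWithinAt
      ((hγ.smooth t (hsub ht)).mdifferentiableWithinAt (by simp))
  refine ⟨⟨hac, hγ.smooth.mono hsub, fun t ht ↦ ?_⟩, ?_⟩
  · rw [hd t ht]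
    exact hγ.horizontal t (hsub ht)
  · refine le_trans (le_of_eq ?_) (lintegral_mono_set hsub)
    refine setLIntegral_congr_fun measurableSet_Icc fun t ht ↦ ?_
    rw [hd t ht]

end SubRiemannianMetric

namespace IsOpenSmoothEmbedding

variable {φ : Heisenberg n → M} {ψ : M → Heisenberg n}

/-- The image of a horizontal curve is a horizontal path. -/
theorem isHorizontalPath_comp (hφ : IsOpenSmoothEmbedding E φ ψ)
    (hD : ∀ x v : Heisenberg n, mfderiv 𝓘(ℝ, Heisenberg n) 𝓘(ℝ, E) φ x v ∈ ξ (φ x) ↔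
      v ∈ Heisenberg.horizontal n x)
    (g : SubRiemannianMetric 𝓘(ℝ, E) ξ) {K : Set (Heisenberg n)} {C : ℝ≥0}
    (hC : ∀ x ∈ K, ∀ v ∈ Heisenberg.horizontal n x,
      ‖v‖ₑ ≤ C * g.speed (φ x) (mfderiv 𝓘(ℝ, Heisenberg n) 𝓘(ℝ, E) φ x v) ∧
      g.speed (φ x) (mfderiv 𝓘(ℝ, Heisenberg n) 𝓘(ℝ, E) φ x v) ≤ C * ‖v‖ₑ)
    {a b : ℝ} {η : ℝ → Heisenberg n}
    (hη : Heisenberg.IsHorizontalCurve a b η) (hK : MapsTo η (Icc a b) K) :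
    IsHorizontalPath 𝓘(ℝ, E) ξ a b (φ ∘ η) ∧
      g.length a b (φ ∘ η) ≤ C * Heisenberg.curveLength a b η := by
  have hd := fun t ht ↦ hφ.mfderivWithin_eq hη.lt hη.contDiffOn (γ := φ ∘ η) (fun _ _ ↦ rfl)
    (t := t) ht
  refine ⟨⟨hη.lt, hφ.contMDiff.comp_contMDiffOn hη.contDiffOn.contMDiffOn, fun t ht ↦ ?_⟩, ?_⟩
  · exact Eq.subst (motive := fun w : E ↦ (show TangentSpace 𝓘(ℝ, E) (φ (η t)) from w) ∈ ξ (φ (η t)))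
      (hd t ht).symm ((hD _ _).2 (hη.mem t ht))
  · rw [Heisenberg.curveLength, ← lintegral_const_mul' _ _ ENNReal.coe_ne_top]
    refine setLIntegral_mono' measurableSet_Icc fun t ht ↦ ?_
    exact (g.speed_congr rfl (hd t ht)).le.trans (hC _ (hK ht) _ (hη.mem t ht)).2

/-- A horizontal path in the image of an embedding comes from a horizontal curve. -/
theorem isHorizontalCurve_comp (hφ : IsOpenSmoothEmbedding E φ ψ)
    (hD : ∀ x v : Heisenberg n, mfderiv 𝓘(ℝ, Heisenberg n) 𝓘(ℝ, E) φ x v ∈ ξ (φ x) ↔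
      v ∈ Heisenberg.horizontal n x)
    (g : SubRiemannianMetric 𝓘(ℝ, E) ξ) {K : Set (Heisenberg n)} {C : ℝ≥0}
    (hC : ∀ x ∈ K, ∀ v ∈ Heisenberg.horizontal n x,
      ‖v‖ₑ ≤ C * g.speed (φ x) (mfderiv 𝓘(ℝ, Heisenberg n) 𝓘(ℝ, E) φ x v) ∧
      g.speed (φ x) (mfderiv 𝓘(ℝ, Heisenberg n) 𝓘(ℝ, E) φ x v) ≤ C * ‖v‖ₑ)
    {a b : ℝ} {γ : ℝ → M} (hγ : IsHorizontalPath 𝓘(ℝ, E) ξ a b γ)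
    (hK : MapsTo γ (Icc a b) (φ '' K)) :
    Heisenberg.IsHorizontalCurve a b (ψ ∘ γ) ∧ MapsTo (ψ ∘ γ) (Icc a b) K ∧
      Heisenberg.curveLength a b (ψ ∘ γ) ≤ C * g.length a b γ := by
  have heq : EqOn γ (φ ∘ ψ ∘ γ) (Icc a b) := by
    intro t ht
    obtain ⟨x, -, hx⟩ := hK ht
    rw [Function.comp_apply, Function.comp_apply, ← hx, hφ.leftInverse]
  have hm : MapsTo (ψ ∘ γ) (Icc a b) K := by
    intro t ht
    obtain ⟨x, hxK, hx⟩ := hK ht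
    rwa [Function.comp_apply, ← hx, hφ.leftInverse]
  have hs : ContDiffOn ℝ ∞ (ψ ∘ γ) (Icc a b) :=
    contMDiffOn_iff_contDiffOn.1 (hφ.contMDiffOn.comp hγ.smooth fun t ht ↦
      image_subset_range _ _ (hK ht))
  have hd := fun t ht ↦ hφ.mfderivWithin_eq hγ.lt hs heq (t := t) ht
  have hmem : ∀ t ∈ Icc a b, derivWithin (ψ ∘ γ) (Icc a b) t ∈
      Heisenberg.horizontal n ((ψ ∘ γ) t) := by
    intro t ht
    rw [← hD]
    have key : ∀ (p q : M) (_ : p = q) (v w : E) (_ : v = w),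
        (show TangentSpace 𝓘(ℝ, E) p from v) ∈ ξ p →
        (show TangentSpace 𝓘(ℝ, E) q from w) ∈ ξ q := by
      rintro p q rfl v w rfl h
      exact h
    exact key _ _ (heq ht) _ _ (hd t ht) (hγ.horizontal t ht)
  refine ⟨⟨hγ.lt, hs, hmem⟩, hm, ?_⟩
  rw [SubRiemannianMetric.length, ← lintegral_const_mul' _ _ ENNReal.coe_ne_top]
  refine setLIntegral_mono' measurableSet_Icc fun t ht ↦ ?_
  refine (hC _ (hm ht) _ (hmem t ht)).1.trans (le_of_eq ?_)
  exact congrArg _ (g.speed_congr (heq ht) (hd t ht)).symm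

end IsOpenSmoothEmbedding

lemma Heisenberg.IsHorizontalCurve.enorm_sub_le {a b : ℝ} {η : ℝ → Heisenberg n}
    (hη : Heisenberg.IsHorizontalCurve a b η) :
    ‖η b - η a‖ₑ ≤ Heisenberg.curveLength a b η :=
  enorm_sub_le_lintegral_derivWithin_Icc_of_contDiffOn_Icc (hη.contDiffOn.of_le (by simp)) hη.lt.le

/-- A horizontal path which leaves the image of a ball has length bounded below. -/
theorem IsOpenSmoothEmbedding.le_length_of_not_mapsTo [T2Space M]
    {φ : Heisenberg n → M} {ψ : M → Heisenberg n} (hφ : IsOpenSmoothEmbedding E φ ψ)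
    (hD : ∀ x v : Heisenberg n, mfderiv 𝓘(ℝ, Heisenberg n) 𝓘(ℝ, E) φ x v ∈ ξ (φ x) ↔
      v ∈ Heisenberg.horizontal n x)
    (g : SubRiemannianMetric 𝓘(ℝ, E) ξ) {x y : Heisenberg n} {r R : ℝ} {C : ℝ≥0}
    (hC : ∀ x' ∈ Metric.closedBall x R, ∀ v ∈ Heisenberg.horizontal n x',
      ‖v‖ₑ ≤ C * g.speed (φ x') (mfderiv 𝓘(ℝ, Heisenberg n) 𝓘(ℝ, E) φ x' v) ∧
      g.speed (φ x') (mfderiv 𝓘(ℝ, Heisenberg n) 𝓘(ℝ, E) φ x' v) ≤ C * ‖v‖ₑ)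
    {a b : ℝ} {γ : ℝ → M} (hγ : IsHorizontalPath 𝓘(ℝ, E) ξ a b γ) (hγa : γ a = φ y)
    (hy : dist y x ≤ r) (hrR : r < R)
    (hγR : ¬ MapsTo γ (Icc a b) (φ '' Metric.ball x R)) :
    ENNReal.ofReal (R - r) ≤ C * g.length a b γ := by
  have hinj : Function.Injective φ := Function.LeftInverse.injective hφ.leftInverse
  have hcont := hγ.smooth.continuousOn
  -- S consists of the times spent outside the image of the open ball. That image is open, so S is
  -- closed and has a least element c, the first exit time.
  let S : Set ℝ := Icc a b ∩ γ ⁻¹' (φ '' Metric.ball x R)ᶜ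
  have hS : IsClosed S := hcont.preimage_isClosed_of_isClosed isClosed_Icc
    (hφ.isOpenMap _ Metric.isOpen_ball).isClosed_compl
  have hne : S.Nonempty := by
    rw [MapsTo] at hγR
    push Not at hγR
    obtain ⟨t, ht, ht'⟩ := hγR
    exact ⟨t, ht, ht'⟩
  obtain ⟨c, hcS, hc⟩ := (isCompact_Icc.of_isClosed_subset hS inter_subset_left).exists_isLeast hne
  have hac : a < c := by
    refine lt_of_le_of_ne hcS.1.1 fun h ↦ hcS.2 ?_
    rw [← h, hγa]
    exact ⟨y, Metric.mem_ball.2 (hy.trans_lt hrR), rfl⟩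
  have hlt : ∀ t ∈ Ico a c, γ t ∈ φ '' Metric.closedBall x R := by
    intro t ht
    by_contra h
    have : t ∈ S := ⟨⟨ht.1, ht.2.le.trans hcS.1.2⟩, fun h' ↦
      h (image_mono Metric.ball_subset_closedBall h')⟩
    exact absurd (hc this) (not_le.2 ht.2)
  -- The image of the closed ball is compact, hence closed in the Hausdorff space M. So the path is
  -- still in it at time c, and can be lifted on all of [a, c].
  have hcl : IsClosed (φ '' Metric.closedBall x R) :=
    ((isCompact_closedBall x R).image hφ.contMDiff.continuous).isClosed
  have hγc : γ c ∈ φ '' Metric.closedBall x R := by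
    have h1 : ContinuousWithinAt γ (Ico a c) c := (hcont c hcS.1).mono
      fun t ht ↦ ⟨ht.1, ht.2.le.trans hcS.1.2⟩
    have h2 : c ∈ closure (Ico a c) := by
      rw [closure_Ico hac.ne]
      exact right_mem_Icc.2 hac.le
    exact hcl.closure_subset (h1.mem_closure h2 hlt)
  have hmaps : MapsTo γ (Icc a c) (φ '' Metric.closedBall x R) := by
    intro t ht
    rcases ht.2.lt_or_eq with h | h
    · exact hlt t ⟨ht.1, h⟩
    · rwa [h]
  obtain ⟨hγ', hlen⟩ := g.length_mono hγ hac hcS.1.2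
  obtain ⟨hη, -, hηl⟩ := hφ.isHorizontalCurve_comp hD g hC hγ' hmaps
  obtain ⟨z, hz, hzc⟩ := hγc
  have hzR : R ≤ dist z x := by
    by_contra h
    exact hcS.2 ⟨z, Metric.mem_ball.2 (not_le.1 h), hzc⟩
  have h1 := hη.enorm_sub_le
  rw [Function.comp_apply, Function.comp_apply, ← hzc, hγa, hφ.leftInverse, hφ.leftInverse] at h1
  have h2 : R - r ≤ ‖z - y‖ := by
    rw [← dist_eq_norm]
    linarith [dist_triangle z y x]
  calc ENNReal.ofReal (R - r) ≤ ‖z - y‖ₑ := by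
        rw [← ofReal_norm]
        exact ENNReal.ofReal_le_ofReal h2
    _ ≤ C * g.length a c γ := h1.trans hηl
    _ ≤ C * g.length a b γ := by gcongr

end Paths

/-! ### Short horizontal curves in the Heisenberg group -/

namespace Heisenberg

variable {n : ℕ}

/-- The last coordinate of the horizontal curve `connectingCurve`. -/
def connectingHeight (i : Fin n) (p D : Heisenberg n) (u w s : ℝ) : ℝ :=
  -- Horizontality prescribes the derivative of the height; this is its primitive vanishing at 0.
  -- The loop profiles f = s - 3s² + 2s³ and h = 2s - 12s² + 20s³ - 10s⁴ are the derivatives of s²(1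
  -- - s)² / 2 and s²(1 - s)²(1 - 2s), so they vanish at both ends and have mean zero.
  -(theta n p D * s) - u * omega n p (EuclideanSpace.single (ix i) 1) * (s - 3 * s ^ 2 + 2 * s ^ 3)
    - w * omega n p (EuclideanSpace.single (iy i) 1) * (2 * s - 12 * s ^ 2 + 20 * s ^ 3 - 10 * s ^ 4)
    - u * omega n D (EuclideanSpace.single (ix i) 1) *
      (s * (s - 3 * s ^ 2 + 2 * s ^ 3) - s ^ 2 * (1 - s) ^ 2)
    - w * omega n D (EuclideanSpace.single (iy i) 1) *
      (s * (2 * s - 12 * s ^ 2 + 20 * s ^ 3 - 10 * s ^ 4) - 2 * s ^ 2 * (1 - s) ^ 2 * (1 - 2 * s))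
    - 2 * (u * w) * (-2 * s ^ 3 + 8 * s ^ 4 - 66 / 5 * s ^ 5 + 10 * s ^ 6 - 20 / 7 * s ^ 7)

/-- The derivative of `connectingHeight`. -/
def connectingHeightDeriv (i : Fin n) (p D : Heisenberg n) (u w s : ℝ) : ℝ :=
  -(theta n p D) - u * omega n p (EuclideanSpace.single (ix i) 1) * (1 - 6 * s + 6 * s ^ 2)
    - w * omega n p (EuclideanSpace.single (iy i) 1) * (2 - 24 * s + 60 * s ^ 2 - 40 * s ^ 3)
    - u * omega n D (EuclideanSpace.single (ix i) 1) *
      (s * (1 - 6 * s + 6 * s ^ 2) - (s - 3 * s ^ 2 + 2 * s ^ 3))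
    - w * omega n D (EuclideanSpace.single (iy i) 1) *
      (s * (2 - 24 * s + 60 * s ^ 2 - 40 * s ^ 3) - (2 * s - 12 * s ^ 2 + 20 * s ^ 3 - 10 * s ^ 4))
    - 2 * (u * w) * ((s - 3 * s ^ 2 + 2 * s ^ 3) * (2 - 24 * s + 60 * s ^ 2 - 40 * s ^ 3)
      - (2 * s - 12 * s ^ 2 + 20 * s ^ 3 - 10 * s ^ 4) * (1 - 6 * s + 6 * s ^ 2))

/-- A horizontal perturbation of the segment from `p` to `p + D`, by a loop of mean value zero in
the plane of the coordinates `x_i`, `y_i`. -/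
def connectingCurve (i : Fin n) (p D : Heisenberg n) (u w s : ℝ) : Heisenberg n :=
  p + s • D + (u * (s - 3 * s ^ 2 + 2 * s ^ 3)) • EuclideanSpace.single (ix i) (1 : ℝ)
    + (w * (2 * s - 12 * s ^ 2 + 20 * s ^ 3 - 10 * s ^ 4)) • EuclideanSpace.single (iy i) (1 : ℝ)
    + connectingHeight i p D u w s • EuclideanSpace.single it (1 : ℝ)

/-- The derivative of `connectingCurve`. -/
def connectingCurveDeriv (i : Fin n) (p D : Heisenberg n) (u w s : ℝ) : Heisenberg n :=
  D + (u * (1 - 6 * s + 6 * s ^ 2)) • EuclideanSpace.single (ix i) (1 : ℝ)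
    + (w * (2 - 24 * s + 60 * s ^ 2 - 40 * s ^ 3)) • EuclideanSpace.single (iy i) (1 : ℝ)
    + connectingHeightDeriv i p D u w s • EuclideanSpace.single it (1 : ℝ)

section

variable (i : Fin n) (p D : Heisenberg n) (u w : ℝ)

lemma contDiff_connectingCurve : ContDiff ℝ ∞ (connectingCurve i p D u w) := by
  unfold connectingCurve connectingHeight
  fun_prop

lemma hasDerivAt_connectingCurve (s : ℝ) :
    HasDerivAt (connectingCurve i p D u w) (connectingCurveDeriv i p D u w s) s := by
  have key : ∀ {f : ℝ → ℝ} {d d' : ℝ}, HasDerivAt f d s → d = d' → HasDerivAt f d' s := by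
    rintro f d _ h rfl
    exact h
  have h1 := hasDerivAt_id' s
  have hp : ∀ k : ℕ, HasDerivAt (fun s : ℝ ↦ s ^ k) (k * s ^ (k - 1)) s := fun k ↦ hasDerivAt_pow k s
  have hf : HasDerivAt (fun s : ℝ ↦ s - 3 * s ^ 2 + 2 * s ^ 3) (1 - 6 * s + 6 * s ^ 2) s :=
    key ((h1.sub ((hp 2).const_mul 3)).add ((hp 3).const_mul 2)) (by norm_num; ring)
  have hh : HasDerivAt (fun s : ℝ ↦ 2 * s - 12 * s ^ 2 + 20 * s ^ 3 - 10 * s ^ 4)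
      (2 - 24 * s + 60 * s ^ 2 - 40 * s ^ 3) s :=
    key ((((h1.const_mul 2).sub ((hp 2).const_mul 12)).add ((hp 3).const_mul 20)).sub
      ((hp 4).const_mul 10)) (by norm_num; ring)
  have h1s : HasDerivAt (fun s : ℝ ↦ 1 - s) (-1) s := h1.const_sub 1
  have h2s : HasDerivAt (fun s : ℝ ↦ 1 - 2 * s) (-(2 * 1)) s := (h1.const_mul 2).const_sub 1
  have hF := (hp 2).mul (h1s.pow 2)
  have hH := (((hp 2).const_mul 2).mul (h1s.pow 2)).mul h2s
  have hP : HasDerivAt (fun s : ℝ ↦ -2 * s ^ 3 + 8 * s ^ 4 - 66 / 5 * s ^ 5 + 10 * s ^ 6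
      - 20 / 7 * s ^ 7) ((s - 3 * s ^ 2 + 2 * s ^ 3) * (2 - 24 * s + 60 * s ^ 2 - 40 * s ^ 3)
      - (2 * s - 12 * s ^ 2 + 20 * s ^ 3 - 10 * s ^ 4) * (1 - 6 * s + 6 * s ^ 2)) s :=
    key ((((((hp 3).const_mul (-2)).add ((hp 4).const_mul 8)).sub ((hp 5).const_mul (66 / 5))).add
      ((hp 6).const_mul 10)).sub ((hp 7).const_mul (20 / 7))) (by norm_num; ring)
  have hτ : HasDerivAt (connectingHeight i p D u w) (connectingHeightDeriv i p D u w s) s := by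
    refine key (((((((h1.const_mul (theta n p D)).neg).sub (hf.const_mul _)).sub
      (hh.const_mul _)).sub (((h1.mul hf).sub hF).const_mul _)).sub
      (((h1.mul hh).sub hH).const_mul _)).sub (hP.const_mul _)) ?_
    unfold connectingHeightDeriv
    simp only [Pi.pow_apply]
    norm_num
    ring
  have := ((((hasDerivAt_const s p).add (h1.smul_const D)).add
    ((hf.const_mul u).smul_const (EuclideanSpace.single (ix i) (1 : ℝ)))).add
    ((hh.const_mul w).smul_const (EuclideanSpace.single (iy i) (1 : ℝ)))).add
    (hτ.smul_const (EuclideanSpace.single it (1 : ℝ)))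
  rw [zero_add, one_smul] at this
  exact this

lemma connectingCurveDeriv_mem (s : ℝ) :
    connectingCurveDeriv i p D u w s ∈ horizontal n (connectingCurve i p D u w s) := by
  have hT : ∀ v, omega n v (EuclideanSpace.single it 1) = 0 := by simp [omega_apply]
  have hT' : ∀ v, omega n (EuclideanSpace.single it 1) v = 0 := by simp [omega_apply]
  have hxx : omega n (EuclideanSpace.single (ix i) 1) (EuclideanSpace.single (ix i) 1) = 0 := by
    simp [omega_apply]
  have hyy : omega n (EuclideanSpace.single (iy i) 1) (EuclideanSpace.single (iy i) 1) = 0 := by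
    simp [omega_apply]
  have hxy : omega n (EuclideanSpace.single (ix i) 1) (EuclideanSpace.single (iy i) 1) = 2 := by
    simp [omega_apply]
  have hyx : omega n (EuclideanSpace.single (iy i) 1) (EuclideanSpace.single (ix i) 1) = -2 := by
    simp [omega_apply]
  have hDD : omega n D D = 0 := by
    rw [omega_apply]
    refine mul_eq_zero_of_right _ (Finset.sum_eq_zero fun i _ ↦ by ring)
  have hxD : omega n (EuclideanSpace.single (ix i) 1) D =
      -omega n D (EuclideanSpace.single (ix i) 1) := by
    simp [omega_apply]
  have hyD : omega n (EuclideanSpace.single (iy i) 1) D =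
      -omega n D (EuclideanSpace.single (iy i) 1) := by
    simp [omega_apply]
  rw [mem_horizontal_iff, theta_apply]
  have h1 : connectingCurveDeriv i p D u w s it = D it + connectingHeightDeriv i p D u w s := by
    simp [connectingCurveDeriv]
  rw [h1, connectingHeightDeriv, theta_apply]
  simp only [connectingCurve, connectingCurveDeriv, map_add, map_smul, add_apply, smul_apply,
    smul_eq_mul, hT, hT', hxx, hyy, hxy, hyx, hDD, hxD, hyD]
  ring

lemma connectingCurve_zero : connectingCurve i p D u w 0 = p := by
  simp [connectingCurve, connectingHeight]

/-- At s = 1 the terms coupling the loop with p vanish because f and h do, and those coupling it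
with D because f and h also have mean zero. The height is then -θ_p(D) - 2uw ∫ (f h' - h f'), where
the integral is -2/35; this gives the factor 35/4. -/
lemma connectingCurve_one (h : u * w = 35 / 4 * theta n p D) :
    connectingCurve i p D u w 1 = p + D := by
  have h1 : connectingHeight i p D u w 1 = 0 := by
    rw [connectingHeight, h]
    ring
  rw [connectingCurve, h1]
  norm_num

end

/-- Nearby points of the Heisenberg group are joined by short horizontal curves. -/
theorem exists_short_horizontalCurve (hn : 1 ≤ n) (p₀ : Heisenberg n) {R : ℝ} (hR : 0 < R) :
    ∃ r > 0, ∀ p ∈ Metric.ball p₀ r, ∀ q ∈ Metric.ball p₀ r, ∃ η : ℝ → Heisenberg n,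
      IsHorizontalCurve 0 1 η ∧ η 0 = p ∧ η 1 = q ∧
      MapsTo η (Icc 0 1) (Metric.closedBall p₀ R) ∧ curveLength 0 1 η ≤ 1 := by
  let i : Fin n := ⟨0, hn⟩
  let A : Heisenberg n × Heisenberg n → ℝ := fun z ↦ 35 / 4 * theta n z.1 (z.2 - z.1)
  have hA : Continuous A := continuous_const.mul
    ((contDiff_theta.continuous.comp continuous_fst).clm_apply (continuous_snd.sub continuous_fst))
  -- `√` vanishes on negative numbers, so u w = A⁺ - A⁻ = A for either sign of A, with both factors
  -- continuous and zero where A is.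
  let u : Heisenberg n × Heisenberg n → ℝ := fun z ↦ √(A z) + √(-A z)
  let w : Heisenberg n × Heisenberg n → ℝ := fun z ↦ √(A z) - √(-A z)
  have hu : Continuous u := hA.sqrt.add hA.neg.sqrt
  have hw : Continuous w := hA.sqrt.sub hA.neg.sqrt
  have huw : ∀ z, u z * w z = A z := by
    intro z
    have h1 : u z * w z = √(A z) ^ 2 - √(-A z) ^ 2 := by ring
    rw [h1]
    rcases le_total 0 (A z) with h | h
    · rw [Real.sq_sqrt h, Real.sqrt_eq_zero_of_nonpos (by linarith)]
      ring
    · rw [Real.sqrt_eq_zero_of_nonpos h, Real.sq_sqrt (neg_nonneg.2 h)]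
      ring
  let c : Heisenberg n × Heisenberg n → ℝ → Heisenberg n := fun z s ↦
    connectingCurve i z.1 (z.2 - z.1) (u z) (w z) s
  let c' : Heisenberg n × Heisenberg n → ℝ → Heisenberg n := fun z s ↦
    connectingCurveDeriv i z.1 (z.2 - z.1) (u z) (w z) s
  have hc : Continuous fun z : (Heisenberg n × Heisenberg n) × ℝ ↦ c z.1 z.2 := by
    have hθ : Continuous (theta n) := contDiff_theta.continuous
    simp only [c, connectingCurve, connectingHeight]
    fun_prop
  have hc' : Continuous fun z : (Heisenberg n × Heisenberg n) × ℝ ↦ c' z.1 z.2 := by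
    have hθ : Continuous (theta n) := contDiff_theta.continuous
    simp only [c', connectingCurveDeriv, connectingHeightDeriv]
    fun_prop
  have hA0 : A (p₀, p₀) = 0 := by simp [A]
  have hu0 : u (p₀, p₀) = 0 := by simp [u, hA0]
  have hw0 : w (p₀, p₀) = 0 := by simp [w, hA0]
  have hc0 : ∀ s, c (p₀, p₀) s = p₀ := by
    intro s
    simp [c, hu0, hw0, connectingCurve, connectingHeight]
  have hc0' : ∀ s, c' (p₀, p₀) s = 0 := by
    intro s
    simp [c', hu0, hw0, connectingCurveDeriv, connectingHeightDeriv]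
  -- For p = q = p₀ the curve is constant. Joint continuity and compactness of [0, 1] keep it in the
  -- ball, with speed below 1, for all nearby end points.
  have hev : ∀ᶠ z in 𝓝 (p₀, p₀), ∀ s ∈ Icc (0 : ℝ) 1, c z s ∈ Metric.ball p₀ R ∧ ‖c' z s‖ < 1 := by
    refine isCompact_Icc.eventually_forall_of_forall_eventually fun s _ ↦ ?_
    refine (hc.continuousAt.eventually_mem (Metric.isOpen_ball.mem_nhds ?_)).and
      (hc'.norm.continuousAt.eventually_lt continuousAt_const ?_)
    · change c (p₀, p₀) s ∈ _
      rw [hc0]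
      exact Metric.mem_ball_self hR
    · change ‖c' (p₀, p₀) s‖ < 1
      rw [hc0', norm_zero]
      exact one_pos
  obtain ⟨r, hr, hball⟩ := Metric.eventually_nhds_iff_ball.1 hev
  refine ⟨r, hr, fun p hp q hq ↦ ?_⟩
  have hpq := hball (p, q) (by rw [← ball_prod_same]; exact ⟨hp, hq⟩)
  have hd : ∀ s ∈ Icc (0 : ℝ) 1, derivWithin (c (p, q)) (Icc 0 1) s = c' (p, q) s := fun s hs ↦
    (hasDerivAt_connectingCurve i _ _ _ _ s).hasDerivWithinAt.derivWithin
      (uniqueDiffOn_Icc one_pos s hs)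
  refine ⟨c (p, q), ⟨one_pos, (contDiff_connectingCurve i _ _ _ _).contDiffOn, fun s hs ↦ ?_⟩,
    connectingCurve_zero i _ _ _ _, ?_, fun s hs ↦ Metric.ball_subset_closedBall (hpq s hs).1, ?_⟩
  · rw [hd s hs]
    exact connectingCurveDeriv_mem i _ _ _ _ s
  · refine (connectingCurve_one i _ _ _ _ (huw (p, q))).trans ?_
    simp
  · calc curveLength 0 1 (c (p, q)) ≤ ∫⁻ _ in Icc (0 : ℝ) 1, 1 := by
          refine setLIntegral_mono' measurableSet_Icc fun s hs ↦ ?_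
          rw [hd s hs, ← ofReal_norm, ← ENNReal.ofReal_one]
          exact ENNReal.ofReal_le_ofReal (hpq s hs).2.le
      _ = 1 := by simp

end Heisenberg

/-! ### Comparison of the Carnot–Carathéodory distances -/

section Distance

variable {n : ℕ} {E E' : Type} [NormedAddCommGroup E] [NormedSpace ℝ E]
  [NormedAddCommGroup E'] [NormedSpace ℝ E']
  {M : Type*} [TopologicalSpace M] [ChartedSpace E M] [IsManifold 𝓘(ℝ, E) ∞ M]
  {M' : Type*} [TopologicalSpace M'] [ChartedSpace E' M'] [IsManifold 𝓘(ℝ, E') ∞ M']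
  {ξ : ∀ p : M, Submodule ℝ (TangentSpace 𝓘(ℝ, E) p)}
  {ξ' : ∀ p : M', Submodule ℝ (TangentSpace 𝓘(ℝ, E') p)}
  {φ : Heisenberg n → M} {ψ : M → Heisenberg n} {φ' : Heisenberg n → M'} {ψ' : M' → Heisenberg n}

/-- The extra 1 keeps the factor nonzero, so that dividing by it in `ℝ≥0∞` is legitimate even if no
path exists and the distance is ∞. -/
lemma SubRiemannianMetric.le_mul_ccDist (g : SubRiemannianMetric 𝓘(ℝ, E) ξ) {p q : M} {D : ℝ≥0∞}
    {L : ℝ≥0} (h : ∀ (a b : ℝ) (γ : ℝ → M), IsHorizontalPath 𝓘(ℝ, E) ξ a b γ → γ a = p → γ b = q →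
      D ≤ L * g.length a b γ) : D ≤ (L + 1 : ℝ≥0) * g.ccDist p q := by
  have h0 : ((L + 1 : ℝ≥0) : ℝ≥0∞) ≠ 0 := by
    rw [Ne, ENNReal.coe_eq_zero]
    positivity
  rw [mul_comm, ← ENNReal.div_le_iff h0 ENNReal.coe_ne_top]
  refine le_sInf ?_
  rintro ℓ ⟨a, b, γ, hγ, ha, hb, rfl⟩
  rw [ENNReal.div_le_iff h0 ENNReal.coe_ne_top, mul_comm]
  exact (h a b γ hγ ha hb).trans (by gcongr; exact le_add_of_nonneg_right zero_le_one)

/-- Two embeddings of the Heisenberg group which identify the distributions induce locally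
comparable distances. -/
theorem exists_ccDist_le [T2Space M] (hn : 1 ≤ n) (hφ : IsOpenSmoothEmbedding E φ ψ)
    (hD : ∀ x v : Heisenberg n, mfderiv 𝓘(ℝ, Heisenberg n) 𝓘(ℝ, E) φ x v ∈ ξ (φ x) ↔
      v ∈ Heisenberg.horizontal n x)
    (g : SubRiemannianMetric 𝓘(ℝ, E) ξ) (hφ' : IsOpenSmoothEmbedding E' φ' ψ')
    (hD' : ∀ x v : Heisenberg n, mfderiv 𝓘(ℝ, Heisenberg n) 𝓘(ℝ, E') φ' x v ∈ ξ' (φ' x) ↔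
      v ∈ Heisenberg.horizontal n x)
    (g' : SubRiemannianMetric 𝓘(ℝ, E') ξ') (p₀ : Heisenberg n) :
    ∃ r > 0, ∃ L : ℝ≥0, ∀ x ∈ Metric.ball p₀ r, ∀ y ∈ Metric.ball p₀ r,
      g'.ccDist (φ' x) (φ' y) ≤ L * g.ccDist (φ x) (φ y) := by
  obtain ⟨C, hC⟩ := exists_speed_comparison hφ hD g (isCompact_closedBall p₀ 1)
  obtain ⟨C', hC'⟩ := exists_speed_comparison hφ' hD' g' (isCompact_closedBall p₀ 1)
  obtain ⟨r, hr, hshort⟩ := Heisenberg.exists_short_horizontalCurve hn p₀ one_pos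
  -- A path that starts within 1/2 of p₀ and leaves the image of the unit ball has C · length ≥ 1/2,
  -- whereas a short curve bounds the distance by C'. This explains the 2; the + 1 comes from
  -- `SubRiemannianMetric.le_mul_ccDist`.
  refine ⟨min r (1 / 2), lt_min hr (by norm_num), 2 * (C' * C) + 1, fun x hx y hy ↦
    g.le_mul_ccDist fun a b γ hγ hγa hγb ↦ ?_⟩
  have hxr := Metric.ball_subset_ball (min_le_left _ _) hx
  have hyr := Metric.ball_subset_ball (min_le_left _ _) hy
  have hx2 : dist x p₀ ≤ 1 / 2 := (lt_min_iff.1 (Metric.mem_ball.1 hx)).2.le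
  have key : ∀ (a b : ℝ) (η : ℝ → Heisenberg n), Heisenberg.IsHorizontalCurve a b η → η a = x →
      η b = y → MapsTo η (Icc a b) (Metric.closedBall p₀ 1) →
      g'.ccDist (φ' x) (φ' y) ≤ C' * Heisenberg.curveLength a b η := by
    intro a b η hη ha hb hm
    obtain ⟨h1, h2⟩ := hφ'.isHorizontalPath_comp hD' g' hC' hη hm
    have h3 : g'.ccDist (φ' x) (φ' y) ≤ g'.length a b (φ' ∘ η) :=
      sInf_le ⟨a, b, _, h1, congrArg φ' ha, congrArg φ' hb, rfl⟩
    exact h3.trans h2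
  push_cast
  by_cases hm : MapsTo γ (Icc a b) (φ '' Metric.ball p₀ 1)
  · obtain ⟨h1, h2, h3⟩ := hφ.isHorizontalCurve_comp hD g hC hγ
      (hm.mono_right (image_mono Metric.ball_subset_closedBall))
    have h4 := key a b _ h1 (by rw [Function.comp_apply, hγa, hφ.leftInverse])
      (by rw [Function.comp_apply, hγb, hφ.leftInverse]) h2
    calc g'.ccDist (φ' x) (φ' y) ≤ C' * (C * g.length a b γ) := h4.trans (by gcongr)
      _ = 1 * (C' * C) * g.length a b γ := by ring
      _ ≤ 2 * (C' * C) * g.length a b γ := by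
        gcongr
        exact one_le_two
  · have h1 := hφ.le_length_of_not_mapsTo hD g hC hγ hγa hx2 (by norm_num) hm
    obtain ⟨η, hη, h0, h1', hηm, hηl⟩ := hshort x hxr y hyr
    have h2 := key 0 1 η hη h0 h1' hηm
    have h3 : (1 : ℝ≥0∞) = 2 * ENNReal.ofReal (1 - 1 / 2) := by
      rw [← ENNReal.ofReal_ofNat, ← ENNReal.ofReal_mul (by norm_num)]
      norm_num
    calc g'.ccDist (φ' x) (φ' y) ≤ C' * 1 := h2.trans (by gcongr)
      _ = C' * (2 * ENNReal.ofReal (1 - 1 / 2)) := by rw [← h3]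
      _ ≤ C' * (2 * (C * g.length a b γ)) := by gcongr
      _ = 2 * (C' * C) * g.length a b γ := by ring

end Distance

namespace Heisenberg

variable {n : ℕ}

lemma isOpenSmoothEmbedding_id :
    IsOpenSmoothEmbedding (Heisenberg n) (id : Heisenberg n → Heisenberg n) id :=
  ⟨contMDiff_id, IsOpenMap.id, fun _ ↦ rfl, contMDiffOn_id⟩

lemma mfderiv_id_mem_iff (x v : Heisenberg n) :
    mfderiv 𝓘(ℝ, Heisenberg n) 𝓘(ℝ, Heisenberg n) (id : Heisenberg n → Heisenberg n) x v ∈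
      distribution n (id x) ↔ v ∈ horizontal n x := by
  rw [mfderiv_id]
  rfl

/-- Open balls are open for the Carnot–Carathéodory distance. -/
lemma isOpenForDist_ball (p₀ : Heisenberg n) (r : ℝ) :
    IsOpenForDist (metric n).ccDist (Metric.ball p₀ r) := by
  intro x hx
  have hR : 0 < r - dist x p₀ := sub_pos.2 hx
  obtain ⟨C, hC⟩ := exists_speed_comparison isOpenSmoothEmbedding_id mfderiv_id_mem_iff (metric n)
    (isCompact_closedBall x (r - dist x p₀))
  refine ⟨ENNReal.ofReal (r - dist x p₀) / (C + 1 : ℝ≥0), ENNReal.div_pos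
    (ENNReal.ofReal_pos.2 hR).ne' ENNReal.coe_ne_top, fun y hy ↦ ?_⟩
  by_contra hyr
  refine absurd hy (not_lt.2 (ENNReal.div_le_of_le_mul' ((metric n).le_mul_ccDist
    fun a b γ hγ ha hb ↦ ?_)))
  -- A path from x to a point outside the ball around p₀ leaves the ball of radius r - dist x p₀
  -- around x, so its length is bounded below.
  have h := isOpenSmoothEmbedding_id.le_length_of_not_mapsTo mfderiv_id_mem_iff (metric n) (r := 0)
    hC hγ ha (dist_self x).le hR fun hm ↦ ?_
  · rwa [sub_zero] at h
  · obtain ⟨z, hz, hzb⟩ := hm (right_mem_Icc.2 hγ.lt.le)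
    rw [hb, id] at hzb
    rw [hzb, Metric.mem_ball] at hz
    apply hyr
    rw [Metric.mem_ball]
    linarith [dist_triangle y x p₀]

end Heisenberg

end

theorem corollary2 (n : ℕ) (hn : 1 ≤ n)
    {M : Type*} [TopologicalSpace M] [T2Space M] [SecondCountableTopology M] [ConnectedSpace M]
    [ChartedSpace (EuclideanSpace ℝ (Fin (2 * n + 1))) M]
    [IsManifold 𝓘(ℝ, EuclideanSpace ℝ (Fin (2 * n + 1))) ∞ M]
    (ξ : ∀ p : M, Submodule ℝ (TangentSpace 𝓘(ℝ, EuclideanSpace ℝ (Fin (2 * n + 1))) p))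
    (hξ : IsContactStructure 𝓘(ℝ, EuclideanSpace ℝ (Fin (2 * n + 1))) ξ n)
    (g : SubRiemannianMetric 𝓘(ℝ, EuclideanSpace ℝ (Fin (2 * n + 1))) ξ)
    (p : M) :
    ∃ φ : Heisenberg n → M,
      IsOpenDistributionalEmbedding 𝓘(ℝ, EuclideanSpace ℝ (Fin (2 * n + 1)))
        𝓘(ℝ, Heisenberg n) (Heisenberg.distribution n) ξ φ ∧
      φ 0 = p ∧
      IsLocallyBiLipschitz (Heisenberg.metric n).ccDist g.ccDist φ := by
  have hE : Module.finrank ℝ (EuclideanSpace ℝ (Fin (2 * n + 1))) = 2 * n + 1 := by simp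
  obtain ⟨φ, ψ, hφ, hemb, hp⟩ := hξ.exists_embedding hE p
  have hD := mfderiv_mem_iff hφ hξ.isDistribution hemb.distributional
  refine ⟨φ, hemb, hp, Function.LeftInverse.injective hφ.leftInverse, fun x ↦ ?_⟩
  -- The group is parametrised by the identity and its image by φ; exchanging their roles gives the
  -- two Lipschitz bounds.
  obtain ⟨r, hr, L, hL⟩ := exists_ccDist_le hn Heisenberg.isOpenSmoothEmbedding_id
    Heisenberg.mfderiv_id_mem_iff (Heisenberg.metric n) hφ hD g x
  obtain ⟨r', hr', L', hL'⟩ := exists_ccDist_le hn hφ hD g Heisenberg.isOpenSmoothEmbedding_id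
    Heisenberg.mfderiv_id_mem_iff (Heisenberg.metric n) x
  have hsub := Metric.ball_subset_ball (x := x) (min_le_left r r')
  have hsub' := Metric.ball_subset_ball (x := x) (min_le_right r r')
  exact ⟨Metric.ball x (min r r'), Metric.isOpen_ball, Heisenberg.isOpenForDist_ball _ _,
    Metric.mem_ball_self (lt_min hr hr'), ⟨L, fun y hy z hz ↦ hL y (hsub hy) z (hsub hz)⟩,
    (Function.LeftInverse.injective hφ.leftInverse).injOn,
    L', fun y hy z hz ↦ hL' y (hsub' hy) z (hsub' hz)⟩
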